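/- **Setting.** For $w\in\mathbb R^3$ let $w^\times$ be the skew matrix with $w^\times v=w\times v$, and for a unit vector $y$ let $\Pi_y=I_3-yy^\top$. For $P\in\mathbf{SE}(3)$ write $R_P,x_P$ for its rotation and translation parts, and for $U\in\mathfrak{se}(3)$ write $U=(\Omega_U^\times,V_U)$. Let $\mathcal T_n=\{(P,p_1,\dots,p_n)\in\mathbf{SE}(3)\times(\mathbb R^3)^n : p_i\ne x_P\}$, with $(P,p_i)\simeq(P',p_i')$ iff $(P,p_i)=(S^{-1}P',R_S^\top(p_i'-x_S))$ for some $S\in\mathbf{SE}(3)$. The outputs are $h^i(P,p)=R_P^\top(p_i-x_P)/\|p_i-x_P\|\in\mathrm S^2$. The group $G=\mathbf{SE}(3)\times(\mathbf{SO}(3)\times\mathbb R_{>0})^n$ acts on $\mathcal T_n$ and on $(\mathrm S^2)^n$ from the right by $$\Upsilon((A,(Q,a)_i),(P,p_i))=(PA,\ a_i^{-1}R_{PA}Q_i^\top R_P^\top(p_i-x_P)+x_{PA}),\qquad \rho((A,(Q,a)_i),y_i)=Q_i^\top y_i ,$$ and, with $q_i=R_P^\top(p_i-x_P)$, the lift is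 $$\Lambda((P,p_i),U)=\Big(U,\Big(\big(\Omega_U+\tfrac{q_i\times V_U}{|q_i|^2}\big)^\times,\ \tfrac{q_i^\top V_U}{|q_i|^2}\Big)_i\Big).$$ Fix $\mathring\xi=(\mathring P,\mathring p_i)\in\mathcal T_n$, put $\mathring y_i=h^i(\mathring\xi)$, and fix $0<\underline r<\overline r$ and gains $k_i,\alpha_i>0$. Let $\xi=(P,p_i)$ be a trajectory in $\mathcal T_n$ on $[0,\infty)$ of $\dot P=PU$, $\dot p_i=0$, with $y_i=h^i(\xi)$ and $r_i=\|p_i-x_P\|$. Assume that - $U$ is continuous and bounded on $[0,\infty)$, and $V_U$ is uniformly continuous there; - $\underline r\le r_i(t)\le\overline r$ for all $t\ge0$ and all $i$; - for each $i$ there are $T,\mu>0$ with $\frac1T\int_t^{t+T}\|y_i^\times y_i^\times V_U\|\,d\tau\ge\mu$ for all $t>0$. **Observer.** The observer state is $\hat X=(\hat A,(\hat Q,\hat a)_i)\in G$, with $\hat\xi=(\hat P,\hat p_i)=\Upsilon(\hat X,\mathring\xi)$ and $$\dot{\hat X}=\hat X\Lambda(\hat\xi,U)-\Delta_{\hat X}\hat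 X,\qquad \Delta_{\hat X}=(\Delta,(\Gamma,\gamma)_i),$$ where $\Delta\in\mathfrak{se}(3)$ is an arbitrary function of $\hat X$, $y$ and $U$. Put $\delta_i=\rho(\hat X^{-1},y)_i=\hat Q_iy_i$, $\hat r_i=\|\hat p_i-x_{\hat P}\|$, $\tilde r_i=\hat r_i/r_i$ and, for a gain $k_0>0$, $\epsilon=\min(k_0,\frac12)\underline r$. Let $\beta(\hat r)=\frac{(\hat r-\underline r)^2}{(\underline r-\epsilon)^2(\hat r-\epsilon)}$ for $\epsilon<\hat r<\underline r$ and $\beta(\hat r)=0$ for $\hat r\ge\underline r$. Where $\hat r_i>\epsilon$ and $\delta_i\ne-\mathring y_i$, let $$\Gamma_i=\Big(\tfrac{\delta_i^\top\hat Q_iV_U}{2\hat r_i}-\tfrac{(\delta_i+\mathring y_i)^\top\hat Q_iV_U}{\hat r_i(1+\delta_i^\top\mathring y_i)}-k_i\Big)(\delta_i^\times\mathring y_i)^\times,$$ $$\gamma_i=\tfrac{\alpha_i}{\hat r_i^2}\Big(\tfrac{1-\delta_i^\top\mathring y_i}{2(1+\delta_i^\top\mathring y_i)}\delta_i^\top\hat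 Q_iV_U-\tfrac{\mathring y_i^\top\Pi_{\delta_i}\hat Q_iV_U}{(1+\delta_i^\top\mathring y_i)^2}\Big)+\tfrac1{\hat r_i}(\mathring y_i-\delta_i)^\top\hat Q_iV_U+\tfrac{\alpha_i}{\hat r_i}\beta(\hat r_i).$$ **Theorem.** The exception set $\chi=\{(\delta,\tilde r)_i\in(\mathrm S^2\times\mathbb R_{>0})^n:\delta_i=-\mathring y_i\text{ for some }i\}$ has measure zero, and for every compact $K\subset(\mathrm S^2\times\mathbb R_{>0})^n\setminus\chi$ there is $k_0>0$ such that for every $(\xi,U)$ as above the following hold. 1. $(\mathring y_i,1)_i$ is an asymptotically stable equilibrium of the dynamics of the error $(\delta_i,\tilde r_i)_i$ with basin of attraction containing $K$. That is, it is Lyapunov stable, and for every initial observer state $\hat X(0)$ with error in $K$, or in some neighbourhood of the equilibrium, the landmark components $(\hat Q_i,\hat a_i)$ are uniquely defined for all $t\ge0$ independently of $\Delta$, and $(\delta_i,\tilde r_i)(t)\to(\mathring y_i,1)$ as $t\to\infty$ for every observer solution on $[0,\infty)$. 2. For every observer solution on $[0,\infty)$ with $(\delta_i,\tilde r_i)\to(\mathring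 y_i,1)$, the estimate $\hat\xi$ converges to $\xi$ up to $\simeq$: there are $\zeta(t)\simeq\hat\xi(t)$ with $\zeta(t)-\xi(t)\to0$. 3. If $X$ solves the lifted system $\dot X=X\Lambda(\Upsilon(X,\mathring\xi),U)$ with $\Upsilon(X(0),\mathring\xi)=\xi(0)$, then $\rho(\hat X^{-1},y)=\rho(X\hat X^{-1},\mathring y)$ for all $t\ge0$. -/

import Mathlib

open MeasureTheory Set Filter Topology

noncomputable section

namespace VSLAM

/-- Euclidean three-space. -/
abbrev E3 := EuclideanSpace ℝ (Fin 3)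

abbrev Mat3 := Matrix (Fin 3) (Fin 3) ℝ

abbrev SO3 := Matrix.specialOrthogonalGroup (Fin 3) ℝ

/-- The unit sphere of `ℝ³`. -/
abbrev S2 := Metric.sphere (0 : E3) 1

/-- The multiplicative group of positive reals. -/
abbrev MR := {a : ℝ // 0 < a}

/-- Matrix acting on a vector. -/
def act (M : Mat3) (v : E3) : E3 := WithLp.toLp 2 (M.mulVec v.ofLp)

/-- The skew-symmetric matrix `Ω^×`. -/
def skew (w : E3) : Mat3 :=
  !![0, -w 2, w 1; w 2, 0, -w 0; -w 1, w 0, 0]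

/-- Cross product `u × v = u^× v`. -/
def cross (u v : E3) : E3 := act (skew u) v

/-- Orthogonal projector `Π_y v = v - (yᵀ v) y` for a unit vector `y`. -/
def proj (y v : E3) : E3 := v - inner ℝ y v • y

theorem act_one (v : E3) : act 1 v = v := by simp [act]

theorem act_mul (M N : Mat3) (v : E3) : act (M * N) v = act M (act N v) := by
  simp [act, Matrix.mulVec_mulVec]

theorem act_add (M : Mat3) (v w : E3) : act M (v + w) = act M v + act M w := by
  simp [act, Matrix.mulVec_add]

theorem act_neg (M : Mat3) (v : E3) : act M (-v) = -act M v := by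
  simp [act, Matrix.mulVec_neg]

theorem norm_act_transpose (Q : SO3) (v : E3) : ‖act (Q : Mat3).transpose v‖ = ‖v‖ := by
  have hQ : (Q : Mat3) * (Q : Mat3).transpose = 1 :=
    (Matrix.mem_orthogonalGroup_iff (Fin 3) ℝ).1
      (Matrix.mem_specialOrthogonalGroup_iff.1 Q.2).1
  have h : ‖act (Q : Mat3).transpose v‖ ^ 2 = ‖v‖ ^ 2 := by
    rw [EuclideanSpace.real_norm_sq_eq, EuclideanSpace.real_norm_sq_eq]
    have : ((Q : Mat3).transpose.mulVec v.ofLp) ⬝ᵥ ((Q : Mat3).transpose.mulVec v.ofLp)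
        = v.ofLp ⬝ᵥ v.ofLp := by
      rw [Matrix.dotProduct_mulVec, Matrix.vecMul_transpose, Matrix.mulVec_mulVec, hQ,
        Matrix.one_mulVec]
    simpa [act, dotProduct, pow_two] using this
  exact (sq_eq_sq₀ (norm_nonneg _) (norm_nonneg _)).1 h

/-- An element of `SE(3)`: rotation part `R` and translation part `x`. -/
@[ext] structure SE3 where
  R : SO3
  x : E3

/-- The homogeneous matrix `[R x; 0 1]`. -/
def SE3.toMatrix (P : SE3) : Matrix (Fin 3 ⊕ Unit) (Fin 3 ⊕ Unit) ℝ :=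
  Matrix.fromBlocks (P.R : Mat3) (Matrix.of fun i _ => P.x i) 0 1

/-- The group structure of `SE(3)`, that of the homogeneous matrices (`SE3.toMatrix_mul`). -/
instance : Group SE3 where
  mul P S := ⟨P.R * S.R, act P.R S.x + P.x⟩
  one := ⟨1, 0⟩
  inv P := ⟨P.R⁻¹, -act (P.R⁻¹ : SO3) P.x⟩
  mul_assoc P S T := by
    refine SE3.ext (mul_assoc _ _ _) ?_
    change act ((P.R * S.R : SO3) : Mat3) T.x + (act P.R S.x + P.x)
      = act P.R (act S.R T.x + S.x) + P.x
    rw [Submonoid.coe_mul, act_mul, act_add, add_assoc]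
  one_mul P := by
    refine SE3.ext (one_mul _) ?_
    change act ((1 : SO3) : Mat3) P.x + 0 = P.x
    rw [Submonoid.coe_one, act_one, add_zero]
  mul_one P := by
    refine SE3.ext (mul_one _) ?_
    change act (P.R : Mat3) 0 + P.x = P.x
    simp [act]
  inv_mul_cancel P := by
    refine SE3.ext (inv_mul_cancel _) ?_
    change act ((P.R⁻¹ : SO3) : Mat3) P.x + -act ((P.R⁻¹ : SO3) : Mat3) P.x = 0
    exact add_neg_cancel _

theorem SE3.toMatrix_mul (P S : SE3) : (P * S).toMatrix = P.toMatrix * S.toMatrix := by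
  change Matrix.fromBlocks ((P.R * S.R : SO3) : Mat3)
    (Matrix.of fun i _ => (act P.R S.x + P.x) i) 0 1 = _
  simp only [SE3.toMatrix, Matrix.fromBlocks_multiply]
  congr 1
  · simp
  · ext i j
    simp [act, Matrix.mul_apply, Matrix.mulVec, dotProduct]
  · simp
  · simp

/-- An element of `𝔰𝔢(3)`: angular velocity `Ω` and linear velocity `V`. -/
@[ext] structure Twist where
  Ω : E3
  V : E3

instance : Zero Twist := ⟨⟨0, 0⟩⟩

/-- The matrix `[Ω^× V; 0 0]`. -/
def Twist.toMatrix (U : Twist) : Matrix (Fin 3 ⊕ Unit) (Fin 3 ⊕ Unit) ℝ :=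
  Matrix.fromBlocks (skew U.Ω) (Matrix.of fun i _ => U.V i) 0 0

/-- The total space: a pose and `n` landmarks, none collocated with the robot. -/
structure TotalSpace (n : ℕ) where
  P : SE3
  p : Fin n → E3
  ne : ∀ i, p i ≠ P.x

variable {n : ℕ}

/-- Equality up to a rigid change `S` of the reference frame. -/
def SlamEquiv (ξ ξ' : TotalSpace n) : Prop :=
  ∃ S : SE3, ξ.P = S⁻¹ * ξ'.P ∧
    ∀ i, ξ.p i = act (S.R : Mat3).transpose (ξ'.p i - S.x)

/-- Ego-centric landmark coordinates `R_Pᵀ (p_i - x_P)`. -/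
def ego (ξ : TotalSpace n) (i : Fin n) : E3 :=
  act (ξ.P.R : Mat3).transpose (ξ.p i - ξ.P.x)

/-- The range `‖p_i - x_P‖`. -/
def range (ξ : TotalSpace n) (i : Fin n) : ℝ := ‖ξ.p i - ξ.P.x‖

theorem range_pos (ξ : TotalSpace n) (i : Fin n) : 0 < range ξ i :=
  norm_pos_iff.2 (sub_ne_zero.2 (ξ.ne i))

/-- The bearing outputs `R_Pᵀ (p_i - x_P) / ‖p_i - x_P‖`. -/
def output (ξ : TotalSpace n) (i : Fin n) : S2 :=
  ⟨(range ξ i)⁻¹ • ego ξ i, by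
    have h := range_pos ξ i
    rw [mem_sphere_zero_iff_norm, norm_smul, norm_inv, Real.norm_eq_abs, abs_of_pos h]
    unfold ego
    rw [norm_act_transpose]
    exact inv_mul_cancel₀ h.ne'⟩

/-- The group `SE(3) × (SO(3) × MR(1))ⁿ` with the product group structure. -/
abbrev Grp (n : ℕ) := SE3 × (Fin n → SO3 × MR)

/-- Its Lie algebra; the `𝔰𝔬(3)` components are written as matrices. -/
abbrev Alg (n : ℕ) := Twist × (Fin n → Mat3 × ℝ)

/-- The right action `Υ` on the total space. -/
def upsilon (X : Grp n) (ξ : TotalSpace n) : TotalSpace n where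
  P := ξ.P * X.1
  p i := ((X.2 i).2 : ℝ)⁻¹ •
      act ((ξ.P * X.1).R : Mat3) (act ((X.2 i).1 : Mat3).transpose (ego ξ i)) + (ξ.P * X.1).x
  ne i := by
    intro h
    have h0 := add_eq_right.1 h
    rw [smul_eq_zero] at h0
    rcases h0 with h0 | h0
    · exact (inv_pos.2 (X.2 i).2.2).ne' h0
    · have key : ∀ v : E3, act ((ξ.P * X.1).R : Mat3) v = 0 → v = 0 := by
        intro v hv
        have e : act ((ξ.P * X.1).R : Mat3).transpose (act ((ξ.P * X.1).R : Mat3) v) = v := by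
          rw [← act_mul]
          have := (Matrix.mem_orthogonalGroup_iff' (Fin 3) ℝ).1
            (Matrix.mem_specialOrthogonalGroup_iff.1 (ξ.P * X.1).R.2).1
          rw [show ((ξ.P * X.1).R : Mat3).transpose * ((ξ.P * X.1).R : Mat3) = 1 from this,
            act_one]
        rw [← e, hv]
        simp [act]
      have h1 := key _ h0
      have h2 : ‖act ((X.2 i).1 : Mat3).transpose (ego ξ i)‖ = range ξ i := by
        rw [norm_act_transpose]
        exact norm_act_transpose _ _
      rw [h1, norm_zero] at h2
      exact (range_pos ξ i).ne h2

/-- The right action `ρ` on the outputs, `y_i ↦ Q_iᵀ y_i`. -/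
def rho (X : Grp n) (y : Fin n → S2) (i : Fin n) : S2 :=
  ⟨act ((X.2 i).1 : Mat3).transpose (y i), by
    rw [mem_sphere_zero_iff_norm, norm_act_transpose]
    exact mem_sphere_zero_iff_norm.1 (y i).2⟩

/-- The velocity lift `Λ`. -/
def lift (ξ : TotalSpace n) (U : Twist) : Alg n :=
  (U, fun i =>
    (skew (U.Ω + (‖ego ξ i‖ ^ 2)⁻¹ • cross (ego ξ i) U.V),
      inner ℝ (ego ξ i) U.V / ‖ego ξ i‖ ^ 2))

/-- `d/dt X = X W - D X` at time `t`, relative to the time set `J`. -/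
def HasGroupDeriv (X : ℝ → Grp n) (W D : Alg n) (J : Set ℝ) (t : ℝ) : Prop :=
  HasDerivWithinAt (fun s => (X s).1.toMatrix)
      ((X t).1.toMatrix * W.1.toMatrix - D.1.toMatrix * (X t).1.toMatrix) J t ∧
    ∀ i, HasDerivWithinAt (fun s => (((X s).2 i).1 : Mat3))
        (((X t).2 i).1 * (W.2 i).1 - (D.2 i).1 * ((X t).2 i).1) J t ∧
      HasDerivWithinAt (fun s => (((X s).2 i).2 : ℝ))
        (((X t).2 i).2 * (W.2 i).2 - (D.2 i).2 * ((X t).2 i).2) J t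

/-- The kinematics `d/dt (P, p_i) = (P U, 0)` on `[0, ∞)`. -/
def IsSystemTrajectory (U : ℝ → Twist) (ξ : ℝ → TotalSpace n) : Prop :=
  ∀ t ∈ Ici (0 : ℝ),
    HasDerivWithinAt (fun s => (ξ s).P.toMatrix) ((ξ t).P.toMatrix * (U t).toMatrix) (Ici 0) t ∧
    ∀ i, HasDerivWithinAt (fun s => (ξ s).p i) 0 (Ici 0) t

/-- The lifted system `d/dt X = X Λ(Υ(X, ξ₀), U)` on `[0, ∞)`, for the origin `ξ₀`. -/
def IsLiftedTrajectory (ξ₀ : TotalSpace n) (U : ℝ → Twist) (X : ℝ → Grp n) : Prop :=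
  ∀ t ∈ Ici (0 : ℝ), HasGroupDeriv X (lift (upsilon (X t) ξ₀) (U t)) 0 (Ici 0) t

/-- The threshold `ε = min(k₀, 1/2) r̲` of the barrier. -/
def eps (k₀ rlo : ℝ) : ℝ := min k₀ (1 / 2) * rlo

/-- The barrier function, meaningful for `ε < r`. -/
def barrier (ε rlo r : ℝ) : ℝ :=
  if r < rlo then (r - rlo) ^ 2 / ((rlo - ε) ^ 2 * (r - ε)) else 0

/-- The bearing innovation `Γ`; `w` stands for `Q̂ V_U`, `y₀` for the origin bearing. -/
def bearingInnovation (k : ℝ) (δ y₀ w : E3) (rhat : ℝ) : Mat3 :=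
  (inner ℝ δ w / (2 * rhat) - inner ℝ (δ + y₀) w / (rhat * (1 + inner ℝ δ y₀)) - k) •
    skew (cross δ y₀)

/-- The range innovation `γ`; `w` stands for `Q̂ V_U`, `b` for the value of the barrier. -/
def rangeInnovation (α : ℝ) (δ y₀ w : E3) (rhat b : ℝ) : ℝ :=
  α / rhat ^ 2 *
      ((1 - inner ℝ δ y₀) / (2 * (1 + inner ℝ δ y₀)) * inner ℝ δ w
        - inner ℝ y₀ (proj δ w) / (1 + inner ℝ δ y₀) ^ 2)
    + 1 / rhat * inner ℝ (y₀ - δ) w + α / rhat * b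

/-- The error space `(S² × ℝ₊)ⁿ`. -/
abbrev Err (n : ℕ) := Fin n → S2 × MR

/-- The error `(δ_i, r̃_i)`: `δ = ρ(X̂⁻¹, y)` and `r̃_i = r̂_i / r_i`, with `ξ̂ = Υ(X̂, ξ₀)`. -/
def err (ξ₀ ξ : TotalSpace n) (Xhat : Grp n) : Err n := fun i =>
  (rho Xhat⁻¹ (output ξ) i,
    ⟨range (upsilon Xhat ξ₀) i / range ξ i, div_pos (range_pos _ i) (range_pos _ i)⟩)

/-- The equilibrium `(y₀_i, 1)`. -/
def equilibrium (ξ₀ : TotalSpace n) : Err n := fun i => (output ξ₀ i, ⟨1, one_pos⟩)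

/-- The exception set: `δ_i = -y₀_i` for some `i`. -/
def exceptionSet (ξ₀ : TotalSpace n) : Set (Err n) :=
  {e | ∃ i, ((e i).1 : E3) = -(output ξ₀ i : E3)}

/-- The measure on the error space: product of surface measures and Lebesgue measures. -/
def errMeasure (n : ℕ) : Measure (Err n) :=
  Measure.pi fun _ => ((volume : Measure E3).toSphere).prod ((volume : Measure ℝ).comap Subtype.val : Measure MR)

/-- A robot pose innovation: a function of the observer state, the measured bearings and the
measured velocity. -/
abbrev PoseInnovation (n : ℕ) := Grp n → (Fin n → S2) → Twist → Twist

/-- The innovation `Δ_X̂ = (Δ, (Γ, γ)_i)`. -/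
def innovation (ξ₀ : TotalSpace n) (rlo k₀ : ℝ) (k α : Fin n → ℝ) (Δ : PoseInnovation n)
    (y : Fin n → S2) (U : Twist) (Xhat : Grp n) : Alg n :=
  (Δ Xhat y U, fun i =>
    let δ : E3 := rho Xhat⁻¹ y i
    let y₀ : E3 := output ξ₀ i
    let w : E3 := act ((Xhat.2 i).1 : Mat3) U.V
    let rhat : ℝ := range (upsilon Xhat ξ₀) i
    (bearingInnovation (k i) δ y₀ w rhat,
      rangeInnovation (α i) δ y₀ w rhat (barrier (eps k₀ rlo) rlo rhat)))

/-- `X̂` solves the observer equation `d/dt X̂ = X̂ Λ(Υ(X̂, ξ₀), U) - Δ_X̂ X̂` on the time set `J`,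
staying where the landmark innovations are defined, `r̂_i > ε` and `δ_i ≠ -y₀_i`. -/
def IsObserverOn (ξ₀ : TotalSpace n) (rlo k₀ : ℝ) (k α : Fin n → ℝ) (Δ : PoseInnovation n)
    (ξ : ℝ → TotalSpace n) (U : ℝ → Twist) (J : Set ℝ) (Xhat : ℝ → Grp n) : Prop :=
  ∀ t ∈ J,
    (∀ i, eps k₀ rlo < range (upsilon (Xhat t) ξ₀) i) ∧
    err ξ₀ (ξ t) (Xhat t) ∉ exceptionSet ξ₀ ∧
    HasGroupDeriv Xhat (lift (upsilon (Xhat t) ξ₀) (U t))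
      (innovation ξ₀ rlo k₀ k α Δ (output (ξ t)) (U t) (Xhat t)) J t

/-- The basin of attraction of the equilibrium. An initial error `e₀` belongs to it if, from every
observer state `X₀` with that error,
* the landmark components of the observer, and so the error, are uniquely defined for all
  `t ≥ 0`, whatever the pose innovation (a solution is exhibited for the pose innovation `0`, and
  every solution for any other one, on any `[0, τ)`, has the same landmark components);
* the error of every observer solution on `[0, ∞)` converges to the equilibrium. -/
def basin (ξ₀ : TotalSpace n) (rlo k₀ : ℝ) (k α : Fin n → ℝ)
    (ξ : ℝ → TotalSpace n) (U : ℝ → Twist) : Set (Err n) :=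
  {e₀ | ∀ X₀ : Grp n, err ξ₀ (ξ 0) X₀ = e₀ →
    (∃ Z : ℝ → Grp n, Z 0 = X₀ ∧
      IsObserverOn ξ₀ rlo k₀ k α (fun _ _ _ => 0) ξ U (Ici 0) Z ∧
      ∀ (Δ : PoseInnovation n) (τ : ℝ) (Xhat : ℝ → Grp n), Xhat 0 = X₀ →
        IsObserverOn ξ₀ rlo k₀ k α Δ ξ U (Ico 0 τ) Xhat →
        ∀ t ∈ Ico 0 τ, (Xhat t).2 = (Z t).2) ∧
    ∀ (Δ : PoseInnovation n) (Xhat : ℝ → Grp n), Xhat 0 = X₀ →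
      IsObserverOn ξ₀ rlo k₀ k α Δ ξ U (Ici 0) Xhat →
      Tendsto (fun t => err ξ₀ (ξ t) (Xhat t)) atTop (𝓝 (equilibrium ξ₀))}

/-- Lyapunov stability of the equilibrium of the error dynamics. -/
def IsStable (ξ₀ : TotalSpace n) (rlo k₀ : ℝ) (k α : Fin n → ℝ)
    (ξ : ℝ → TotalSpace n) (U : ℝ → Twist) : Prop :=
  ∀ η > 0, ∃ κ > 0, ∀ (Δ : PoseInnovation n) (τ : ℝ) (Xhat : ℝ → Grp n),
    IsObserverOn ξ₀ rlo k₀ k α Δ ξ U (Ico 0 τ) Xhat →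
    dist (err ξ₀ (ξ 0) (Xhat 0)) (equilibrium ξ₀) < κ →
    ∀ t ∈ Ico 0 τ, dist (err ξ₀ (ξ t) (Xhat t)) (equilibrium ξ₀) < η

/-- `ξ'` converges to `ξ` up to equivalence: it has rigidly transformed copies
whose difference to `ξ` tends to zero. -/
def ConvergesUpToEquiv (ξ' ξ : ℝ → TotalSpace n) : Prop :=
  ∃ ζ : ℝ → TotalSpace n, (∀ t, 0 ≤ t → SlamEquiv (ζ t) (ξ' t)) ∧
    Tendsto (fun t => (ζ t).P.toMatrix - (ξ t).P.toMatrix) atTop (𝓝 0) ∧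
    ∀ i, Tendsto (fun t => (ζ t).p i - (ξ t).p i) atTop (𝓝 0)

end VSLAM

end

/-! The problem splits into single landmarks seen in the world frame. With M = Q̂ R_Pᵀ, v = R_P V_U
and z = R_P y the angular velocity cancels, the pose innovation does not enter, and what remains is
an equation for the rotation M and the estimated range s, driven by v and z alone
(`IsObserverOn.isLandmarkSolution`). Write δ = M z, w = M v, c = ⟨δ, y₀⟩, l = (1 - c)/(1 + c), and r
for the true range.

The innovations are designed around r l + (s - r)²/α (`lyap`). Every term containing the velocity
cancels, and the derivative is exactly -2 k r l + 2 (s - r) β(s) (`hasDerivWithinAt_lyap`); the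
second summand is nonpositive because β vanishes unless s is below the lower bound of r.
Monotonicity keeps δ away from -y₀ and bounds s above, while the growth of β near ε keeps s away
from ε (`exists_lt_range`). Solutions are thus confined to a compact subset of the domain, so they
exist for all time (`exists_isLandmarkSolution`); the C¹ field makes them unique. Comparing the
Lyapunov function with the squared errors gives stability (`exists_stable`).

Convergence (`IsLandmarkSolution.tendsto`) uses Barbalat's lemma twice. Applied to the Lyapunov
function it gives l → 0, that is δ → y₀. Applied to δ itself it gives δ' → 0, and with δ replaced by
its limit this says that (1/s - 1/r) times the projection of w orthogonal to y₀ tends to zero.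
Meanwhile (s - r)² converges to α times the limit of the Lyapunov function. Were that limit
positive, the scalar factor would stay away from zero, so the projected velocity would vanish
asymptotically, against persistent excitation. Hence s - r → 0.

The gain k₀ is a lower bound of the range ratios on K, which places the initial ranges above ε.
Convergence of the estimate follows by moving it rigidly onto the true pose
(`convergesUpToEquiv_of_tendsto_err`). The identity along the lifted system holds because the
ego-centric coordinates of Υ(X, ξ₀) and of ξ obey the same affine equation with skew linear part
(`ego_upsilon_eq_ego`). -/

/-! ### Controlled differential equations: uniqueness, and existence from a priori bounds -/

/-- A `C¹` map on an open set agrees on a given compact subset with a globally Lipschitz and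
bounded map. -/
theorem ContDiffOn.exists_lipschitzWith_bounded_eqOn {E F : Type*}
    [NormedAddCommGroup E] [NormedSpace ℝ E] [FiniteDimensional ℝ E]
    [NormedAddCommGroup F] [NormedSpace ℝ F] {f : E → F} {O K : Set E}
    (hf : ContDiffOn ℝ 1 f O) (hO : IsOpen O) (hK : IsCompact K) (hKO : K ⊆ O) :
    ∃ (g : E → F) (L : NNReal) (B : NNReal), LipschitzWith L g ∧ (∀ x, ‖g x‖ ≤ B) ∧ EqOn g f K := by
  -- A cutoff equal to 1 near K and zero off K' turns f into a compactly supported C¹ map on the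
  -- whole space, whatever f does outside O.
  obtain ⟨K', hK', hKK', hK'O⟩ := exists_compact_between hK hO hKO
  obtain ⟨χ, h1, h0, -⟩ := exists_contMDiffMap_one_nhds_of_subset_interior (n := 1)
    (modelWithCornersSelf ℝ E) hK.isClosed hKK'
  have hχ : ContDiff ℝ 1 χ := χ.contMDiff.contDiff
  have hsupp : tsupport (fun x => χ x • f x) ⊆ K' := by
    refine closure_minimal (fun x hx => ?_) hK'.isClosed
    by_contra hxK
    exact hx (by simp [h0 x hxK])
  have hcs : HasCompactSupport (fun x => χ x • f x) := hK'.of_isClosed_subset isClosed_closure hsupp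
  have hg : ContDiff ℝ 1 (fun x => χ x • f x) := by
    rw [contDiff_iff_contDiffAt]
    intro x
    by_cases hx : x ∈ tsupport (fun x => χ x • f x)
    · exact hχ.contDiffAt.smul (hf.contDiffAt (hO.mem_nhds (hK'O (hsupp hx))))
    · exact contDiffAt_const.congr_of_eventuallyEq (notMem_tsupport_iff_eventuallyEq.1 hx)
  obtain ⟨L, hL⟩ := hg.lipschitzWith_of_hasCompactSupport hcs one_ne_zero
  obtain ⟨B, hB⟩ := hcs.exists_bound_of_continuous hg.continuous
  refine ⟨_, L, B.toNNReal, hL, fun x => (hB x).trans (Real.le_coe_toNNReal B), fun x hx => ?_⟩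
  simp [h1.self_of_nhdsSet x hx]

/-- Two solutions of a controlled equation with `C¹` right-hand side and the same initial value
coincide. -/
theorem eqOn_of_hasDerivWithinAt_of_contDiffOn {P X : Type*}
    [NormedAddCommGroup P] [NormedSpace ℝ P] [FiniteDimensional ℝ P]
    [NormedAddCommGroup X] [NormedSpace ℝ X] [FiniteDimensional ℝ X]
    {f : P × X → X} {O : Set (P × X)} (hO : IsOpen O) (hf : ContDiffOn ℝ 1 f O)
    {T : ℝ} {u : ℝ → P} (hu : ContinuousOn u (Icc 0 T)) {x y : ℝ → X}
    (hx : ∀ t ∈ Icc 0 T, (u t, x t) ∈ O ∧ HasDerivWithinAt x (f (u t, x t)) (Icc 0 T) t)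
    (hy : ∀ t ∈ Icc 0 T, (u t, y t) ∈ O ∧ HasDerivWithinAt y (f (u t, y t)) (Icc 0 T) t)
    (h0 : x 0 = y 0) : EqOn x y (Icc 0 T) := by
  have hxc : ContinuousOn x (Icc 0 T) := fun t ht => (hx t ht).2.continuousWithinAt
  have hyc : ContinuousOn y (Icc 0 T) := fun t ht => (hy t ht).2.continuousWithinAt
  -- Both trajectories, together with the control, sweep out a compact set; there f may be replaced
  -- by a globally Lipschitz field, and Grönwall uniqueness applies.
  have hK : IsCompact ((fun t => (u t, x t)) '' Icc 0 T ∪ (fun t => (u t, y t)) '' Icc 0 T) :=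
    (isCompact_Icc.image_of_continuousOn (hu.prodMk hxc)).union
      (isCompact_Icc.image_of_continuousOn (hu.prodMk hyc))
  obtain ⟨g, L, -, hL, -, hgf⟩ := hf.exists_lipschitzWith_bounded_eqOn hO hK (by
    rintro _ (⟨t, ht, rfl⟩ | ⟨t, ht, rfl⟩)
    exacts [(hx t ht).1, (hy t ht).1])
  refine ODE_solution_unique_of_mem_Icc_right (v := fun t x => g (u t, x)) (s := fun _ => univ)
    (K := L) (fun t _ => ?_) hxc (fun t ht => ?_) (fun _ _ => mem_univ _) hyc (fun t ht => ?_)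
    (fun _ _ => mem_univ _) h0
  · exact ((hL.comp (LipschitzWith.prodMk_left (u t))).weaken (by simp)).lipschitzOnWith
  · have := (hx t (Ico_subset_Icc_self ht)).2
    rw [← hgf (Or.inl ⟨t, Ico_subset_Icc_self ht, rfl⟩)] at this
    exact this.mono_of_mem_nhdsWithin (Icc_mem_nhdsGE_of_mem ht)
  · have := (hy t (Ico_subset_Icc_self ht)).2
    rw [← hgf (Or.inr ⟨t, Ico_subset_Icc_self ht, rfl⟩)] at this
    exact this.mono_of_mem_nhdsWithin (Icc_mem_nhdsGE_of_mem ht)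

/-- A solution confined a priori to a compact set exists on every `[0, T]`. -/
theorem exists_solution_Icc_of_apriori {P X : Type*}
    [NormedAddCommGroup P] [NormedSpace ℝ P] [FiniteDimensional ℝ P]
    [NormedAddCommGroup X] [NormedSpace ℝ X] [FiniteDimensional ℝ X]
    {f : P × X → X} {O K : Set (P × X)} (hO : IsOpen O) (hf : ContDiffOn ℝ 1 f O)
    {u : ℝ → P} (hu : ContinuousOn u (Ici 0)) {x₀ : X}
    (hK : IsCompact K) (hKO : K ⊆ O)
    (hap : ∀ T, 0 ≤ T → ∀ x : ℝ → X, x 0 = x₀ →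
      (∀ t ∈ Icc 0 T, (u t, x t) ∈ O ∧ HasDerivWithinAt x (f (u t, x t)) (Icc 0 T) t) →
      (u T, x T) ∈ K) (h0 : (u 0, x₀) ∈ O) {T : ℝ} (hT : 0 ≤ T) :
    ∃ x : ℝ → X, x 0 = x₀ ∧
      ∀ t ∈ Icc 0 T, (u t, x t) ∈ O ∧ HasDerivWithinAt x (f (u t, x t)) (Icc 0 T) t := by
  have := FiniteDimensional.complete ℝ X
  -- The field is modified only outside K', a neighbourhood of K: solutions of the modified equation
  -- are genuine as long as they stay in K', and the a priori bound will keep them from leaving it.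
  obtain ⟨K', hK', hKK', hK'O⟩ := exists_compact_between hK hO hKO
  obtain ⟨g, L, B, hL, hB, hgf⟩ := hf.exists_lipschitzWith_bounded_eqOn hO hK' hK'O
  have huT : ContinuousOn u (Icc 0 T) := hu.mono Icc_subset_Ici_self
  -- The modified field is bounded by B everywhere, so a ball of radius B T contains the motion on
  -- all of [0, T] and no step-by-step continuation is needed.
  have hPL : IsPicardLindelof (fun t x => g (u t, x)) (⟨0, left_mem_Icc.2 hT⟩ : Icc 0 T) x₀
      (B * T.toNNReal) 0 B L := by
    refine ⟨fun t _ => ?_, fun x _ => ?_, fun t _ x _ => hB _, ?_⟩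
    · exact ((hL.comp (LipschitzWith.prodMk_left (u t))).weaken (by simp)).lipschitzOnWith
    · exact hL.continuous.comp_continuousOn (huT.prodMk continuousOn_const)
    · simp [hT]
  obtain ⟨x, hx0, hx⟩ := hPL.exists_eq_forall_mem_Icc_hasDerivWithinAt₀
  simp only at hx0
  have hxc : ContinuousOn x (Icc 0 T) := fun t ht => (hx t ht).continuousWithinAt
  have hin : ∀ t ∈ Icc 0 T, (u t, x t) ∈ interior K' := by
    by_contra! hne
    obtain ⟨t₁, ht₁, hout⟩ := hne
    have hcl : IsCompact (Icc 0 T ∩ (fun t => (u t, x t)) ⁻¹' (interior K')ᶜ) :=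
      isCompact_Icc.of_isClosed_subset
        ((huT.prodMk hxc).preimage_isClosed_of_isClosed isClosed_Icc
          isOpen_interior.isClosed_compl) inter_subset_left
    -- At a first exit time τ from the interior of K' the curve still solves the original equation
    -- on [0, τ], so the a priori bound puts its end point in K, inside that interior.
    obtain ⟨τ, ⟨hτ, hτout⟩, hmin⟩ := hcl.exists_isLeast ⟨t₁, ht₁, hout⟩
    have hbefore : ∀ t ∈ Ico 0 τ, (u t, x t) ∈ interior K' := fun t ht => by
      by_contra h
      exact ht.2.not_ge (hmin ⟨⟨ht.1, ht.2.le.trans hτ.2⟩, h⟩)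
    refine hτout (hKK' (hap τ hτ.1 x hx0 fun t ht => ?_))
    -- For τ = 0 the initial point is only known to lie in O. This suffices, since a derivative
    -- within a single point is no condition.
    rcases hτ.1.eq_or_lt with h00 | hτ0
    · obtain rfl : t = 0 := le_antisymm (ht.2.trans h00.ge) ht.1
      refine ⟨by rw [hx0]; exact h0, ?_⟩
      rw [← h00, Icc_self]
      exact HasFDerivWithinAt.of_subsingleton (f := x) subsingleton_singleton
    · have htT : t ∈ Icc 0 T := ⟨ht.1, ht.2.trans hτ.2⟩
      have htK : (u t, x t) ∈ K' := by
        rcases ht.2.eq_or_lt with rfl | hlt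
        · have hsub : Icc 0 t ⊆ Icc 0 T := Icc_subset_Icc_right hτ.2
          have hcw : ContinuousWithinAt (fun s => (u s, x s)) (Ico 0 t) t :=
            ((huT.prodMk hxc) t htT).mono (Ico_subset_Icc_self.trans hsub)
          have hmem : t ∈ closure (Ico 0 t) := by
            rw [closure_Ico hτ0.ne]; exact ht
          exact hK'.isClosed.closure_subset_iff.2 interior_subset
            (hcw.mem_closure hmem hbefore)
        · exact interior_subset (hbefore t ⟨ht.1, hlt⟩)
      refine ⟨hK'O htK, ?_⟩
      rw [← hgf htK]
      exact (hx t htT).mono (Icc_subset_Icc_right hτ.2)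
  refine ⟨x, hx0, fun t ht => ⟨hK'O (interior_subset (hin t ht)), ?_⟩⟩
  rw [← hgf (interior_subset (hin t ht))]
  exact hx t ht

/-- A solution confined a priori to a compact set exists on `[0, ∞)`. -/
theorem exists_solution_Ici_of_apriori {P X : Type*}
    [NormedAddCommGroup P] [NormedSpace ℝ P] [FiniteDimensional ℝ P]
    [NormedAddCommGroup X] [NormedSpace ℝ X] [FiniteDimensional ℝ X]
    {f : P × X → X} {O K : Set (P × X)} (hO : IsOpen O) (hf : ContDiffOn ℝ 1 f O)
    {u : ℝ → P} (hu : ContinuousOn u (Ici 0)) {x₀ : X}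
    (hK : IsCompact K) (hKO : K ⊆ O)
    (hap : ∀ T, 0 ≤ T → ∀ x : ℝ → X, x 0 = x₀ →
      (∀ t ∈ Icc 0 T, (u t, x t) ∈ O ∧ HasDerivWithinAt x (f (u t, x t)) (Icc 0 T) t) →
      (u T, x T) ∈ K) (h0 : (u 0, x₀) ∈ O) :
    ∃ x : ℝ → X, x 0 = x₀ ∧
      ∀ t ∈ Ici (0 : ℝ), (u t, x t) ∈ O ∧ HasDerivWithinAt x (f (u t, x t)) (Ici 0) t := by
  choose φ hφ0 hφ using fun N : ℕ =>
    exists_solution_Icc_of_apriori hO hf hu hK hKO hap h0 (Nat.cast_nonneg (α := ℝ) N)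
  have heq : ∀ N M : ℕ, N ≤ M → EqOn (φ N) (φ M) (Icc 0 N) := fun N M hNM =>
    have hsub : Icc (0 : ℝ) N ⊆ Icc 0 M := Icc_subset_Icc_right (Nat.cast_le.2 hNM)
    eqOn_of_hasDerivWithinAt_of_contDiffOn hO hf (hu.mono Icc_subset_Ici_self) (hφ N)
      (fun t ht => ⟨(hφ M t (hsub ht)).1, (hφ M t (hsub ht)).2.mono hsub⟩)
      ((hφ0 N).trans (hφ0 M).symm)
  have hagree : ∀ N : ℕ, EqOn (fun t => φ (⌈t⌉₊ + 1) t) (φ N) (Icc 0 N) := fun N t ht => by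
    have h1 : t ∈ Icc (0 : ℝ) (⌈t⌉₊ + 1 : ℕ) :=
      ⟨ht.1, (Nat.le_ceil t).trans (by push_cast; linarith)⟩
    rcases le_total (⌈t⌉₊ + 1) N with h | h
    · exact heq _ _ h h1
    · exact (heq _ _ h ht).symm
  refine ⟨fun t => φ (⌈t⌉₊ + 1) t, (hagree 0 (by simp)).trans (hφ0 0), fun t ht => ?_⟩
  -- N is strictly larger than t, so that [0, N] is a neighbourhood of t in [0, ∞) and the
  -- derivative transfers.
  obtain ⟨N, hN⟩ := exists_nat_gt t
  have htN : t ∈ Icc (0 : ℝ) N := ⟨ht, hN.le⟩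
  have e : φ (⌈t⌉₊ + 1) t = φ N t := hagree N htN
  beta_reduce
  rw [e]
  refine ⟨(hφ N t htN).1, ((hφ N t htN).2.congr (hagree N) e).mono_of_mem_nhdsWithin ?_⟩
  rw [← Ici_inter_Iic]
  exact inter_mem self_mem_nhdsWithin (mem_nhdsWithin_of_mem_nhds (Iic_mem_nhds hN))

/-! ### Barbalat's lemma and uniform continuity of signals -/

/-- Barbalat's lemma: if `F` converges and its derivative is uniformly continuous, the derivative
tends to zero. -/
theorem tendsto_zero_of_hasDerivWithinAt_of_uniformContinuousOn {E : Type*}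
    [NormedAddCommGroup E] [NormedSpace ℝ E] {F φ : ℝ → E} {l : E}
    (hF : ∀ t ∈ Ici (0 : ℝ), HasDerivWithinAt F (φ t) (Ici 0) t)
    (hφ : UniformContinuousOn φ (Ici 0)) (hl : Tendsto F atTop (𝓝 l)) :
    Tendsto φ atTop (𝓝 0) := by
  rw [Metric.tendsto_atTop]
  intro η hη
  obtain ⟨d, hd, hdφ⟩ := Metric.uniformContinuousOn_iff.1 hφ (η / 2) (half_pos hη)
  set h := d / 2 with hh
  have hpos : 0 < h := half_pos hd
  have hdiff : Tendsto (fun t => F (t + h) - F t) atTop (𝓝 0) := by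
    have := (hl.comp (tendsto_atTop_add_const_right atTop h tendsto_id)).sub hl
    simpa using this
  obtain ⟨t₀, ht₀⟩ := Metric.tendsto_atTop.1 hdiff (h * (η / 2)) (by positivity)
  refine ⟨max t₀ 0, fun t ht => ?_⟩
  have ht0 : 0 ≤ t := (le_max_right _ _).trans ht
  -- Mean value inequality for s ↦ F s - s φ(t): its derivative φ(s) - φ(t) is below η/2 on a window
  -- of length h = d/2. Hence the increment of F over the window is within h η/2 of h φ(t).
  have key : ‖(F (t + h) - (t + h) • φ t) - (F t - t • φ t)‖ ≤ η / 2 * ‖t + h - t‖ := by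
    refine Convex.norm_image_sub_le_of_norm_hasDerivWithin_le
      (f := fun s => F s - s • φ t) (f' := fun s => φ s - φ t) (s := Icc t (t + h))
      (fun s hs => ?_) (fun s hs => ?_) (convex_Icc _ _) (left_mem_Icc.2 (by linarith))
      (right_mem_Icc.2 (by linarith))
    · have := ((hasDerivWithinAt_id s (Icc t (t + h))).smul_const (φ t))
      simp only [one_smul] at this
      exact ((hF s (ht0.trans hs.1)).mono fun x hx => ht0.trans hx.1).sub this
    · rw [← dist_eq_norm]
      refine (hdφ s (ht0.trans hs.1) t ht0 ?_).le
      rw [Real.dist_eq, abs_of_nonneg (by linarith [hs.1])]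
      linarith [hs.2]
  have h1 := ht₀ t ((le_max_left _ _).trans ht)
  rw [dist_zero_right] at h1 ⊢
  have h2 : (F (t + h) - F t) - ((F (t + h) - (t + h) • φ t) - (F t - t • φ t)) = h • φ t := by
    rw [add_smul]; abel
  have h3 : ‖h • φ t‖ < h * (η / 2) + η / 2 * h := by
    rw [← h2]
    refine (norm_sub_le _ _).trans_lt (add_lt_add_of_lt_of_le h1 (key.trans ?_))
    rw [add_sub_cancel_left, Real.norm_of_nonneg hpos.le]
  rw [norm_smul, Real.norm_of_nonneg hpos.le] at h3
  nlinarith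

/-- A function with bounded derivative on `[0, ∞)` is uniformly continuous. -/
theorem uniformContinuousOn_of_norm_hasDerivWithinAt_le {E : Type*}
    [NormedAddCommGroup E] [NormedSpace ℝ E] {F φ : ℝ → E} {C : ℝ}
    (hF : ∀ t ∈ Ici (0 : ℝ), HasDerivWithinAt F (φ t) (Ici 0) t)
    (hC : ∀ t ∈ Ici (0 : ℝ), ‖φ t‖ ≤ C) : UniformContinuousOn F (Ici 0) :=
  ((convex_Ici 0).lipschitzOnWith_of_nnnorm_hasDerivWithin_le (C := C.toNNReal) hF fun t ht => by
    rw [← NNReal.coe_le_coe, coe_nnnorm]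
    exact (hC t ht).trans (Real.le_coe_toNNReal C)).uniformContinuousOn

/-- A continuous function of a uniformly continuous signal with values in a compact set is
uniformly continuous. -/
theorem UniformContinuousOn.continuousOn_comp_of_isCompact {α β γ : Type*} [UniformSpace α]
    [UniformSpace β] [UniformSpace γ] {Ψ : α → β} {S : Set α} {K : Set β} {h : β → γ}
    (hΨ : UniformContinuousOn Ψ S) (hK : IsCompact K) (hm : MapsTo Ψ S K)
    (hh : ContinuousOn h K) : UniformContinuousOn (fun t => h (Ψ t)) S :=
  (hK.uniformContinuousOn_of_continuous hh).comp hΨ hm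

noncomputable section

namespace VSLAM

/-! ### Vector algebra in three-space and rotations -/

theorem inner_eq_sum (u v : E3) : inner ℝ u v = u 0 * v 0 + u 1 * v 1 + u 2 * v 2 := by
  simp [PiLp.inner_apply, Fin.sum_univ_three]; ring

theorem act_apply (M : Mat3) (v : E3) (i : Fin 3) :
    act M v i = M i 0 * v 0 + M i 1 * v 1 + M i 2 * v 2 := by
  simp [act, Matrix.mulVec, dotProduct, Fin.sum_univ_three]

theorem cross_zero_coord (u v : E3) : cross u v 0 = u 1 * v 2 - u 2 * v 1 := by
  simp [cross, act_apply, skew]; ring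

theorem cross_one_coord (u v : E3) : cross u v 1 = u 2 * v 0 - u 0 * v 2 := by
  simp [cross, act_apply, skew]; ring

theorem cross_two_coord (u v : E3) : cross u v 2 = u 0 * v 1 - u 1 * v 0 := by
  simp [cross, act_apply, skew]; ring

theorem ext3 {u v : E3} (h0 : u 0 = v 0) (h1 : u 1 = v 1) (h2 : u 2 = v 2) : u = v := by
  ext i; fin_cases i <;> assumption

theorem act_sub (M : Mat3) (v w : E3) : act M (v - w) = act M v - act M w := by
  simp [act, Matrix.mulVec_sub]

theorem act_smul (M : Mat3) (a : ℝ) (v : E3) : act M (a • v) = a • act M v := by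
  simp [act, Matrix.mulVec_smul]

theorem add_act (M N : Mat3) (v : E3) : act (M + N) v = act M v + act N v := by
  simp [act, Matrix.add_mulVec]

theorem sub_act (M N : Mat3) (v : E3) : act (M - N) v = act M v - act N v := by
  simp [act, Matrix.sub_mulVec]

theorem smul_act (a : ℝ) (M : Mat3) (v : E3) : act (a • M) v = a • act M v := by
  simp [act, Matrix.smul_mulVec]

theorem inner_act_left (M : Mat3) (u v : E3) :
    inner ℝ (act M u) v = inner ℝ u (act M.transpose v) := by
  simp only [inner_eq_sum, act_apply, Matrix.transpose_apply]; ring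

theorem skew_transpose (u : E3) : (skew u).transpose = -skew u := by
  ext i j; fin_cases i <;> fin_cases j <;> simp [skew]

theorem skew_add (u v : E3) : skew (u + v) = skew u + skew v := by
  ext i j; fin_cases i <;> fin_cases j <;> simp [skew] <;> ring

theorem skew_sub (u v : E3) : skew (u - v) = skew u - skew v := by
  ext i j; fin_cases i <;> fin_cases j <;> simp [skew] <;> ring

theorem skew_smul (a : ℝ) (u : E3) : skew (a • u) = a • skew u := by
  ext i j; fin_cases i <;> fin_cases j <;> simp [skew]

theorem cross_sub (u v w : E3) : cross u (v - w) = cross u v - cross u w := act_sub _ _ _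

theorem add_cross (u v w : E3) : cross (u + v) w = cross u w + cross v w := by
  simp [cross, skew_add, add_act]

theorem sub_cross (u v w : E3) : cross (u - v) w = cross u w - cross v w := by
  simp [cross, skew_sub, sub_act]

theorem smul_cross (a : ℝ) (u v : E3) : cross (a • u) v = a • cross u v := by
  simp [cross, skew_smul, smul_act]

theorem cross_cross_left (a b c : E3) :
    cross (cross a b) c = inner ℝ a c • b - inner ℝ b c • a := by
  apply ext3 <;>
  simp only [cross_zero_coord, cross_one_coord, cross_two_coord, inner_eq_sum, PiLp.sub_apply,
    PiLp.smul_apply, smul_eq_mul] <;> ring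

theorem cross_cross_right (a b c : E3) :
    cross a (cross b c) = inner ℝ a c • b - inner ℝ a b • c := by
  apply ext3 <;>
  simp only [cross_zero_coord, cross_one_coord, cross_two_coord, inner_eq_sum, PiLp.sub_apply,
    PiLp.smul_apply, smul_eq_mul] <;> ring

theorem inner_cross_self (u v : E3) : inner ℝ v (cross u v) = 0 := by
  simp only [cross_zero_coord, cross_one_coord, cross_two_coord, inner_eq_sum]; ring

theorem mul_transpose_SO3 (Q : SO3) : (Q : Mat3) * (Q : Mat3).transpose = 1 :=
  (Matrix.mem_orthogonalGroup_iff (Fin 3) ℝ).1 (Matrix.mem_specialOrthogonalGroup_iff.1 Q.2).1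

theorem transpose_mul_SO3 (Q : SO3) : (Q : Mat3).transpose * (Q : Mat3) = 1 :=
  (Matrix.mem_orthogonalGroup_iff' (Fin 3) ℝ).1 (Matrix.mem_specialOrthogonalGroup_iff.1 Q.2).1

theorem det_SO3 (Q : SO3) : (Q : Mat3).det = 1 :=
  (Matrix.mem_specialOrthogonalGroup_iff.1 Q.2).2

theorem coe_inv_SO3 (Q : SO3) : ((Q⁻¹ : SO3) : Mat3) = (Q : Mat3).transpose := rfl

theorem act_act_transpose (Q : SO3) (v : E3) : act Q (act (Q : Mat3).transpose v) = v := by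
  rw [← act_mul, mul_transpose_SO3, act_one]

theorem act_transpose_act (Q : SO3) (v : E3) : act (Q : Mat3).transpose (act Q v) = v := by
  rw [← act_mul, transpose_mul_SO3, act_one]

theorem inner_act_act (Q : SO3) (u v : E3) : inner ℝ (act Q u) (act Q v) = inner ℝ u v := by
  rw [inner_act_left, act_transpose_act]

theorem norm_act (Q : SO3) (v : E3) : ‖act Q v‖ = ‖v‖ := by
  rw [← norm_act_transpose Q, act_transpose_act]

/-- A polynomial identity valid for every matrix (the cofactor rule). Determinant 1 then makes
rotations commute with the cross product. -/
theorem act_transpose_cross_act (M : Mat3) (u v : E3) :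
    act M.transpose (cross (act M u) (act M v)) = M.det • cross u v := by
  apply ext3 <;>
  simp only [cross_zero_coord, cross_one_coord, cross_two_coord, act_apply, Matrix.transpose_apply,
    PiLp.smul_apply, smul_eq_mul, Matrix.det_fin_three] <;> ring

/-- Rotations preserve the cross product. -/
theorem act_cross (Q : SO3) (u v : E3) : act Q (cross u v) = cross (act Q u) (act Q v) := by
  have h := act_transpose_cross_act (Q : Mat3) u v
  rw [det_SO3, one_smul] at h
  rw [← h, act_act_transpose]

theorem mat_ext_act {M N : Mat3} (h : ∀ v, act M v = act N v) : M = N := by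
  refine Matrix.mulVec_injective (funext fun v => ?_)
  simpa [act] using h (WithLp.toLp 2 v)

/-- Conjugation of a skew matrix by a rotation. -/
theorem mul_skew (Q : SO3) (u : E3) : (Q : Mat3) * skew u = skew (act Q u) * Q :=
  mat_ext_act fun v => by
    rw [act_mul, act_mul]
    exact act_cross Q u v

/-- For a unit vector the double cross product is minus the orthogonal projection; this is how the
excitation hypothesis becomes one on the projected velocity. -/
theorem norm_cross_cross {y : E3} (hy : ‖y‖ = 1) (v : E3) :
    ‖cross y (cross y v)‖ = ‖v - inner ℝ y v • y‖ := by
  rw [cross_cross_right, real_inner_self_eq_norm_sq, hy, one_pow, one_smul, norm_sub_rev]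

theorem SO3_entry_abs_le (Q : SO3) (i j : Fin 3) : |(Q : Mat3) i j| ≤ 1 := by
  have h := congrFun (congrFun (mul_transpose_SO3 Q) i) i
  simp only [Matrix.mul_apply, Matrix.transpose_apply, Fin.sum_univ_three, Matrix.one_apply_eq] at h
  have h0 := mul_self_nonneg ((Q : Mat3) i 0)
  have h1 := mul_self_nonneg ((Q : Mat3) i 1)
  have h2 := mul_self_nonneg ((Q : Mat3) i 2)
  rw [← sq_le_one_iff_abs_le_one, sq]
  obtain rfl | rfl | rfl : j = 0 ∨ j = 1 ∨ j = 2 := by fin_cases j <;> simp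
  exacts [by linear_combination h + h1 + h2, by linear_combination h + h0 + h2,
    by linear_combination h + h0 + h1]

/-! ### The exception set is negligible -/

/-- The cone over a point of the sphere lies in a line, which is a proper subspace and hence
Lebesgue null. -/
theorem toSphere_singleton (x : S2) : (volume : Measure E3).toSphere {x} = 0 := by
  rw [Measure.toSphere_apply' _ (measurableSet_singleton x)]
  refine mul_eq_zero_of_right _ (measure_mono_null (t := (Submodule.span ℝ {(x : E3)} : Set E3)) ?_ ?_)
  · rw [image_singleton]
    rintro _ ⟨a, -, _, rfl, rfl⟩
    exact Submodule.smul_mem _ _ (Submodule.mem_span_singleton_self _)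
  · refine Measure.addHaar_submodule _ _ fun h => ?_
    have h1 := finrank_span_singleton (K := ℝ) (v := (x : E3)) (by
      intro h0; have := mem_sphere_zero_iff_norm.1 x.2; simp [h0] at this)
    rw [h, finrank_top, finrank_euclideanSpace] at h1
    simp at h1

theorem errMeasure_exceptionSet {n : ℕ} (ξ₀ : TotalSpace n) : errMeasure n (exceptionSet ξ₀) = 0 := by
  have hset : exceptionSet ξ₀ = ⋃ i, Function.eval i ⁻¹' (({-output ξ₀ i} : Set S2) ×ˢ univ) := by
    ext e
    simp [exceptionSet, Subtype.ext_iff]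
  -- Nullity of a cylinder in the product needs σ-finite factors. For the positive reals this comes
  -- from the restriction of Lebesgue measure to which the measure pushes forward.
  have : SigmaFinite ((volume : Measure ℝ).comap Subtype.val : Measure MR) :=
    SigmaFinite.of_map _ measurable_subtype_coe.aemeasurable
      ((congrArg SigmaFinite (map_comap_subtype_coe
        (measurableSet_Ioi : MeasurableSet {a : ℝ | 0 < a}) volume)).mpr inferInstance)
  have : SigmaFinite (((volume : Measure E3).toSphere).prod
      ((volume : Measure ℝ).comap Subtype.val : Measure MR)) := inferInstance
  rw [hset]
  refine measure_iUnion_null fun i => ?_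
  refine Measure.pi_eval_preimage_null _ ?_
  rw [Measure.prod_prod, toSphere_singleton, zero_mul]

section

attribute [local instance] Matrix.normedAddCommGroup Matrix.normedSpace

/-! ### Calculus of matrix-valued functions -/

theorem hasDerivWithinAt_matrix {m k : Type*} [Fintype m] [Fintype k] {M : ℝ → Matrix m k ℝ}
    {M' : Matrix m k ℝ} {J : Set ℝ} {t : ℝ} :
    HasDerivWithinAt M M' J t ↔ ∀ i j, HasDerivWithinAt (fun s => M s i j) (M' i j) J t := by
  refine (hasDerivWithinAt_pi (φ := M) (φ' := M')).trans (forall_congr' fun i => ?_)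
  exact hasDerivWithinAt_pi (φ := fun s => M s i) (φ' := M' i)

theorem hasDerivWithinAt_E3 {v : ℝ → E3} {v' : E3} {J : Set ℝ} {t : ℝ} :
    HasDerivWithinAt v v' J t ↔ ∀ i, HasDerivWithinAt (fun s => v s i) (v' i) J t := by
  refine ⟨fun h i => (EuclideanSpace.proj (𝕜 := ℝ) i).hasFDerivAt.comp_hasDerivWithinAt t h,
    fun h => ?_⟩
  exact (EuclideanSpace.equiv (Fin 3) ℝ).symm.hasFDerivAt.comp_hasDerivWithinAt t
    (hasDerivWithinAt_pi.2 h)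

theorem _root_.HasDerivWithinAt.matrix_mul {m k l : Type*} [Fintype m] [Fintype k] [Fintype l]
    {M : ℝ → Matrix m k ℝ} {N : ℝ → Matrix k l ℝ} {M' : Matrix m k ℝ} {N' : Matrix k l ℝ}
    {J : Set ℝ} {t : ℝ} (hM : HasDerivWithinAt M M' J t) (hN : HasDerivWithinAt N N' J t) :
    HasDerivWithinAt (fun s => M s * N s) (M' * N t + M t * N') J t := by
  rw [hasDerivWithinAt_matrix] at hM hN ⊢
  intro i j
  have := HasDerivWithinAt.fun_sum (u := Finset.univ) fun a _ => (hM i a).mul (hN a j)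
  simpa [Matrix.mul_apply, Finset.sum_add_distrib] using this

theorem _root_.HasDerivWithinAt.matrix_transpose {m k : Type*} [Fintype m] [Fintype k]
    {M : ℝ → Matrix m k ℝ} {M' : Matrix m k ℝ} {J : Set ℝ} {t : ℝ}
    (hM : HasDerivWithinAt M M' J t) :
    HasDerivWithinAt (fun s => (M s).transpose) M'.transpose J t := by
  rw [hasDerivWithinAt_matrix] at hM ⊢
  exact fun i j => hM j i

theorem _root_.HasDerivWithinAt.act {M : ℝ → Mat3} {v : ℝ → E3} {M' : Mat3} {v' : E3}
    {J : Set ℝ} {t : ℝ} (hM : HasDerivWithinAt M M' J t) (hv : HasDerivWithinAt v v' J t) :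
    HasDerivWithinAt (fun s => VSLAM.act (M s) (v s)) (VSLAM.act M' (v t) + VSLAM.act (M t) v') J t := by
  rw [hasDerivWithinAt_matrix] at hM
  rw [hasDerivWithinAt_E3] at hv ⊢
  intro i
  simp only [act_apply, PiLp.add_apply]
  exact ((((hM i 0).mul (hv 0)).add ((hM i 1).mul (hv 1))).add ((hM i 2).mul (hv 2))).congr_deriv
    (by ring)

theorem contDiff_act : ContDiff ℝ 1 (fun p : Mat3 × E3 => act p.1 p.2) := by
  rw [contDiff_euclidean]
  intro i
  have hM : ∀ j, ContDiff ℝ 1 (fun p : Mat3 × E3 => p.1 i j) := fun j =>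
    (contDiff_apply_apply ℝ ℝ i j).comp contDiff_fst
  have hv : ∀ j, ContDiff ℝ 1 (fun p : Mat3 × E3 => p.2 j) := fun j =>
    contDiff_euclidean.1 contDiff_snd j
  simp only [act_apply]
  exact (((hM 0).mul (hv 0)).add ((hM 1).mul (hv 1))).add ((hM 2).mul (hv 2))

theorem contDiff_matrix {X : Type*} [NormedAddCommGroup X] [NormedSpace ℝ X] {f : X → Mat3}
    (h : ∀ i j, ContDiff ℝ 1 (fun x => f x i j)) : ContDiff ℝ 1 f :=
  contDiff_pi.2 fun i => contDiff_pi.2 fun j => h i j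

theorem contDiff_skew : ContDiff ℝ 1 skew := by
  have hv : ∀ j, ContDiff ℝ 1 (fun p : E3 => p j) := fun j => contDiff_euclidean.1 contDiff_id j
  refine contDiff_matrix fun i j => ?_
  fin_cases i <;> fin_cases j <;> simp [skew] <;>
    first | exact contDiff_const | exact hv _ | exact (hv _).neg

theorem contDiff_skew_mul : ContDiff ℝ 1 (fun p : E3 × Mat3 => skew p.1 * p.2) := by
  refine contDiff_matrix fun i j => ?_
  simp only [Matrix.mul_apply]
  refine ContDiff.sum fun a _ => ?_
  exact ((contDiff_apply_apply ℝ ℝ i a).comp (contDiff_skew.comp contDiff_fst)).mul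
    ((contDiff_apply_apply ℝ ℝ a j).comp contDiff_snd)

theorem contDiff_cross : ContDiff ℝ 1 (fun p : E3 × E3 => cross p.1 p.2) :=
  contDiff_act.comp ((contDiff_skew.comp contDiff_fst).prodMk contDiff_snd)

theorem continuous_act : Continuous (fun p : Mat3 × E3 => act p.1 p.2) := contDiff_act.continuous

theorem continuous_cross : Continuous (fun p : E3 × E3 => cross p.1 p.2) := contDiff_cross.continuous

/-! ### The barrier -/

/-- The square of min(r - rlo, 0) absorbs the case distinction and is visibly C¹ across r = rlo, the
smoothness that the uniqueness and existence theorems require. -/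
theorem barrier_eq (ε rlo r : ℝ) :
    barrier ε rlo r = (min (r - rlo) 0) ^ 2 / ((rlo - ε) ^ 2 * (r - ε)) := by
  unfold barrier
  split_ifs with h
  · rw [min_eq_left (by linarith)]
  · rw [min_eq_right (by linarith)]; simp

theorem barrier_nonneg {ε rlo r : ℝ} (h : ε < r) : 0 ≤ barrier ε rlo r := by
  rw [barrier_eq]
  exact div_nonneg (sq_nonneg _) (mul_nonneg (sq_nonneg _) (by linarith))

theorem hasDerivAt_min_zero_sq (x : ℝ) : HasDerivAt (fun x : ℝ => (min x 0) ^ 2) (2 * min x 0) x := by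
  rcases lt_trichotomy x 0 with h | rfl | h
  · have := (hasDerivAt_pow 2 x).congr_of_eventuallyEq (f₁ := fun x : ℝ => (min x 0) ^ 2) (by
      filter_upwards [Iio_mem_nhds h] with y hy
      rw [min_eq_left hy.le])
    simpa [min_eq_left h.le] using this
  · rw [hasDerivAt_iff_isLittleO]
    simp only [min_self, sub_zero, mul_zero, smul_zero, ne_eq, OfNat.ofNat_ne_zero,
      not_false_eq_true, zero_pow]
    refine Asymptotics.IsBigO.trans_isLittleO (g := fun x : ℝ => x ^ 2) ?_ ?_
    · refine Asymptotics.IsBigO.of_bound 1 (Eventually.of_forall fun y => ?_)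
      rw [one_mul, Real.norm_of_nonneg (sq_nonneg _), Real.norm_of_nonneg (sq_nonneg _)]
      rcases le_total y 0 with hy | hy
      · rw [min_eq_left hy]
      · rw [min_eq_right hy, zero_pow two_ne_zero]; exact sq_nonneg y
    · exact Asymptotics.isLittleO_pow_id one_lt_two
  · have := (hasDerivAt_const x (0 : ℝ)).congr_of_eventuallyEq (f₁ := fun x : ℝ => (min x 0) ^ 2) (by
      filter_upwards [Ioi_mem_nhds h] with y hy
      rw [min_eq_right hy.le]; simp)
    simpa [min_eq_right h.le] using this

theorem contDiff_min_zero_sq : ContDiff ℝ 1 (fun x : ℝ => (min x 0) ^ 2) := by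
  rw [contDiff_one_iff_deriv]
  refine ⟨fun x => (hasDerivAt_min_zero_sq x).differentiableAt, ?_⟩
  rw [funext fun x => (hasDerivAt_min_zero_sq x).deriv]
  fun_prop

theorem contDiffOn_barrier {ε rlo : ℝ} (h : ε < rlo) : ContDiffOn ℝ 1 (barrier ε rlo) (Ioi ε) := by
  rw [funext (barrier_eq ε rlo)]
  refine (contDiff_min_zero_sq.comp (contDiff_id.sub contDiff_const)).contDiffOn.div
    (contDiff_const.mul (contDiff_id.sub contDiff_const)).contDiffOn fun x hx => ?_
  have h1 : rlo - ε ≠ 0 := (sub_pos.2 h).ne'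
  have h2 : x - ε ≠ 0 := (sub_pos.2 hx).ne'
  exact mul_ne_zero (pow_ne_zero 2 h1) h2

/-- Near the threshold the barrier exceeds any bound. -/
theorem le_barrier {ε rlo r : ℝ} (h : ε < r) (hr : r ≤ (ε + rlo) / 2) :
    1 / (4 * (r - ε)) ≤ barrier ε rlo r := by
  have h1 : 0 < rlo - ε := by linarith
  have h2 : 0 < r - ε := by linarith
  rw [barrier, if_pos (by linarith), div_le_div_iff₀ (by positivity) (by positivity)]
  -- Below the midpoint of ε and rlo, the distance to rlo is at least half of rlo - ε.
  have : (rlo - ε) ^ 2 ≤ 4 * (r - rlo) ^ 2 := by nlinarith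
  nlinarith

/-! ### The vector field of one landmark -/

/-- The scalar gain in the bearing innovation. -/
def bearingGain (k : ℝ) (δ y₀ w : E3) (s : ℝ) : ℝ :=
  inner ℝ δ w / (2 * s) - inner ℝ (δ + y₀) w / (s * (1 + inner ℝ δ y₀)) - k

/-- Angular velocity, in the origin frame, of the landmark rotation relative to the world. -/
def spin (k : ℝ) (δ y₀ w : E3) (s : ℝ) : E3 :=
  (1 / s) • cross y₀ w - bearingGain k δ y₀ w s • cross δ y₀

/-- The rate of the estimated range. -/
def rangeRate (ε rlo α : ℝ) (δ y₀ w : E3) (s : ℝ) : ℝ :=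
  -inner ℝ y₀ w + rangeInnovation α δ y₀ w s (barrier ε rlo s) * s

/-- Landmark dynamics in world coordinates. The parameter is the pair of the robot velocity and the
bearing, the state the pair of a rotation and the estimated range. -/
def field (ε rlo k α : ℝ) (y₀ : E3) (x : (E3 × E3) × (Mat3 × ℝ)) : Mat3 × ℝ :=
  (skew (spin k (act x.2.1 x.1.2) y₀ (act x.2.1 x.1.1) x.2.2) * x.2.1,
    rangeRate ε rlo α (act x.2.1 x.1.2) y₀ (act x.2.1 x.1.1) x.2.2)

/-- Where the landmark dynamics is defined. -/
def domain (ε : ℝ) (y₀ : E3) : Set ((E3 × E3) × (Mat3 × ℝ)) :=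
  {x | ε < x.2.2 ∧ 1 + inner ℝ (act x.2.1 x.1.2) y₀ ≠ 0}

theorem isOpen_domain (ε : ℝ) (y₀ : E3) : IsOpen (domain ε y₀) := by
  have h : Continuous fun x : (E3 × E3) × (Mat3 × ℝ) => act x.2.1 x.1.2 :=
    continuous_act.comp (by fun_prop : Continuous fun x : (E3 × E3) × (Mat3 × ℝ) => (x.2.1, x.1.2))
  exact (isOpen_lt (f := fun _ => ε) (g := fun x : (E3 × E3) × (Mat3 × ℝ) => x.2.2)
    (by fun_prop) (by fun_prop)).inter
    (isOpen_ne_fun (f := fun x : (E3 × E3) × (Mat3 × ℝ) => 1 + inner ℝ (act x.2.1 x.1.2) y₀)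
      (continuous_const.add (h.inner continuous_const)) continuous_const)

section
variable {X : Type*} [NormedAddCommGroup X] [NormedSpace ℝ X] {S : Set X} {δ w : X → E3} {s : X → ℝ}
  {y₀ : E3} {ε rlo : ℝ}

/-- Stated for arbitrary functions δ, w, s so as to serve both the vector field on its domain and
the signals on a compact set. -/
theorem contDiffOn_spin (k : ℝ) (hδ : ContDiffOn ℝ 1 δ S) (hw : ContDiffOn ℝ 1 w S)
    (hs : ContDiffOn ℝ 1 s S) (hs0 : ∀ x ∈ S, s x ≠ 0)
    (hc0 : ∀ x ∈ S, 1 + inner ℝ (δ x) y₀ ≠ 0) :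
    ContDiffOn ℝ 1 (fun x => spin k (δ x) y₀ (w x) (s x)) S := by
  have hc : ContDiffOn ℝ 1 (fun x => 1 + inner ℝ (δ x) y₀) S :=
    contDiffOn_const.add (hδ.inner ℝ contDiffOn_const)
  have hg : ContDiffOn ℝ 1 (fun x => bearingGain k (δ x) y₀ (w x) (s x)) S :=
    (((hδ.inner ℝ hw).div (contDiffOn_const.mul hs) fun x hx => mul_ne_zero two_ne_zero (hs0 x hx)).sub
      (((hδ.add contDiffOn_const).inner ℝ hw).div (hs.mul hc)
        fun x hx => mul_ne_zero (hs0 x hx) (hc0 x hx))).sub contDiffOn_const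
  have h1 : ContDiffOn ℝ 1 (fun x => cross y₀ (w x)) S :=
    contDiff_cross.comp_contDiffOn (f := fun x => (y₀, w x)) (contDiffOn_const.prodMk hw)
  have h2 : ContDiffOn ℝ 1 (fun x => cross (δ x) y₀) S :=
    contDiff_cross.comp_contDiffOn (f := fun x => (δ x, y₀)) (hδ.prodMk contDiffOn_const)
  have h3 : ContDiffOn ℝ 1 (fun x => 1 / s x) S := contDiffOn_const.div hs hs0
  unfold spin
  exact (h3.smul h1).sub (hg.smul h2)

theorem contDiffOn_rangeRate (hε : ε < rlo) (α : ℝ) (hδ : ContDiffOn ℝ 1 δ S)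
    (hw : ContDiffOn ℝ 1 w S) (hs : ContDiffOn ℝ 1 s S) (hs0 : ∀ x ∈ S, s x ≠ 0)
    (hsε : ∀ x ∈ S, ε < s x) (hc0 : ∀ x ∈ S, 1 + inner ℝ (δ x) y₀ ≠ 0) :
    ContDiffOn ℝ 1 (fun x => rangeRate ε rlo α (δ x) y₀ (w x) (s x)) S := by
  have hi : ContDiffOn ℝ 1 (fun x => inner ℝ (δ x) y₀) S := hδ.inner ℝ contDiffOn_const
  have hc : ContDiffOn ℝ 1 (fun x => 1 + inner ℝ (δ x) y₀) S := contDiffOn_const.add hi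
  have hb : ContDiffOn ℝ 1 (fun x => barrier ε rlo (s x)) S :=
    (contDiffOn_barrier hε).comp hs hsε
  have hp : ContDiffOn ℝ 1 (fun x => inner ℝ y₀ (proj (δ x) (w x))) S :=
    contDiffOn_const.inner ℝ (hw.sub ((hδ.inner ℝ hw).smul hδ))
  refine (contDiffOn_const.inner ℝ hw).neg.add (ContDiffOn.mul ?_ hs)
  refine ((((contDiffOn_const.div (hs.pow 2) fun x hx => pow_ne_zero 2 (hs0 x hx)).mul
    ((((contDiffOn_const.sub hi).div (contDiffOn_const.mul hc)
      fun x hx => mul_ne_zero two_ne_zero (hc0 x hx)).mul (hδ.inner ℝ hw)).sub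
      (hp.div (hc.pow 2) fun x hx => pow_ne_zero 2 (hc0 x hx)))).add
    ((contDiffOn_const.div hs hs0).mul ((contDiffOn_const.sub hδ).inner ℝ hw))).add
    ((contDiffOn_const.div hs hs0).mul hb))

end

theorem contDiffOn_field {ε rlo : ℝ} (hε0 : 0 < ε) (hε : ε < rlo) (k α : ℝ) (y₀ : E3) :
    ContDiffOn ℝ 1 (field ε rlo k α y₀) (domain ε y₀) := by
  have hs : ContDiffOn ℝ 1 (fun x : (E3 × E3) × (Mat3 × ℝ) => x.2.2) (domain ε y₀) :=
    (contDiff_snd.comp contDiff_snd).contDiffOn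
  have hM : ContDiff ℝ 1 (fun x : (E3 × E3) × (Mat3 × ℝ) => x.2.1) :=
    contDiff_fst.comp contDiff_snd
  have hw : ContDiffOn ℝ 1 (fun x : (E3 × E3) × (Mat3 × ℝ) => act x.2.1 x.1.1) (domain ε y₀) :=
    (contDiff_act.comp (hM.prodMk (contDiff_fst.comp contDiff_fst))).contDiffOn
  have hδ : ContDiffOn ℝ 1 (fun x : (E3 × E3) × (Mat3 × ℝ) => act x.2.1 x.1.2) (domain ε y₀) :=
    (contDiff_act.comp (hM.prodMk (contDiff_snd.comp contDiff_fst))).contDiffOn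
  have hs0 : ∀ x ∈ domain ε y₀, x.2.2 ≠ 0 := fun x hx => (hε0.trans hx.1).ne'
  exact (contDiff_skew_mul.comp_contDiffOn
    ((contDiffOn_spin k hδ hw hs hs0 fun x hx => hx.2).prodMk hM.contDiffOn)).prodMk
    (contDiffOn_rangeRate hε α hδ hw hs hs0 (fun x hx => hx.1) fun x hx => hx.2)

end

section

attribute [local instance] Matrix.normedAddCommGroup Matrix.normedSpace

/-! ### Error dynamics of one landmark -/

/-- The rate of the bearing error. -/
def bearingRate (k : ℝ) (δ y₀ w : E3) (s r : ℝ) : E3 :=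
  cross (spin k δ y₀ w s) δ - (1 / r) • (w - inner ℝ δ w • δ)

/-- The Lyapunov function of one landmark. -/
def lyap (α : ℝ) (δ y₀ : E3) (s r : ℝ) : ℝ :=
  r * ((1 - inner ℝ δ y₀) / (1 + inner ℝ δ y₀)) + (s - r) ^ 2 / α

/-- The rate of the Lyapunov function. -/
def lyapRate (ε rlo k : ℝ) (δ y₀ : E3) (s r : ℝ) : ℝ :=
  -(2 * k * (r * ((1 - inner ℝ δ y₀) / (1 + inner ℝ δ y₀)))) + 2 * (s - r) * barrier ε rlo s

/-- At δ = y₀ the term with the gain disappears; this is what isolates the range error in the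
convergence proof. -/
theorem cross_spin {δ y₀ : E3} (hδ : ‖δ‖ = 1) (k : ℝ) (w : E3) (s : ℝ) :
    cross (spin k δ y₀ w s) δ = (1 / s) • (inner ℝ δ y₀ • w - inner ℝ δ w • y₀)
      - bearingGain k δ y₀ w s • (y₀ - inner ℝ δ y₀ • δ) := by
  rw [spin, sub_cross, smul_cross, smul_cross, cross_cross_left, cross_cross_left,
    real_inner_self_eq_norm_sq, hδ, real_inner_comm δ y₀, real_inner_comm δ w, one_pow, one_smul]

theorem inner_bearingRate {δ y₀ : E3} (hδ : ‖δ‖ = 1) (hy : ‖y₀‖ = 1) (k : ℝ) (w : E3) {s r : ℝ}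
    (hs : s ≠ 0) (hc : 1 + inner ℝ δ y₀ ≠ 0) :
    inner ℝ (bearingRate k δ y₀ w s r) y₀ =
      (1 / s - 1 / r) * (inner ℝ y₀ w - inner ℝ δ y₀ * inner ℝ δ w)
      - inner ℝ δ w * (1 - inner ℝ δ y₀ ^ 2) / (2 * s) + k * (1 - inner ℝ δ y₀ ^ 2) := by
  rw [bearingRate, cross_spin hδ, bearingGain]
  simp only [inner_sub_left, inner_add_left, inner_smul_left, real_inner_self_eq_norm_sq, hy,
    real_inner_comm y₀ w, conj_trivial]
  generalize inner ℝ δ y₀ = c at *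
  generalize inner ℝ δ w = a
  generalize inner ℝ y₀ w = b
  rcases eq_or_ne r 0 with rfl | hr
  · simp only [div_zero]
    field_simp
    ring
  · field_simp
    ring

/-- The part (y₀ - δ)ᵀ w / s of the range innovation replaces the drift -⟨y₀, w⟩ by -⟨δ, w⟩, the
rate of the true range. So s - r is driven only by the α-terms. -/
theorem rangeRate_eq (ε rlo α : ℝ) (δ y₀ w : E3) {s : ℝ} (hs : s ≠ 0) :
    rangeRate ε rlo α δ y₀ w s = -inner ℝ δ w
      + α / s * ((1 - inner ℝ δ y₀) / (2 * (1 + inner ℝ δ y₀)) * inner ℝ δ w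
        - (inner ℝ y₀ w - inner ℝ δ y₀ * inner ℝ δ w) / (1 + inner ℝ δ y₀) ^ 2)
      + α * barrier ε rlo s := by
  rw [rangeRate, rangeInnovation, proj]
  simp only [inner_sub_left, inner_sub_right, inner_smul_right, real_inner_comm δ y₀]
  generalize inner ℝ δ y₀ = c
  generalize inner ℝ δ w = a
  generalize inner ℝ y₀ w = b
  generalize barrier ε rlo s = β
  have : ∀ X : ℝ, -b + (α / s ^ 2 * X + 1 / s * (b - a) + α / s * β) * s
      = -a + α / s * X + α * β := by
    intro X
    field_simp
    ring
  rw [this, mul_comm a c]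

/-- Put a = ⟨δ, w⟩, b = ⟨y₀, w⟩. Since l' = -2 c'/(1 + c)² and r' = -a, the derivative of r l is -2
k r l + ((s - r)/s) (2 (b - c a)/(1 + c)² - a l). The α-part of the range innovation makes (s -
r)²/α contribute exactly the opposite of the velocity term, besides 2 (s - r) β. -/
theorem hasDerivWithinAt_lyap {δ : ℝ → E3} {s r : ℝ → ℝ} {J : Set ℝ} {t ε rlo k α : ℝ} {y₀ w : E3}
    (hα : α ≠ 0) (hδ : ‖δ t‖ = 1) (hy : ‖y₀‖ = 1) (hs0 : s t ≠ 0) (hr0 : r t ≠ 0)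
    (hc : 1 + inner ℝ (δ t) y₀ ≠ 0)
    (dδ : HasDerivWithinAt δ (bearingRate k (δ t) y₀ w (s t) (r t)) J t)
    (ds : HasDerivWithinAt s (rangeRate ε rlo α (δ t) y₀ w (s t)) J t)
    (dr : HasDerivWithinAt r (-inner ℝ (δ t) w) J t) :
    HasDerivWithinAt (fun τ => lyap α (δ τ) y₀ (s τ) (r τ))
      (lyapRate ε rlo k (δ t) y₀ (s t) (r t)) J t := by
  have dc : HasDerivWithinAt (fun τ => inner ℝ (δ τ) y₀)
      (inner ℝ (bearingRate k (δ t) y₀ w (s t) (r t)) y₀) J t := by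
    simpa using dδ.inner ℝ (hasDerivWithinAt_const t J y₀)
  rw [inner_bearingRate hδ hy k w hs0 hc] at dc
  rw [rangeRate_eq _ _ _ _ _ _ hs0] at ds
  refine ((dr.mul ((dc.const_sub 1).div (dc.const_add 1) hc)).add
    (((ds.sub dr).pow 2).div_const α)).congr_deriv ?_
  rw [lyapRate]
  simp only [Pi.sub_apply, Pi.div_apply]
  generalize inner ℝ (δ t) y₀ = c at *
  generalize inner ℝ (δ t) w = a
  generalize inner ℝ y₀ w = b
  generalize barrier ε rlo (s t) = β
  field_simp
  push_cast
  ring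

/-- Relative motion of robot and landmark in the world frame: robot velocity `v`, bearing `z`,
range `r`. -/
structure IsMotion (rlo rhi C : ℝ) (v z : ℝ → E3) (r : ℝ → ℝ) : Prop where
  uc_v : UniformContinuousOn v (Ici 0)
  norm_v : ∀ t ∈ Ici (0 : ℝ), ‖v t‖ ≤ C
  norm_z : ∀ t ∈ Ici (0 : ℝ), ‖z t‖ = 1
  lo : ∀ t ∈ Ici (0 : ℝ), rlo ≤ r t
  hi : ∀ t ∈ Ici (0 : ℝ), r t ≤ rhi
  dz : ∀ t ∈ Ici (0 : ℝ), HasDerivWithinAt z (-((1 / r t) • (v t - inner ℝ (z t) (v t) • z t)))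
    (Ici 0) t
  dr : ∀ t ∈ Ici (0 : ℝ), HasDerivWithinAt r (-inner ℝ (z t) (v t)) (Ici 0) t

/-- Solution of the landmark dynamics on `J` with values in rotations. -/
structure IsLandmarkSolution (ε rlo k α : ℝ) (y₀ : E3) (v z : ℝ → E3) (J : Set ℝ) (M : ℝ → Mat3)
    (s : ℝ → ℝ) : Prop where
  so : ∀ t ∈ J, M t ∈ SO3
  gt : ∀ t ∈ J, ε < s t
  ne : ∀ t ∈ J, 1 + inner ℝ (act (M t) (z t)) y₀ ≠ 0
  dM : ∀ t ∈ J, HasDerivWithinAt M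
    (skew (spin k (act (M t) (z t)) y₀ (act (M t) (v t)) (s t)) * M t) J t
  ds : ∀ t ∈ J, HasDerivWithinAt s (rangeRate ε rlo α (act (M t) (z t)) y₀ (act (M t) (v t)) (s t)) J t

variable {ε rlo rhi C k α : ℝ} {y₀ : E3} {v z : ℝ → E3} {r : ℝ → ℝ} {J : Set ℝ} {M : ℝ → Mat3}
  {s : ℝ → ℝ}

theorem IsLandmarkSolution.mono (h : IsLandmarkSolution ε rlo k α y₀ v z J M s) {J' : Set ℝ}
    (hJ : J' ⊆ J) : IsLandmarkSolution ε rlo k α y₀ v z J' M s :=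
  ⟨fun t ht => h.so t (hJ ht), fun t ht => h.gt t (hJ ht), fun t ht => h.ne t (hJ ht),
    fun t ht => (h.dM t (hJ ht)).mono hJ, fun t ht => (h.ds t (hJ ht)).mono hJ⟩

theorem IsLandmarkSolution.norm_bearing (h : IsLandmarkSolution ε rlo k α y₀ v z J M s)
    (hm : IsMotion rlo rhi C v z r) (hJ : J ⊆ Ici 0) {t : ℝ} (ht : t ∈ J) :
    ‖act (M t) (z t)‖ = 1 :=
  (norm_act ⟨M t, h.so t ht⟩ (z t)).trans (hm.norm_z t (hJ ht))

theorem IsLandmarkSolution.norm_velocity (h : IsLandmarkSolution ε rlo k α y₀ v z J M s)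
    (hm : IsMotion rlo rhi C v z r) (hJ : J ⊆ Ici 0) {t : ℝ} (ht : t ∈ J) :
    ‖act (M t) (v t)‖ ≤ C :=
  (norm_act ⟨M t, h.so t ht⟩ (v t)).trans_le (hm.norm_v t (hJ ht))

theorem IsLandmarkSolution.inner_eq (h : IsLandmarkSolution ε rlo k α y₀ v z J M s)
    {t : ℝ} (ht : t ∈ J) :
    inner ℝ (act (M t) (z t)) (act (M t) (v t)) = inner ℝ (z t) (v t) :=
  inner_act_act ⟨M t, h.so t ht⟩ (z t) (v t)

/-- Product rule: M turns by `spin`, and being a rotation it carries the projection of v orthogonal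
to z to that of w orthogonal to δ. -/
theorem IsLandmarkSolution.hasDerivWithinAt_bearing
    (h : IsLandmarkSolution ε rlo k α y₀ v z J M s) (hm : IsMotion rlo rhi C v z r)
    (hJ : J ⊆ Ici 0) {t : ℝ} (ht : t ∈ J) :
    HasDerivWithinAt (fun τ => act (M τ) (z τ))
      (bearingRate k (act (M t) (z t)) y₀ (act (M t) (v t)) (s t) (r t)) J t := by
  refine ((h.dM t ht).act ((hm.dz t (hJ ht)).mono hJ)).congr_deriv ?_
  rw [bearingRate, h.inner_eq ht, act_mul, act_neg, act_smul, act_sub, act_smul, ← sub_eq_add_neg]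
  rfl

theorem one_add_inner_nonneg {δ y : E3} (hδ : ‖δ‖ = 1) (hy : ‖y‖ = 1) : 0 ≤ 1 + inner ℝ δ y := by
  have := neg_le_of_abs_le (abs_real_inner_le_norm δ y)
  rw [hδ, hy] at this
  linarith

theorem inner_le_one {δ y : E3} (hδ : ‖δ‖ = 1) (hy : ‖y‖ = 1) : inner ℝ δ y ≤ 1 := by
  have := real_inner_le_norm δ y
  rw [hδ, hy] at this
  linarith

theorem norm_sub_sq_unit {δ y : E3} (hδ : ‖δ‖ = 1) (hy : ‖y‖ = 1) :
    ‖δ - y‖ ^ 2 = 2 * (1 - inner ℝ δ y) := by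
  rw [norm_sub_sq_real, hδ, hy]; ring

theorem one_add_inner_ne_zero_iff {δ y : E3} (hδ : ‖δ‖ = 1) (hy : ‖y‖ = 1) :
    1 + inner ℝ δ y ≠ 0 ↔ δ ≠ -y := by
  have h : ‖δ + y‖ ^ 2 = 2 * (1 + inner ℝ δ y) := by
    rw [norm_add_sq_real, hδ, hy]; ring
  rw [not_iff_not, ← add_eq_zero_iff_eq_neg, ← norm_eq_zero (a := δ + y),
    ← sq_eq_zero_iff (a := ‖δ + y‖), h]
  simp

theorem IsLandmarkSolution.one_add_pos (h : IsLandmarkSolution ε rlo k α y₀ v z J M s)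
    (hm : IsMotion rlo rhi C v z r) (hy : ‖y₀‖ = 1) (hJ : J ⊆ Ici 0) {t : ℝ} (ht : t ∈ J) :
    0 < 1 + inner ℝ (act (M t) (z t)) y₀ :=
  lt_of_le_of_ne (one_add_inner_nonneg (h.norm_bearing hm hJ ht) hy) (h.ne t ht).symm

theorem IsLandmarkSolution.quotient_nonneg (h : IsLandmarkSolution ε rlo k α y₀ v z J M s)
    (hm : IsMotion rlo rhi C v z r) (hy : ‖y₀‖ = 1) (hJ : J ⊆ Ici 0) {t : ℝ} (ht : t ∈ J) :
    0 ≤ (1 - inner ℝ (act (M t) (z t)) y₀) / (1 + inner ℝ (act (M t) (z t)) y₀) :=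
  div_nonneg (sub_nonneg.2 (inner_le_one (h.norm_bearing hm hJ ht) hy)) (h.one_add_pos hm hy hJ ht).le

theorem IsLandmarkSolution.hasDerivWithinAt_lyap
    (h : IsLandmarkSolution ε rlo k α y₀ v z J M s) (hm : IsMotion rlo rhi C v z r)
    (hα : 0 < α) (hε0 : 0 < ε) (hlo : 0 < rlo) (hy : ‖y₀‖ = 1) (hJ : J ⊆ Ici 0) {t : ℝ} (ht : t ∈ J) :
    HasDerivWithinAt (fun τ => lyap α (act (M τ) (z τ)) y₀ (s τ) (r τ))
      (lyapRate ε rlo k (act (M t) (z t)) y₀ (s t) (r t)) J t :=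
  VSLAM.hasDerivWithinAt_lyap (δ := fun τ => act (M τ) (z τ)) (w := act (M t) (v t))
    hα.ne' (h.norm_bearing hm hJ ht) hy (hε0.trans (h.gt t ht)).ne'
    (hlo.trans_le (hm.lo t (hJ ht))).ne' (h.ne t ht) (h.hasDerivWithinAt_bearing hm hJ ht)
    (h.ds t ht) (by rw [h.inner_eq ht]; exact (hm.dr t (hJ ht)).mono hJ)

/-- The barrier acts only below rlo, hence below the true range, where raising the estimate reduces
the error. -/
theorem mul_barrier_nonpos {x ρ : ℝ} (hx : ε < x) (hρ : rlo ≤ ρ) :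
    2 * (x - ρ) * barrier ε rlo x ≤ 0 := by
  rcases lt_or_ge x rlo with h | h
  · exact mul_nonpos_of_nonpos_of_nonneg (by linarith) (barrier_nonneg hx)
  · rw [barrier, if_neg h.not_gt, mul_zero]

theorem IsLandmarkSolution.lyapRate_le
    (h : IsLandmarkSolution ε rlo k α y₀ v z J M s) (hm : IsMotion rlo rhi C v z r)
    (hk : 0 < k) (hy : ‖y₀‖ = 1) (hJ : J ⊆ Ici 0) {t : ℝ} (ht : t ∈ J) :
    lyapRate ε rlo k (act (M t) (z t)) y₀ (s t) (r t) ≤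
      -(2 * k * (rlo * ((1 - inner ℝ (act (M t) (z t)) y₀) / (1 + inner ℝ (act (M t) (z t)) y₀)))) := by
  have h1 := mul_barrier_nonpos (h.gt t ht) (hm.lo t (hJ ht))
  have h2 : rlo * ((1 - inner ℝ (act (M t) (z t)) y₀) / (1 + inner ℝ (act (M t) (z t)) y₀)) ≤
      r t * ((1 - inner ℝ (act (M t) (z t)) y₀) / (1 + inner ℝ (act (M t) (z t)) y₀)) :=
    mul_le_mul_of_nonneg_right (hm.lo t (hJ ht)) (h.quotient_nonneg hm hy hJ ht)
  have h3 := mul_le_mul_of_nonneg_left h2 (by positivity : 0 ≤ 2 * k)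
  rw [lyapRate]
  linarith

theorem IsLandmarkSolution.antitoneOn_lyap
    (h : IsLandmarkSolution ε rlo k α y₀ v z J M s) (hm : IsMotion rlo rhi C v z r)
    (hk : 0 < k) (hα : 0 < α) (hε0 : 0 < ε) (hlo : 0 < rlo) (hy : ‖y₀‖ = 1) (hJ : J ⊆ Ici 0)
    (hJc : Convex ℝ J) : AntitoneOn (fun τ => lyap α (act (M τ) (z τ)) y₀ (s τ) (r τ)) J := by
  have hd := fun t (ht : t ∈ J) => h.hasDerivWithinAt_lyap hm hα hε0 hlo hy hJ ht
  refine antitoneOn_of_hasDerivWithinAt_nonpos hJc (fun t ht => (hd t ht).continuousWithinAt)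
    (fun t ht => (hd t (interior_subset ht)).mono interior_subset) fun t ht => ?_
  refine (h.lyapRate_le hm hk hy hJ (interior_subset ht)).trans ?_
  have := h.quotient_nonneg hm hy hJ (interior_subset ht)
  rw [neg_nonpos]
  positivity

/-- Consequences of a bound on the Lyapunov function. -/
theorem bounds_of_lyap_le {δ : E3} {x ρ B : ℝ} (hδ : ‖δ‖ = 1) (hy : ‖y₀‖ = 1) (hα : 0 < α)
    (hlo : 0 < rlo) (hρ : rlo ≤ ρ) (hρ' : ρ ≤ rhi)
    (hc : 1 + inner ℝ δ y₀ ≠ 0) (hB : lyap α δ y₀ x ρ ≤ B) :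
    (1 - inner ℝ δ y₀) / (1 + inner ℝ δ y₀) ≤ B / rlo ∧
      2 / (1 + B / rlo) ≤ 1 + inner ℝ δ y₀ ∧ (x - ρ) ^ 2 ≤ α * B ∧ x ≤ rhi + √(α * B) ∧ 0 ≤ B := by
  have hp : 0 < 1 + inner ℝ δ y₀ := lt_of_le_of_ne (one_add_inner_nonneg hδ hy) hc.symm
  have hq : 0 ≤ (1 - inner ℝ δ y₀) / (1 + inner ℝ δ y₀) :=
    div_nonneg (sub_nonneg.2 (inner_le_one hδ hy)) hp.le
  have hρ0 : 0 < ρ := hlo.trans_le hρ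
  have h2 : 0 ≤ (x - ρ) ^ 2 / α := by positivity
  have h3 : 0 ≤ ρ * ((1 - inner ℝ δ y₀) / (1 + inner ℝ δ y₀)) := by positivity
  rw [lyap] at hB
  have hl : (1 - inner ℝ δ y₀) / (1 + inner ℝ δ y₀) ≤ B / rlo := by
    rw [le_div_iff₀ hlo]
    nlinarith
  have he : (x - ρ) ^ 2 ≤ α * B := by
    have : (x - ρ) ^ 2 / α ≤ B := by linarith
    rw [div_le_iff₀ hα] at this
    linarith
  refine ⟨hl, ?_, he, ?_, by linarith⟩
  · have h4 : 1 + B / rlo ≥ 2 / (1 + inner ℝ δ y₀) := by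
      have : 2 / (1 + inner ℝ δ y₀) = 1 + (1 - inner ℝ δ y₀) / (1 + inner ℝ δ y₀) := by
        field_simp; ring
      linarith
    rw [ge_iff_le, div_le_iff₀ hp] at h4
    rw [div_le_iff₀ (by linarith)]
    linarith
  · have := Real.le_sqrt_of_sq_le he
    linarith

end

section

attribute [local instance] Matrix.normedAddCommGroup Matrix.normedSpace

variable {ε rlo rhi C k α : ℝ} {y₀ : E3} {v z : ℝ → E3} {r : ℝ → ℝ} {J : Set ℝ} {M : ℝ → Mat3}
  {s : ℝ → ℝ}

/-! ### A priori bounds and existence for one landmark -/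

theorem IsLandmarkSolution.lyap_le (h : IsLandmarkSolution ε rlo k α y₀ v z J M s)
    (hm : IsMotion rlo rhi C v z r) (hk : 0 < k) (hα : 0 < α) (hε0 : 0 < ε) (hlo : 0 < rlo)
    (hy : ‖y₀‖ = 1) (hJ : J ⊆ Ici 0) (hJc : Convex ℝ J) (h0 : 0 ∈ J) {t : ℝ} (ht : t ∈ J) :
    lyap α (act (M t) (z t)) y₀ (s t) (r t) ≤ lyap α (act (M 0) (z 0)) y₀ (s 0) (r 0) :=
  h.antitoneOn_lyap hm hk hα hε0 hlo hy hJ hJc h0 ht (hJ ht)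

/-- The rate of the estimated range, up to the barrier, is bounded below while the Lyapunov
function is bounded. -/
theorem neg_add_le_rangeRate {δ w : E3} {x D : ℝ} (hδ : ‖δ‖ = 1) (hy : ‖y₀‖ = 1) (hα : 0 < α)
    (hw : ‖w‖ ≤ C) (hε0 : 0 < ε) (hx : ε < x) (hc : 0 < 1 + inner ℝ δ y₀)
    (hD : (1 - inner ℝ δ y₀) / (1 + inner ℝ δ y₀) ≤ D) :
    -(C + α / ε * (D * C / 2 + 2 * C * ((1 + D) / 2) ^ 2)) + α * barrier ε rlo x ≤
      rangeRate ε rlo α δ y₀ w x := by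
  have hC : 0 ≤ C := (norm_nonneg w).trans hw
  have hx0 : 0 < x := hε0.trans hx
  rw [rangeRate_eq _ _ _ _ _ _ hx0.ne']
  have ha : |inner ℝ δ w| ≤ C := (abs_real_inner_le_norm δ w).trans (by rw [hδ, one_mul]; exact hw)
  have hb : |inner ℝ y₀ w| ≤ C := (abs_real_inner_le_norm y₀ w).trans (by rw [hy, one_mul]; exact hw)
  have hc1 : |inner ℝ δ y₀| ≤ 1 := by
    have := abs_real_inner_le_norm δ y₀
    rwa [hδ, hy, one_mul] at this
  have hl0 : 0 ≤ (1 - inner ℝ δ y₀) / (1 + inner ℝ δ y₀) :=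
    div_nonneg (sub_nonneg.2 (inner_le_one hδ hy)) hc.le
  -- With 1/(1 + c) = (1 + l)/2 the singular denominators are expressed through l, and the bound D
  -- on l controls everything.
  have hinv : 1 / (1 + inner ℝ δ y₀) = (1 + (1 - inner ℝ δ y₀) / (1 + inner ℝ δ y₀)) / 2 := by
    field_simp; ring
  have e1 : (1 - inner ℝ δ y₀) / (2 * (1 + inner ℝ δ y₀)) * inner ℝ δ w
        - (inner ℝ y₀ w - inner ℝ δ y₀ * inner ℝ δ w) / (1 + inner ℝ δ y₀) ^ 2
      = (1 - inner ℝ δ y₀) / (1 + inner ℝ δ y₀) * inner ℝ δ w / 2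
        - (inner ℝ y₀ w - inner ℝ δ y₀ * inner ℝ δ w) * (1 / (1 + inner ℝ δ y₀)) ^ 2 := by
    field_simp
  rw [e1, hinv]
  generalize inner ℝ δ w = a at *
  generalize inner ℝ y₀ w = b at *
  generalize (1 - inner ℝ δ y₀) / (1 + inner ℝ δ y₀) = l at *
  generalize inner ℝ δ y₀ = c at *
  have hD0 : 0 ≤ D := hl0.trans hD
  have hla : |l * a / 2| ≤ D * C / 2 := by
    rw [abs_div, abs_mul, abs_of_nonneg hl0, abs_two]
    gcongr
  have hbca : |b - c * a| ≤ 2 * C := by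
    calc |b - c * a| ≤ |b| + |c * a| := abs_sub _ _
      _ ≤ C + 1 * C := by rw [abs_mul]; gcongr
      _ = 2 * C := by ring
  have hterm : |(b - c * a) * ((1 + l) / 2) ^ 2| ≤ 2 * C * ((1 + D) / 2) ^ 2 := by
    rw [abs_mul, abs_of_nonneg (sq_nonneg ((1 + l) / 2))]
    gcongr
  have hX : |l * a / 2 - (b - c * a) * ((1 + l) / 2) ^ 2| ≤ D * C / 2 + 2 * C * ((1 + D) / 2) ^ 2 :=
    (abs_sub _ _).trans (add_le_add hla hterm)
  have hY : |α / x * (l * a / 2 - (b - c * a) * ((1 + l) / 2) ^ 2)| ≤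
      α / ε * (D * C / 2 + 2 * C * ((1 + D) / 2) ^ 2) := by
    rw [abs_mul, abs_of_pos (by positivity : 0 < α / x)]
    gcongr
  linarith [neg_le_of_abs_le hY, le_of_abs_le ha]

/-- The estimated range stays away from the threshold, uniformly in the solution. -/
theorem exists_lt_range (hε0 : 0 < ε) (hε : ε < rlo) (hk : 0 < k) (hα : 0 < α) (hy : ‖y₀‖ = 1)
    {s₀ : ℝ} (hs₀ : ε < s₀) (B : ℝ) (hm : IsMotion rlo rhi C v z r) :
    ∃ m, ε < m ∧ ∀ T M s, 0 ≤ T → IsLandmarkSolution ε rlo k α y₀ v z (Icc 0 T) M s → s 0 = s₀ →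
      lyap α (act (M 0) (z 0)) y₀ (s 0) (r 0) ≤ B → ∀ t ∈ Icc 0 T, m ≤ s t := by
  have hlo : 0 < rlo := hε0.trans hε
  set D := B / rlo
  set N := C + α / ε * (D * C / 2 + 2 * C * ((1 + D) / 2) ^ 2)
  -- D bounds l, and -N bounds the rate of s from below apart from the barrier. The three bounds on
  -- d say: s starts at or above ε + d; this level is below the midpoint of ε and rlo, where
  -- `le_barrier` applies; and there α β ≥ α/(4 d) ≥ |N| + 1.
  set d := min (s₀ - ε) (min ((rlo - ε) / 2) (α / (4 * (|N| + 1))))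
  have hN : 0 < |N| + 1 := by positivity
  have hd : 0 < d := lt_min (by linarith) (lt_min (by linarith) (by positivity))
  have hd1 : d ≤ s₀ - ε := min_le_left _ _
  have hd2 : d ≤ (rlo - ε) / 2 := (min_le_right _ _).trans (min_le_left _ _)
  have hd3 : d ≤ α / (4 * (|N| + 1)) := (min_le_right _ _).trans (min_le_right _ _)
  refine ⟨ε + d, by linarith, fun T M s hT h hs0 hB t ht => ?_⟩
  have hJ : Icc 0 T ⊆ Ici (0 : ℝ) := Icc_subset_Ici_self
  have hsc : ContinuousOn s (Icc 0 T) := fun τ hτ => (h.ds τ hτ).continuousWithinAt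
  -- Fencing: on the level s = ε + d the rate of s is strictly positive, so s cannot pass below it.
  -- The comparison is made for -s with a constant upper barrier.
  have key := image_le_of_deriv_right_lt_deriv_boundary (f := fun τ => -s τ)
    (f' := fun τ => -rangeRate ε rlo α (act (M τ) (z τ)) y₀ (act (M τ) (v τ)) (s τ))
    (B := fun _ => -(ε + d)) (B' := fun _ => 0) (a := 0) (b := T) hsc.neg
    (fun τ hτ => ((h.ds τ (Ico_subset_Icc_self hτ)).mono_of_mem_nhdsWithin
      (Icc_mem_nhdsGE_of_mem hτ)).neg)
    (by simp only [hs0]; linarith) (fun τ => hasDerivAt_const τ _) (fun τ hτ hse => ?_) ht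
  · linarith
  · have hτ' := Ico_subset_Icc_self hτ
    have hle := (h.lyap_le hm hk hα hε0 hlo hy hJ (convex_Icc 0 T) (left_mem_Icc.2 hT) hτ').trans hB
    have hb := bounds_of_lyap_le (h.norm_bearing hm hJ hτ') hy hα hlo (hm.lo τ (hJ hτ'))
      (hm.hi τ (hJ hτ')) (h.ne τ hτ') hle
    have hr := neg_add_le_rangeRate (rlo := rlo) (h.norm_bearing hm hJ hτ') hy hα
      (h.norm_velocity hm hJ hτ') hε0 (h.gt τ hτ') (h.one_add_pos hm hy hJ hτ') hb.1
    change -N + _ ≤ _ at hr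
    have hse' : s τ = ε + d := neg_injective hse
    have hbar := le_barrier (ε := ε) (rlo := rlo) (h.gt τ hτ') (by linarith)
    rw [show s τ - ε = d by linarith] at hbar
    have h1 : |N| + 1 ≤ α * barrier ε rlo (s τ) := by
      refine le_trans ?_ (mul_le_mul_of_nonneg_left hbar hα.le)
      rw [le_div_iff₀ (by positivity)] at hd3
      rw [mul_one_div, le_div_iff₀ (by positivity)]
      linarith
    have h2 := le_abs_self N
    linarith

instance : ProperSpace Mat3 := inferInstanceAs (ProperSpace (Fin 3 → Fin 3 → ℝ))

instance : FiniteDimensional ℝ Mat3 := inferInstanceAs (FiniteDimensional ℝ (Fin 3 → Fin 3 → ℝ))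

theorem norm_SO3_le (Q : SO3) : ‖(Q : Mat3)‖ ≤ 1 :=
  (Matrix.norm_le_iff zero_le_one).2 fun i j => SO3_entry_abs_le Q i j

/-- The compact set to which a landmark solution is confined. -/
def confinement (C c₀ m m' : ℝ) (y₀ : E3) : Set ((E3 × E3) × (Mat3 × ℝ)) :=
  ((Metric.closedBall 0 C ×ˢ Metric.closedBall 0 1) ×ˢ (Metric.closedBall 0 1 ×ˢ Icc m m')) ∩
    {x | c₀ ≤ 1 + inner ℝ (act x.2.1 x.1.2) y₀}

theorem isCompact_confinement (C c₀ m m' : ℝ) (y₀ : E3) : IsCompact (confinement C c₀ m m' y₀) := by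
  have h : Continuous fun x : (E3 × E3) × (Mat3 × ℝ) => act x.2.1 x.1.2 :=
    continuous_act.comp (by fun_prop : Continuous fun x : (E3 × E3) × (Mat3 × ℝ) => (x.2.1, x.1.2))
  refine IsCompact.inter_right ?_ (isClosed_le (f := fun _ => c₀) continuous_const
    (continuous_const.add (h.inner continuous_const)))
  exact ((isCompact_closedBall _ _).prod (isCompact_closedBall _ _)).prod
    ((isCompact_closedBall _ _).prod isCompact_Icc)

theorem IsLandmarkSolution.mem_confinement (h : IsLandmarkSolution ε rlo k α y₀ v z J M s)
    (hm : IsMotion rlo rhi C v z r) (hk : 0 < k) (hα : 0 < α) (hε0 : 0 < ε) (hlo : 0 < rlo)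
    (hy : ‖y₀‖ = 1) (hJ : J ⊆ Ici 0) (hJc : Convex ℝ J) (h0 : 0 ∈ J) {t m B : ℝ}
    (hB : lyap α (act (M 0) (z 0)) y₀ (s 0) (r 0) = B) (ht : t ∈ J) (hmt : m ≤ s t) :
    ((v t, z t), (M t, s t)) ∈ confinement C (2 / (1 + B / rlo)) m (rhi + √(α * B)) y₀ := by
  have hb := bounds_of_lyap_le (h.norm_bearing hm hJ ht) hy hα hlo (hm.lo t (hJ ht))
    (hm.hi t (hJ ht)) (h.ne t ht)
    ((h.lyap_le hm hk hα hε0 hlo hy hJ hJc h0 ht).trans_eq hB)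
  refine ⟨⟨⟨?_, ?_⟩, ?_, hmt, hb.2.2.2.1⟩, hb.2.1⟩
  · simpa using hm.norm_v t (hJ ht)
  · simpa using (hm.norm_z t (hJ ht)).le
  · simpa using norm_SO3_le ⟨M t, h.so t ht⟩

/-- Solutions of `M' = Ω(t)^× M` starting at a rotation stay rotations. -/
theorem mem_SO3_of_hasDerivWithinAt {T : ℝ} {Ω : ℝ → E3}
    (hM : ∀ t ∈ Icc 0 T, HasDerivWithinAt M (skew (Ω t) * M t) (Icc 0 T) t) (h0 : M 0 ∈ SO3)
    {t : ℝ} (ht : t ∈ Icc 0 T) : M t ∈ SO3 := by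
  have hT : 0 ≤ T := ht.1.trans ht.2
  have horth : ∀ t ∈ Icc 0 T, (M t).transpose * M t = 1 := by
    have hd : ∀ t ∈ Icc 0 T, HasDerivWithinAt (fun τ => (M τ).transpose * M τ) 0 (Icc 0 T) t :=
      fun t ht => ((hM t ht).matrix_transpose.matrix_mul (hM t ht)).congr_deriv (by
        rw [Matrix.transpose_mul, skew_transpose]
        simp [Matrix.mul_assoc])
    intro t ht
    have := (convex_Icc 0 T).norm_image_sub_le_of_norm_hasDerivWithin_le (C := 0) hd (by simp)
      (left_mem_Icc.2 hT) ht
    rw [zero_mul, norm_le_zero_iff, sub_eq_zero] at this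
    rw [this]
    exact transpose_mul_SO3 ⟨M 0, h0⟩
  -- Orthogonality leaves det M = ±1. Starting from 1, a continuous determinant could reach -1 only
  -- through the forbidden value 0.
  have hdet : ∀ t ∈ Icc 0 T, (M t).det = 1 ∨ (M t).det = -1 := fun t ht => by
    have := congrArg Matrix.det (horth t ht)
    rw [Matrix.det_mul, Matrix.det_transpose, Matrix.det_one] at this
    exact mul_self_eq_one_iff.1 this
  have hcont : ContinuousOn (fun t => (M t).det) (Icc 0 T) :=
    Continuous.comp_continuousOn (continuous_id.matrix_det)
      fun t ht => (hM t ht).continuousWithinAt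
  refine Matrix.mem_specialOrthogonalGroup_iff.2
    ⟨(Matrix.mem_orthogonalGroup_iff' (Fin 3) ℝ).2 (horth t ht), ?_⟩
  refine (hdet t ht).resolve_right fun hneg => ?_
  have h1 : (M 0).det = 1 := det_SO3 ⟨M 0, h0⟩
  obtain ⟨τ, hτ, hτ0⟩ := (isPreconnected_Icc.intermediate_value ht (left_mem_Icc.2 hT) hcont)
    (show (0 : ℝ) ∈ Icc _ _ by rw [hneg, h1]; norm_num)
  simp only at hτ0
  rcases hdet τ hτ with h | h <;> rw [hτ0] at h <;> norm_num at h

/-- The equation is solved in the linear space of all matrices; membership in the rotation group is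
recovered afterwards from the skew form of the field. -/
theorem isLandmarkSolution_of_field {T : ℝ} {x : ℝ → Mat3 × ℝ}
    (hx : ∀ t ∈ Icc 0 T, ((v t, z t), x t) ∈ domain ε y₀ ∧
      HasDerivWithinAt x (field ε rlo k α y₀ ((v t, z t), x t)) (Icc 0 T) t) (h0 : (x 0).1 ∈ SO3) :
    IsLandmarkSolution ε rlo k α y₀ v z (Icc 0 T) (fun t => (x t).1) (fun t => (x t).2) := by
  have hM : ∀ t ∈ Icc 0 T, HasDerivWithinAt (fun t => (x t).1) _ (Icc 0 T) t :=
    fun t ht => (hx t ht).2.fst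
  exact ⟨fun t ht => mem_SO3_of_hasDerivWithinAt hM h0 ht, fun t ht => (hx t ht).1.1,
    fun t ht => (hx t ht).1.2, hM, fun t ht => (hx t ht).2.snd⟩

theorem IsMotion.continuousOn_z (hm : IsMotion rlo rhi C v z r) : ContinuousOn z (Ici 0) :=
  fun t ht => (hm.dz t ht).continuousWithinAt

/-- Global existence for one landmark. -/
theorem exists_isLandmarkSolution (hε0 : 0 < ε) (hε : ε < rlo) (hk : 0 < k) (hα : 0 < α)
    (hy : ‖y₀‖ = 1) (hm : IsMotion rlo rhi C v z r) {M₀ : Mat3} (hM₀ : M₀ ∈ SO3) {s₀ : ℝ}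
    (hs₀ : ε < s₀) (hne : 1 + inner ℝ (act M₀ (z 0)) y₀ ≠ 0) :
    ∃ M s, M 0 = M₀ ∧ s 0 = s₀ ∧ IsLandmarkSolution ε rlo k α y₀ v z (Ici 0) M s := by
  have hlo : 0 < rlo := hε0.trans hε
  set B := lyap α (act M₀ (z 0)) y₀ s₀ (r 0) with hB
  have h00 : (0 : ℝ) ∈ Ici (0 : ℝ) := mem_Ici.2 le_rfl
  have hB0 : 0 ≤ B := (bounds_of_lyap_le ((norm_act ⟨M₀, hM₀⟩ _).trans (hm.norm_z 0 h00)) hy hα hlo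
    (hm.lo 0 h00) (hm.hi 0 h00) hne hB.ge).2.2.2.2
  obtain ⟨m, hεm, hms⟩ := exists_lt_range hε0 hε hk hα hy hs₀ B hm
  -- 2/(1 + B/rlo) is the lower bound of 1 + c obtained from the Lyapunov bound B. It is positive
  -- because B ≥ 0, so the confining set avoids δ = -y₀.
  have hKO : confinement C (2 / (1 + B / rlo)) m (rhi + √(α * B)) y₀ ⊆ domain ε y₀ := fun x hx =>
    ⟨hεm.trans_le hx.1.2.2.1, ((by positivity : 0 < 2 / (1 + B / rlo)).trans_le hx.2).ne'⟩
  obtain ⟨x, hx0, hx⟩ := exists_solution_Ici_of_apriori (u := fun t => (v t, z t))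
    (isOpen_domain ε y₀) (contDiffOn_field hε0 hε k α y₀)
    (hm.uc_v.continuousOn.prodMk hm.continuousOn_z) (x₀ := (M₀, s₀))
    (isCompact_confinement C _ m _ y₀) hKO
    (fun T hT x hx0 hx => by
      have hsol := isLandmarkSolution_of_field hx (by rw [hx0]; exact hM₀)
      have hBx : lyap α (act (x 0).1 (z 0)) y₀ (x 0).2 (r 0) = B := by rw [hx0]
      exact hsol.mem_confinement hm hk hα hε0 hlo hy Icc_subset_Ici_self (convex_Icc 0 T)
        (left_mem_Icc.2 hT) hBx (right_mem_Icc.2 hT)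
        (hms T _ _ hT hsol (by rw [hx0]) hBx.le T (right_mem_Icc.2 hT)))
    ⟨hs₀, hne⟩
  refine ⟨fun t => (x t).1, fun t => (x t).2, by simp [hx0], by simp [hx0], ?_⟩
  refine ⟨fun t ht => ?_, fun t ht => (hx t ht).1.1, fun t ht => (hx t ht).1.2,
    fun t ht => (hx t ht).2.fst, fun t ht => (hx t ht).2.snd⟩
  exact (isLandmarkSolution_of_field (T := t)
    (fun τ hτ => ⟨(hx τ hτ.1).1, (hx τ hτ.1).2.mono Icc_subset_Ici_self⟩)
    (by rw [hx0]; exact hM₀)).so t (right_mem_Icc.2 ht)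

/-- Uniqueness for one landmark. -/
theorem IsLandmarkSolution.eqOn {T : ℝ} {M' : ℝ → Mat3} {s' : ℝ → ℝ} (hε0 : 0 < ε) (hε : ε < rlo)
    (hm : IsMotion rlo rhi C v z r) (h : IsLandmarkSolution ε rlo k α y₀ v z (Icc 0 T) M s)
    (h' : IsLandmarkSolution ε rlo k α y₀ v z (Icc 0 T) M' s') (hM : M 0 = M' 0) (hs : s 0 = s' 0)
    {t : ℝ} (ht : t ∈ Icc 0 T) : M t = M' t ∧ s t = s' t := by
  have := eqOn_of_hasDerivWithinAt_of_contDiffOn (u := fun t => (v t, z t))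
    (x := fun t => (M t, s t)) (y := fun t => (M' t, s' t))
    (isOpen_domain ε y₀) (contDiffOn_field hε0 hε k α y₀)
    ((hm.uc_v.continuousOn.prodMk hm.continuousOn_z).mono Icc_subset_Ici_self)
    (fun t ht => ⟨⟨h.gt t ht, h.ne t ht⟩, (h.dM t ht).prodMk (h.ds t ht)⟩)
    (fun t ht => ⟨⟨h'.gt t ht, h'.ne t ht⟩, (h'.dM t ht).prodMk (h'.ds t ht)⟩)
    (by simp [hM, hs]) ht
  exact Prod.ext_iff.1 this

end

section

attribute [local instance] Matrix.normedAddCommGroup Matrix.normedSpace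

variable {ε rlo rhi C k α : ℝ} {y₀ : E3} {v z : ℝ → E3} {r : ℝ → ℝ} {J : Set ℝ} {M : ℝ → Mat3}
  {s : ℝ → ℝ}

/-! ### Convergence for one landmark -/

/-- Along two asymptotic signals in a compact set, a continuous function takes asymptotic values. -/
theorem _root_.IsCompact.tendsto_sub_of_tendsto_dist {β γ ι : Type*} [PseudoMetricSpace β]
    [SeminormedAddCommGroup γ] {K : Set β} (hK : IsCompact K) {h : β → γ} (hh : ContinuousOn h K)
    {l : Filter ι} {Ψ Φ : ι → β} (hΨ : ∀ᶠ t in l, Ψ t ∈ K) (hΦ : ∀ᶠ t in l, Φ t ∈ K)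
    (hd : Tendsto (fun t => dist (Ψ t) (Φ t)) l (𝓝 0)) :
    Tendsto (fun t => h (Ψ t) - h (Φ t)) l (𝓝 0) := by
  rw [Metric.tendsto_nhds]
  intro η hη
  obtain ⟨d, hd0, hdK⟩ := Metric.uniformContinuousOn_iff.1
    (hK.uniformContinuousOn_of_continuous hh) η hη
  filter_upwards [hΨ, hΦ, hd.eventually_lt_const hd0] with t h1 h2 h3
  rw [dist_zero_right, ← dist_eq_norm]
  exact hdK _ h1 _ h2 h3

theorem uniformContinuousOn_prodMk {α β γ : Type*} [UniformSpace α] [UniformSpace β]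
    [UniformSpace γ] {f : α → β} {g : α → γ} {S : Set α} (hf : UniformContinuousOn f S)
    (hg : UniformContinuousOn g S) : UniformContinuousOn (fun x => (f x, g x)) S :=
  uniformContinuousOn_iff_restrict.2
    ((uniformContinuousOn_iff_restrict.1 hf).prodMk (uniformContinuousOn_iff_restrict.1 hg))

/-- The compact set of values of the signals `(δ, w, r, s)`. -/
def signalSet (C c₀ rlo rhi m m' : ℝ) (y₀ : E3) : Set (E3 × E3 × ℝ × ℝ) :=
  (Metric.sphere 0 1 ×ˢ Metric.closedBall 0 C ×ˢ Icc rlo rhi ×ˢ Icc m m') ∩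
    {x | c₀ ≤ 1 + inner ℝ x.1 y₀}

theorem isCompact_signalSet (C c₀ rlo rhi m m' : ℝ) (y₀ : E3) :
    IsCompact (signalSet C c₀ rlo rhi m m' y₀) := by
  refine IsCompact.inter_right ?_ (isClosed_le (f := fun _ => c₀) continuous_const
    (continuous_const.add (continuous_fst.inner continuous_const)))
  exact (isCompact_sphere _ _).prod ((isCompact_closedBall _ _).prod (isCompact_Icc.prod isCompact_Icc))

section
variable {c₀ m m' : ℝ}

theorem continuousOn_spin_signal (k : ℝ) (hm : 0 < m) (hc₀ : 0 < c₀) :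
    ContinuousOn (fun x : E3 × E3 × ℝ × ℝ => spin k x.1 y₀ x.2.1 x.2.2.2)
      (signalSet C c₀ rlo rhi m m' y₀) :=
  (contDiffOn_spin k contDiff_fst.contDiffOn (contDiff_fst.comp contDiff_snd).contDiffOn
    (contDiff_snd.comp (contDiff_snd.comp contDiff_snd)).contDiffOn
    (fun _ hx => (hm.trans_le hx.1.2.2.2.1).ne') (fun _ hx => (hc₀.trans_le hx.2).ne')).continuousOn

theorem continuousOn_bearingRate (k : ℝ) (hlo : 0 < rlo) (hm : 0 < m) (hc₀ : 0 < c₀) :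
    ContinuousOn (fun x : E3 × E3 × ℝ × ℝ => bearingRate k x.1 y₀ x.2.1 x.2.2.2 x.2.2.1)
      (signalSet C c₀ rlo rhi m m' y₀) := by
  have h1 : ContinuousOn (fun x : E3 × E3 × ℝ × ℝ => cross (spin k x.1 y₀ x.2.1 x.2.2.2) x.1)
      (signalSet C c₀ rlo rhi m m' y₀) :=
    continuous_cross.comp_continuousOn
      (f := fun x : E3 × E3 × ℝ × ℝ => (spin k x.1 y₀ x.2.1 x.2.2.2, x.1))
      ((continuousOn_spin_signal k hm hc₀).prodMk continuousOn_fst)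
  have h2 : ContinuousOn (fun x : E3 × E3 × ℝ × ℝ => 1 / x.2.2.1)
      (signalSet C c₀ rlo rhi m m' y₀) :=
    continuousOn_const.div (by fun_prop) fun x hx => (hlo.trans_le hx.1.2.2.1.1).ne'
  have h3 : ContinuousOn (fun x : E3 × E3 × ℝ × ℝ => x.2.1 - inner ℝ x.1 x.2.1 • x.1)
      (signalSet C c₀ rlo rhi m m' y₀) := by fun_prop
  unfold bearingRate
  exact h1.sub (h2.smul h3)

theorem continuousOn_rangeRate (α : ℝ) (hε : ε < rlo) (hm : 0 < m) (hεm : ε < m) (hc₀ : 0 < c₀) :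
    ContinuousOn (fun x : E3 × E3 × ℝ × ℝ => rangeRate ε rlo α x.1 y₀ x.2.1 x.2.2.2)
      (signalSet C c₀ rlo rhi m m' y₀) :=
  (contDiffOn_rangeRate hε α contDiff_fst.contDiffOn (contDiff_fst.comp contDiff_snd).contDiffOn
    (contDiff_snd.comp (contDiff_snd.comp contDiff_snd)).contDiffOn
    (fun _ hx => (hm.trans_le hx.1.2.2.2.1).ne') (fun _ hx => hεm.trans_le hx.1.2.2.2.1)
    (fun _ hx => (hc₀.trans_le hx.2).ne')).continuousOn

theorem continuousOn_lyapRate (k : ℝ) (hε : ε < rlo) (hεm : ε < m) (hc₀ : 0 < c₀) :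
    ContinuousOn (fun x : E3 × E3 × ℝ × ℝ => lyapRate ε rlo k x.1 y₀ x.2.2.2 x.2.2.1)
      (signalSet C c₀ rlo rhi m m' y₀) := by
  have hb : ContinuousOn (fun x : E3 × E3 × ℝ × ℝ => barrier ε rlo x.2.2.2)
      (signalSet C c₀ rlo rhi m m' y₀) :=
    (contDiffOn_barrier hε).continuousOn.comp (by fun_prop) fun x hx => hεm.trans_le hx.1.2.2.2.1
  have hl : ContinuousOn (fun x : E3 × E3 × ℝ × ℝ => (1 - inner ℝ x.1 y₀) / (1 + inner ℝ x.1 y₀))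
      (signalSet C c₀ rlo rhi m m' y₀) :=
    ContinuousOn.div (by fun_prop) (by fun_prop) fun x hx => (hc₀.trans_le hx.2).ne'
  exact ((continuousOn_const.mul (ContinuousOn.mul (by fun_prop) hl)).neg).add
    (ContinuousOn.mul (by fun_prop) hb)

end

/-- The bound c₀ ≤ 2 is recorded because 1 + ⟨y₀, y₀⟩ = 2: replacing δ by its limit y₀ then stays
within the same compact set. -/
theorem IsLandmarkSolution.exists_mem_signalSet
    (h : IsLandmarkSolution ε rlo k α y₀ v z (Ici 0) M s) (hm : IsMotion rlo rhi C v z r)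
    (hε0 : 0 < ε) (hε : ε < rlo) (hk : 0 < k) (hα : 0 < α) (hy : ‖y₀‖ = 1) :
    ∃ c₀ m m', 0 < c₀ ∧ c₀ ≤ 2 ∧ ε < m ∧ ∀ t ∈ Ici (0 : ℝ),
      (act (M t) (z t), act (M t) (v t), r t, s t) ∈ signalSet C c₀ rlo rhi m m' y₀ := by
  have hlo : 0 < rlo := hε0.trans hε
  have h00 : (0 : ℝ) ∈ Ici (0 : ℝ) := mem_Ici.2 le_rfl
  set B := lyap α (act (M 0) (z 0)) y₀ (s 0) (r 0) with hB
  have hb := fun t ht => bounds_of_lyap_le (h.norm_bearing hm subset_rfl ht) hy hα hlo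
    (hm.lo t ht) (hm.hi t ht) (h.ne t ht)
    (h.lyap_le hm hk hα hε0 hlo hy subset_rfl (convex_Ici 0) h00 ht)
  have hB0 : 0 ≤ B := (hb 0 h00).2.2.2.2
  obtain ⟨m, hεm, hms⟩ := exists_lt_range hε0 hε hk hα hy (h.gt 0 h00) B hm
  refine ⟨2 / (1 + B / rlo), m, rhi + √(α * B), by positivity, ?_, hεm, fun t ht => ?_⟩
  · exact div_le_self zero_le_two (le_add_of_nonneg_right (by positivity))
  · refine ⟨⟨?_, ?_, ⟨hm.lo t ht, hm.hi t ht⟩, ?_, (hb t ht).2.2.2.1⟩, (hb t ht).2.1⟩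
    · simpa using h.norm_bearing hm subset_rfl ht
    · simpa using h.norm_velocity hm subset_rfl ht
    · exact hms t M s ht (h.mono Icc_subset_Ici_self) rfl le_rfl t (right_mem_Icc.2 ht)

/-- The signals of one landmark are uniformly continuous. -/
theorem IsLandmarkSolution.uniformContinuousOn_signal {c₀ m m' : ℝ}
    (h : IsLandmarkSolution ε rlo k α y₀ v z (Ici 0) M s) (hm : IsMotion rlo rhi C v z r)
    (hε0 : 0 < ε) (hε : ε < rlo) (hc₀ : 0 < c₀) (hεm : ε < m)
    (hmem : ∀ t ∈ Ici (0 : ℝ),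
      (act (M t) (z t), act (M t) (v t), r t, s t) ∈ signalSet C c₀ rlo rhi m m' y₀) :
    UniformContinuousOn (fun t => (act (M t) (z t), act (M t) (v t), r t, s t)) (Ici 0) := by
  have hlo : 0 < rlo := hε0.trans hε
  have hm0 : 0 < m := hε0.trans hεm
  have hK := isCompact_signalSet C c₀ rlo rhi m m' y₀
  have cb := continuousOn_bearingRate (C := C) (rhi := rhi) (m' := m') (y₀ := y₀) k hlo hm0 hc₀
  have ucδ : UniformContinuousOn (fun t => act (M t) (z t)) (Ici 0) := by
    obtain ⟨N, hN⟩ := hK.exists_bound_of_continuousOn cb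
    exact uniformContinuousOn_of_norm_hasDerivWithinAt_le
      (fun t ht => h.hasDerivWithinAt_bearing hm subset_rfl ht)
      fun t ht => hN (act (M t) (z t), act (M t) (v t), r t, s t) (hmem t ht)
  have ucs : UniformContinuousOn s (Ici 0) := by
    obtain ⟨N, hN⟩ := hK.exists_bound_of_continuousOn
      (continuousOn_rangeRate (C := C) (rhi := rhi) (m' := m') (y₀ := y₀) α hε hm0 hεm hc₀)
    exact uniformContinuousOn_of_norm_hasDerivWithinAt_le h.ds
      fun t ht => hN (act (M t) (z t), act (M t) (v t), r t, s t) (hmem t ht)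
  have ucr : UniformContinuousOn r (Ici 0) := by
    refine uniformContinuousOn_of_norm_hasDerivWithinAt_le (C := C) hm.dr fun t ht => ?_
    rw [norm_neg]
    refine (norm_inner_le_norm _ _).trans ?_
    rw [hm.norm_z t ht, one_mul]
    exact hm.norm_v t ht
  -- The velocity v need not be differentiable, so w = M v cannot be treated through a derivative
  -- bound. Instead M is shown to be Lipschitz and is combined with the uniform continuity of v.
  have ucM : UniformContinuousOn M (Ici 0) := by
    have hcs : ContinuousOn
        (fun x : (E3 × E3 × ℝ × ℝ) × Mat3 => skew (spin k x.1.1 y₀ x.1.2.1 x.1.2.2.2) * x.2)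
        (signalSet C c₀ rlo rhi m m' y₀ ×ˢ Metric.closedBall (0 : Mat3) 1) :=
      contDiff_skew_mul.continuous.comp_continuousOn
        (f := fun x : (E3 × E3 × ℝ × ℝ) × Mat3 => (spin k x.1.1 y₀ x.1.2.1 x.1.2.2.2, x.2))
        (((continuousOn_spin_signal k hm0 hc₀).comp continuousOn_fst
          fun x hx => hx.1).prodMk continuousOn_snd)
    obtain ⟨N, hN⟩ := (hK.prod (isCompact_closedBall (0 : Mat3) 1)).exists_bound_of_continuousOn hcs
    refine uniformContinuousOn_of_norm_hasDerivWithinAt_le h.dM fun t ht =>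
      hN ((act (M t) (z t), act (M t) (v t), r t, s t), M t) ⟨hmem t ht, ?_⟩
    simpa using norm_SO3_le ⟨M t, h.so t ht⟩
  have ucw : UniformContinuousOn (fun t => act (M t) (v t)) (Ici 0) :=
    (uniformContinuousOn_prodMk ucM hm.uc_v).continuousOn_comp_of_isCompact (h := fun p : Mat3 × E3 => act p.1 p.2)
      ((isCompact_closedBall (0 : Mat3) 1).prod (isCompact_closedBall (0 : E3) C))
      (fun t ht => ⟨by simpa using norm_SO3_le ⟨M t, h.so t ht⟩, by simpa using hm.norm_v t ht⟩)
      continuous_act.continuousOn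
  exact uniformContinuousOn_prodMk ucδ
    (uniformContinuousOn_prodMk ucw (uniformContinuousOn_prodMk ucr ucs))

/-- Under persistent excitation the error of one landmark converges to the equilibrium. -/
theorem IsLandmarkSolution.tendsto
    (h : IsLandmarkSolution ε rlo k α y₀ v z (Ici 0) M s) (hm : IsMotion rlo rhi C v z r)
    (hε0 : 0 < ε) (hε : ε < rlo) (hk : 0 < k) (hα : 0 < α) (hy : ‖y₀‖ = 1)
    (hpe : ∃ T μ : ℝ, 0 < T ∧ 0 < μ ∧ ∀ t, 0 < t →
      μ ≤ 1 / T * ∫ τ in t..(t + T), ‖v τ - inner ℝ (z τ) (v τ) • z τ‖) :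
    Tendsto (fun t => act (M t) (z t)) atTop (𝓝 y₀) ∧ Tendsto (fun t => s t / r t) atTop (𝓝 1) := by
  have hlo : 0 < rlo := hε0.trans hε
  have hr0 : ∀ t ∈ Ici (0 : ℝ), 0 < r t := fun t ht => hlo.trans_le (hm.lo t ht)
  have hpos : ∀ᶠ t : ℝ in atTop, t ∈ Ici (0 : ℝ) := eventually_ge_atTop 0
  obtain ⟨c₀, m, m', hc₀, hc₂, hεm, hmem⟩ := h.exists_mem_signalSet hm hε0 hε hk hα hy
  have hm0 : 0 < m := hε0.trans hεm
  have hK := isCompact_signalSet C c₀ rlo rhi m m' y₀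
  set K := signalSet C c₀ rlo rhi m m' y₀ with hKdef
  set δ : ℝ → E3 := fun t => act (M t) (z t) with hδdef
  set w : ℝ → E3 := fun t => act (M t) (v t) with hwdef
  set Ψ : ℝ → E3 × E3 × ℝ × ℝ := fun t => (δ t, w t, r t, s t) with hΨdef
  have hδ1 : ∀ t ∈ Ici (0 : ℝ), ‖δ t‖ = 1 := fun t ht => h.norm_bearing hm subset_rfl ht
  have dδ := fun t (ht : t ∈ Ici (0 : ℝ)) => h.hasDerivWithinAt_bearing hm subset_rfl ht
  have dW := fun t (ht : t ∈ Ici (0 : ℝ)) =>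
    h.hasDerivWithinAt_lyap hm hα hε0 hlo hy subset_rfl ht
  have cb := continuousOn_bearingRate (C := C) (rhi := rhi) (m' := m') (y₀ := y₀) k hlo hm0 hc₀
  have cl := continuousOn_lyapRate (C := C) (rhi := rhi) (m' := m') (y₀ := y₀) k hε hεm hc₀
  have ucΨ : UniformContinuousOn Ψ (Ici 0) :=
    h.uniformContinuousOn_signal hm hε0 hε hc₀ hεm hmem
  -- the Lyapunov function converges
  set W : ℝ → ℝ := fun t => lyap α (δ t) y₀ (s t) (r t) with hWdef
  have hl0 : ∀ t ∈ Ici (0 : ℝ), 0 ≤ (1 - inner ℝ (δ t) y₀) / (1 + inner ℝ (δ t) y₀) :=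
    fun t ht => h.quotient_nonneg hm hy subset_rfl ht
  have hWanti : AntitoneOn W (Ici 0) := h.antitoneOn_lyap hm hk hα hε0 hlo hy subset_rfl (convex_Ici 0)
  have hW0 : ∀ t ∈ Ici (0 : ℝ), 0 ≤ W t := fun t ht =>
    add_nonneg (mul_nonneg (hr0 t ht).le (hl0 t ht)) (by positivity)
  obtain ⟨Winf, hWinf⟩ : ∃ Winf, Tendsto W atTop (𝓝 Winf) := by
    -- Freezing W at its initial value for negative times gives an antitone function on the whole
    -- line, to which monotone convergence applies.
    have hanti : Antitone fun t => W (max t 0) := fun a b hab =>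
      hWanti (mem_Ici.2 (le_max_right _ _)) (mem_Ici.2 (le_max_right _ _)) (max_le_max_right 0 hab)
    have hbdd : BddBelow (Set.range fun t => W (max t 0)) :=
      ⟨0, by rintro _ ⟨t, rfl⟩; exact hW0 _ (mem_Ici.2 (le_max_right _ _))⟩
    refine ⟨_, (tendsto_atTop_ciInf hanti hbdd).congr' ?_⟩
    filter_upwards [hpos] with t ht
    rw [max_eq_left ht]
  -- the bearing error converges
  have hlim_l : Tendsto (fun t => (1 - inner ℝ (δ t) y₀) / (1 + inner ℝ (δ t) y₀)) atTop (𝓝 0) := by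
    have hrate := tendsto_zero_of_hasDerivWithinAt_of_uniformContinuousOn dW
      (ucΨ.continuousOn_comp_of_isCompact hK hmem cl) hWinf
    have hup : Tendsto (fun t => -lyapRate ε rlo k (δ t) y₀ (s t) (r t) / (2 * k * rlo)) atTop (𝓝 0) := by
      simpa using hrate.neg.div_const (2 * k * rlo)
    refine squeeze_zero' (hpos.mono hl0) (hpos.mono fun t ht => ?_) hup
    rw [le_div_iff₀ (by positivity)]
    linarith [h.lyapRate_le hm hk hy subset_rfl ht]
  have hlim_δ : Tendsto δ atTop (𝓝 y₀) := by
    rw [tendsto_iff_norm_sub_tendsto_zero]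
    have hsq : Tendsto (fun t => ‖δ t - y₀‖ ^ 2) atTop (𝓝 0) := by
      -- ‖δ - y₀‖² = 2 (1 - c) = 2 l (1 + c) ≤ 4 l, as 1 + c ≤ 2.
      refine squeeze_zero' (Eventually.of_forall fun t => sq_nonneg _) (hpos.mono fun t ht => ?_)
        (by simpa using hlim_l.const_mul 4)
      have hp := h.one_add_pos hm hy subset_rfl ht
      have hle := inner_le_one (hδ1 t ht) hy
      rw [norm_sub_sq_unit (hδ1 t ht) hy, ← mul_div_assoc, le_div_iff₀ hp]
      nlinarith
    have := hsq.sqrt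
    simpa [Real.sqrt_sq (norm_nonneg _)] using this
  -- the projected velocity weighted by the range error vanishes asymptotically
  set Φ : ℝ → E3 × E3 × ℝ × ℝ := fun t => (y₀, w t, r t, s t) with hΦdef
  have hΦmem : ∀ t ∈ Ici (0 : ℝ), Φ t ∈ K := fun t ht => by
    refine ⟨⟨by simpa using hy, (hmem t ht).1.2⟩, ?_⟩
    simp only [hΦdef, mem_ofPred_eq, real_inner_self_eq_norm_sq, hy]
    linarith
  have hdist : Tendsto (fun t => dist (Ψ t) (Φ t)) atTop (𝓝 0) := by
    have : (fun t => dist (Ψ t) (Φ t)) = fun t => dist (δ t) y₀ := by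
      funext t
      simp [hΨdef, hΦdef, Prod.dist_eq]
    rw [this]
    exact tendsto_iff_dist_tendsto_zero.1 hlim_δ
  have hzero : Tendsto (fun t => (1 / s t - 1 / r t) • (w t - inner ℝ y₀ (w t) • y₀)) atTop (𝓝 0) := by
    have h1 := tendsto_zero_of_hasDerivWithinAt_of_uniformContinuousOn dδ
      (ucΨ.continuousOn_comp_of_isCompact hK hmem cb) hlim_δ
    have h2 := hK.tendsto_sub_of_tendsto_dist cb (hpos.mono hmem) (hpos.mono hΦmem) hdist
    have h3 := h1.sub h2
    rw [sub_zero] at h3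
    refine h3.congr fun t => ?_
    simp only [hΦdef, sub_sub_cancel]
    -- At δ = y₀ the bearing rate reduces to (1/s - 1/r) times the projection of w, and it has the
    -- same limit as δ'.
    rw [bearingRate, cross_spin hy, real_inner_self_eq_norm_sq, hy]
    simp [sub_smul]
  -- (s - r)² = α (W - r l), and r l → 0 because r is bounded.
  have he2 : Tendsto (fun t => (s t - r t) ^ 2) atTop (𝓝 (α * Winf)) := by
    have h1 : Tendsto (fun t => r t * ((1 - inner ℝ (δ t) y₀) / (1 + inner ℝ (δ t) y₀))) atTop (𝓝 0) := by
      refine squeeze_zero' (hpos.mono fun t ht => mul_nonneg (hr0 t ht).le (hl0 t ht))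
        (hpos.mono fun t ht => mul_le_mul_of_nonneg_right (hm.hi t ht) (hl0 t ht))
        (by simpa using hlim_l.const_mul rhi)
    have h2 := (hWinf.sub h1).const_mul α
    rw [sub_zero] at h2
    refine h2.congr fun t => ?_
    simp only [hWdef, lyap]
    field_simp
    ring
  -- excitation forces the range error to vanish
  have hWinf0 : Winf = 0 := by
    have hge : 0 ≤ Winf := ge_of_tendsto hWinf (hpos.mono hW0)
    by_contra hne
    have hWp : 0 < α * Winf := mul_pos hα (lt_of_le_of_ne hge (Ne.symm hne))
    have hm'0 : 0 < m' := hm0.trans_le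
      ((hmem 0 (mem_Ici.2 le_rfl)).1.2.2.2.1.trans (hmem 0 (mem_Ici.2 le_rfl)).1.2.2.2.2)
    have hrhi : 0 < rhi := (hr0 0 (mem_Ici.2 le_rfl)).trans_le (hm.hi 0 (mem_Ici.2 le_rfl))
    -- Half the limit of (s - r)² is eventually exceeded, so |r - s| ≥ q and |1/s - 1/r| = |r -
    -- s|/(r s) ≥ q/(rhi m').
    set q := √(α * Winf / 2) with hq
    have hq0 : 0 < q := Real.sqrt_pos.2 (by linarith)
    have hfac : ∀ᶠ t in atTop, q / (rhi * m') ≤ |1 / s t - 1 / r t| := by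
      filter_upwards [hpos, he2.eventually_const_lt (show α * Winf / 2 < α * Winf by linarith)]
        with t ht hlt
      have hs0 : 0 < s t := hε0.trans (h.gt t ht)
      have hqe : q ≤ |r t - s t| := by
        rw [abs_sub_comm]
        exact Real.sqrt_le_iff.2 ⟨abs_nonneg _, by rw [sq_abs]; exact hlt.le⟩
      have : 1 / s t - 1 / r t = (r t - s t) / (r t * s t) := by
        have := hr0 t ht
        field_simp
      rw [this, abs_div, abs_of_pos (mul_pos (hr0 t ht) hs0)]
      have hs' : s t ≤ m' := (hmem t ht).1.2.2.2.2
      have hr' := hm.hi t ht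
      have hrt := hr0 t ht
      gcongr
    have hproj₀ : Tendsto (fun t => w t - inner ℝ y₀ (w t) • y₀) atTop (𝓝 0) := by
      rw [tendsto_zero_iff_norm_tendsto_zero] at hzero ⊢
      refine squeeze_zero' (Eventually.of_forall fun t => norm_nonneg _) (hfac.mono fun t ht => ?_)
        (by simpa using hzero.const_mul (rhi * m' / q))
      rw [norm_smul, Real.norm_eq_abs, ← mul_assoc]
      refine le_mul_of_one_le_left (norm_nonneg _) ?_
      calc (1 : ℝ) = rhi * m' / q * (q / (rhi * m')) := by field_simp
        _ ≤ _ := by gcongr; simpa using ht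
    have hproj : Tendsto (fun t => w t - inner ℝ (δ t) (w t) • δ t) atTop (𝓝 0) := by
      have h2 := hK.tendsto_sub_of_tendsto_dist
        (h := fun x : E3 × E3 × ℝ × ℝ => x.2.1 - inner ℝ x.1 x.2.1 • x.1)
        (by fun_prop) (hpos.mono hmem) (hpos.mono hΦmem) hdist
      have h3 := h2.add hproj₀
      simpa [hΨdef, hΦdef] using h3
    obtain ⟨T, μ, hT, hμ, hpe⟩ := hpe
    rw [tendsto_zero_iff_norm_tendsto_zero] at hproj
    obtain ⟨t₀, ht₀⟩ := eventually_atTop.1 (hproj.eventually_lt_const (half_pos hμ))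
    -- Excitation is available only for t > 0, hence the maximum with 1. On [t, t + T] the mean of
    -- the projected speed is then at most μ/2, a contradiction.
    set t := max t₀ 1 with htdef
    have ht1 : 0 < t := zero_lt_one.trans_le (le_max_right _ _)
    have hint := intervalIntegral.norm_integral_le_of_norm_le_const (a := t) (b := t + T) (C := μ / 2)
      (f := fun τ => ‖v τ - inner ℝ (z τ) (v τ) • z τ‖) (fun τ hτ => by
        rw [uIoc_of_le (by linarith)] at hτ
        have hτ0 : τ ∈ Ici (0 : ℝ) := (ht1.trans hτ.1).le
        have := ht₀ τ ((le_max_left _ _).trans hτ.1.le)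
        have e : ‖w τ - inner ℝ (δ τ) (w τ) • δ τ‖ = ‖v τ - inner ℝ (z τ) (v τ) • z τ‖ := by
          simp only [hwdef, hδdef]
          rw [h.inner_eq hτ0, ← act_smul, ← act_sub]
          exact norm_act ⟨M τ, h.so τ hτ0⟩ _
        rw [norm_norm, ← e]
        exact this.le)
    rw [add_sub_cancel_left, abs_of_pos hT] at hint
    have h1 := (hpe t ht1).trans (mul_le_mul_of_nonneg_left ((le_abs_self _).trans hint) (by positivity))
    rw [show 1 / T * (μ / 2 * T) = μ / 2 by field_simp] at h1
    linarith
  refine ⟨hlim_δ, ?_⟩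
  rw [hWinf0, mul_zero] at he2
  have he : Tendsto (fun t => |s t - r t|) atTop (𝓝 0) := by
    simpa [Real.sqrt_sq_eq_abs] using he2.sqrt
  rw [tendsto_iff_dist_tendsto_zero]
  refine squeeze_zero' (Eventually.of_forall fun t => dist_nonneg) (hpos.mono fun t ht => ?_)
    (by simpa using he.div_const rlo)
  rw [Real.dist_eq, div_sub_one (hr0 t ht).ne', abs_div, abs_of_pos (hr0 t ht)]
  have := hm.lo t ht
  gcongr

end

section

attribute [local instance] Matrix.normedAddCommGroup Matrix.normedSpace

/-! ### Lyapunov stability for one landmark -/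

section
variable {ε rlo rhi C k α : ℝ} {y₀ : E3} {v z : ℝ → E3} {r : ℝ → ℝ}

/-- Errors below κ give a Lyapunov value of at most A κ², which persists by monotonicity and in turn
bounds both squared errors by G κ². The choice κ (G + 1) ≤ η makes this less than η². -/
theorem exists_stable (hε0 : 0 < ε) (hε : ε < rlo) (hk : 0 < k) (hα : 0 < α) (hy : ‖y₀‖ = 1)
    (hm : IsMotion rlo rhi C v z r) {η : ℝ} (hη : 0 < η) :
    ∃ κ > 0, ∀ (J : Set ℝ) M s, J ⊆ Ici 0 → Convex ℝ J → 0 ∈ J →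
      IsLandmarkSolution ε rlo k α y₀ v z J M s → ‖act (M 0) (z 0) - y₀‖ < κ →
      |s 0 / r 0 - 1| < κ → ∀ t ∈ J, ‖act (M t) (z t) - y₀‖ < η ∧ |s t / r t - 1| < η := by
  have hlo : 0 < rlo := hε0.trans hε
  have h00 : (0 : ℝ) ∈ Ici (0 : ℝ) := mem_Ici.2 le_rfl
  have hrhi : 0 < rhi := hlo.trans_le ((hm.lo 0 h00).trans (hm.hi 0 h00))
  -- A collects r l ≤ rhi κ²/2 and (s - r)²/α ≤ rhi² κ²/α. In G below, 4 A/rlo comes from ‖δ - y₀‖²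
  -- ≤ 4 l, and α A/rlo² from dividing (s - r)² ≤ α A κ² by r².
  set A := rhi / 2 + rhi ^ 2 / α
  have hA : 0 < A := by positivity
  set G := 4 * A / rlo + α * A / rlo ^ 2
  have hG : 0 < G := by positivity
  refine ⟨min 1 (η / (G + 1)), by positivity, fun J M s hJ hJc h0 h hδ0 hs0 t ht => ?_⟩
  set κ := min 1 (η / (G + 1)) with hκ
  have hκ0 : 0 < κ := by positivity
  have hκ1 : κ ≤ 1 := min_le_left _ _
  have hκ2 : κ * (G + 1) ≤ η := by
    have := min_le_right 1 (η / (G + 1))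
    rwa [← hκ, le_div_iff₀ (by positivity)] at this
  have hκG : G * κ ^ 2 < η ^ 2 := by
    calc G * κ ^ 2 < (κ * (G + 1)) ^ 2 := by nlinarith [pow_pos hκ0 2]
      _ ≤ η ^ 2 := by gcongr
  -- the Lyapunov function at time zero
  have hδ := h.norm_bearing hm hJ h0
  have hsq : 2 * (1 - inner ℝ (act (M 0) (z 0)) y₀) ≤ κ ^ 2 := by
    rw [← norm_sub_sq_unit hδ hy]
    gcongr
  have hr0 : 0 < r 0 := hlo.trans_le (hm.lo 0 h00)
  have hW0 : lyap α (act (M 0) (z 0)) y₀ (s 0) (r 0) ≤ A * κ ^ 2 := by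
    -- κ ≤ 1 is used here: it forces c ≥ 1/2, so the denominator of l is at least 1.
    have hc1 : 1 ≤ 1 + inner ℝ (act (M 0) (z 0)) y₀ := by nlinarith
    have h1 : (1 - inner ℝ (act (M 0) (z 0)) y₀) / (1 + inner ℝ (act (M 0) (z 0)) y₀) ≤ κ ^ 2 / 2 := by
      refine (div_le_self (sub_nonneg.2 (inner_le_one hδ hy)) hc1).trans ?_
      linarith
    have h2 : (s 0 - r 0) ^ 2 ≤ rhi ^ 2 * κ ^ 2 := by
      have e : s 0 - r 0 = r 0 * (s 0 / r 0 - 1) := by field_simp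
      rw [e, mul_pow, ← sq_abs (s 0 / r 0 - 1)]
      have := hm.hi 0 h00
      gcongr
    have h3 := h.quotient_nonneg hm hy hJ h0
    calc lyap α (act (M 0) (z 0)) y₀ (s 0) (r 0) ≤ rhi * (κ ^ 2 / 2) + rhi ^ 2 * κ ^ 2 / α := by
          rw [lyap]
          have := hm.hi 0 h00
          gcongr
      _ = A * κ ^ 2 := by simp only [A]; ring
  have hb := bounds_of_lyap_le (h.norm_bearing hm hJ ht) hy hα hlo (hm.lo t (hJ ht))
    (hm.hi t (hJ ht)) (h.ne t ht) ((h.lyap_le hm hk hα hε0 hlo hy hJ hJc h0 ht).trans hW0)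
  have hrt : rlo ≤ r t := hm.lo t (hJ ht)
  constructor
  · refine lt_of_pow_lt_pow_left₀ 2 hη.le (lt_of_le_of_lt ?_ hκG)
    rw [norm_sub_sq_unit (h.norm_bearing hm hJ ht) hy]
    have hp := h.one_add_pos hm hy hJ ht
    have h1 := hb.1
    rw [div_le_iff₀ hp] at h1
    have h2 : 1 + inner ℝ (act (M t) (z t)) y₀ ≤ 2 := by
      linarith [inner_le_one (h.norm_bearing hm hJ ht) hy]
    have h3 : A * κ ^ 2 / rlo * (1 + inner ℝ (act (M t) (z t)) y₀) ≤ A * κ ^ 2 / rlo * 2 := by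
      gcongr
    have h4 : 4 * A / rlo * κ ^ 2 ≤ G * κ ^ 2 := by
      gcongr
      exact le_add_of_nonneg_right (by positivity)
    have h5 : A * κ ^ 2 / rlo * 2 * 2 = 4 * A / rlo * κ ^ 2 := by ring
    linarith
  · refine lt_of_pow_lt_pow_left₀ 2 hη.le (lt_of_le_of_lt ?_ hκG)
    have hrt0 : 0 < r t := hlo.trans_le hrt
    rw [sq_abs, div_sub_one hrt0.ne', div_pow]
    calc (s t - r t) ^ 2 / r t ^ 2 ≤ α * (A * κ ^ 2) / rlo ^ 2 := by
          have := hb.2.2.1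
          gcongr
      _ = α * A / rlo ^ 2 * κ ^ 2 := by ring
      _ ≤ G * κ ^ 2 := by
          gcongr
          exact le_add_of_nonneg_left (by positivity)

end

/-! ### From the observer to landmark dynamics -/

variable {n : ℕ}

theorem norm_ego (ξ : TotalSpace n) (i : Fin n) : ‖ego ξ i‖ = range ξ i := norm_act_transpose _ _

theorem coe_output (ξ : TotalSpace n) (i : Fin n) :
    (output ξ i : E3) = (range ξ i)⁻¹ • ego ξ i := rfl

theorem norm_output (ξ : TotalSpace n) (i : Fin n) : ‖(output ξ i : E3)‖ = 1 :=
  mem_sphere_zero_iff_norm.1 (output ξ i).2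

theorem ego_eq (ξ : TotalSpace n) (i : Fin n) : ego ξ i = range ξ i • (output ξ i : E3) := by
  rw [coe_output, smul_inv_smul₀ (range_pos ξ i).ne']

/-- The pose part of X drops out of the ego-centric coordinates. This is why the pose innovation
cannot influence the landmark errors. -/
theorem ego_upsilon (X : Grp n) (ξ : TotalSpace n) (i : Fin n) :
    ego (upsilon X ξ) i = ((X.2 i).2 : ℝ)⁻¹ • act ((X.2 i).1 : Mat3).transpose (ego ξ i) := by
  have : ego (upsilon X ξ) i = act ((ξ.P * X.1).R : Mat3).transpose
      (((X.2 i).2 : ℝ)⁻¹ •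
        act ((ξ.P * X.1).R : Mat3) (act ((X.2 i).1 : Mat3).transpose (ego ξ i))
        + (ξ.P * X.1).x - (ξ.P * X.1).x) := rfl
  rw [this, add_sub_cancel_right, act_smul, act_transpose_act]

theorem range_upsilon (X : Grp n) (ξ : TotalSpace n) (i : Fin n) :
    range (upsilon X ξ) i = ((X.2 i).2 : ℝ)⁻¹ * range ξ i := by
  rw [← norm_ego, ego_upsilon, norm_smul, norm_act_transpose, norm_ego, norm_inv,
    Real.norm_of_nonneg (X.2 i).2.2.le]

theorem ego_upsilon_eq (X : Grp n) (ξ : TotalSpace n) (i : Fin n) :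
    ego (upsilon X ξ) i =
      range (upsilon X ξ) i • act ((X.2 i).1 : Mat3).transpose (output ξ i) := by
  rw [ego_upsilon, range_upsilon, ego_eq, act_smul, smul_smul]

theorem rho_inv (X : Grp n) (y : Fin n → S2) (i : Fin n) :
    (rho X⁻¹ y i : E3) = act ((X.2 i).1 : Mat3) (y i) := by
  change act (((X.2 i).1⁻¹ : SO3) : Mat3).transpose (y i) = _
  rw [coe_inv_SO3, Matrix.transpose_transpose]

/-- The rate of the landmark rotation of the observer. -/
theorem rotation_rate (ξ₀ : TotalSpace n) (rlo k₀ : ℝ) (k α : Fin n → ℝ) (Δ : PoseInnovation n)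
    (y : Fin n → S2) (U : Twist) (X : Grp n) (i : Fin n) :
    ((X.2 i).1 : Mat3) * ((lift (upsilon X ξ₀) U).2 i).1
        - ((innovation ξ₀ rlo k₀ k α Δ y U X).2 i).1 * ((X.2 i).1 : Mat3)
      = skew (spin (k i) (act (X.2 i).1 (y i)) (output ξ₀ i) (act (X.2 i).1 U.V)
          (range (upsilon X ξ₀) i)) * ((X.2 i).1 : Mat3)
        + ((X.2 i).1 : Mat3) * skew U.Ω := by
  have hs := (range_pos (upsilon X ξ₀) i).ne'
  have h1 : ((innovation ξ₀ rlo k₀ k α Δ y U X).2 i).1 =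
      skew (bearingGain (k i) (act (X.2 i).1 (y i)) (output ξ₀ i) (act (X.2 i).1 U.V)
        (range (upsilon X ξ₀) i) • cross (act (X.2 i).1 (y i)) (output ξ₀ i)) := by
    rw [skew_smul, ← rho_inv]
    rfl
  have h2 : act ((X.2 i).1 : Mat3) ((‖ego (upsilon X ξ₀) i‖ ^ 2)⁻¹ • cross (ego (upsilon X ξ₀) i) U.V)
      = (1 / range (upsilon X ξ₀) i) • cross (output ξ₀ i) (act (X.2 i).1 U.V) := by
    rw [norm_ego, ego_upsilon_eq, smul_cross, smul_smul, act_smul, act_cross, act_act_transpose]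
    congr 1
    field_simp
  have h3 : ((lift (upsilon X ξ₀) U).2 i).1 = skew (U.Ω +
      (‖ego (upsilon X ξ₀) i‖ ^ 2)⁻¹ • cross (ego (upsilon X ξ₀) i) U.V) := rfl
  -- Conjugation by Q̂ moves the velocity term to the origin frame; the term with Ω stays to the
  -- right of Q̂, where it will cancel against the derivative of R_Pᵀ.
  rw [h1, h3, skew_add, mul_add, mul_skew _ ((‖ego (upsilon X ξ₀) i‖ ^ 2)⁻¹ • _), h2, spin, skew_sub,
    sub_mul]
  abel

/-- The rate of the landmark scale of the observer. -/
theorem scale_rate (ξ₀ : TotalSpace n) (rlo k₀ : ℝ) (k α : Fin n → ℝ) (Δ : PoseInnovation n)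
    (y : Fin n → S2) (U : Twist) (X : Grp n) (i : Fin n) :
    ((X.2 i).2 : ℝ) * ((lift (upsilon X ξ₀) U).2 i).2
        - ((innovation ξ₀ rlo k₀ k α Δ y U X).2 i).2 * ((X.2 i).2 : ℝ)
      = -(((X.2 i).2 : ℝ) / range (upsilon X ξ₀) i * rangeRate (eps k₀ rlo) rlo (α i)
          (act (X.2 i).1 (y i)) (output ξ₀ i) (act (X.2 i).1 U.V) (range (upsilon X ξ₀) i)) := by
  have hs := (range_pos (upsilon X ξ₀) i).ne'
  have h1 : ((innovation ξ₀ rlo k₀ k α Δ y U X).2 i).2 =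
      rangeInnovation (α i) (act (X.2 i).1 (y i)) (output ξ₀ i) (act (X.2 i).1 U.V)
        (range (upsilon X ξ₀) i) (barrier (eps k₀ rlo) rlo (range (upsilon X ξ₀) i)) := by
    rw [← rho_inv]
    rfl
  have h2 : ((lift (upsilon X ξ₀) U).2 i).2 =
      inner ℝ (output ξ₀ i : E3) (act (X.2 i).1 U.V) / range (upsilon X ξ₀) i := by
    change inner ℝ (ego (upsilon X ξ₀) i) U.V / ‖ego (upsilon X ξ₀) i‖ ^ 2 = _
    rw [norm_ego, ego_upsilon_eq, inner_smul_left, inner_act_left, Matrix.transpose_transpose,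
      conj_trivial]
    field_simp
  rw [h1, h2, rangeRate]
  field_simp
  ring

/-! ### The trajectory -/

theorem toMatrix_mul_twist (P : SE3) (U : Twist) : P.toMatrix * U.toMatrix =
    Matrix.fromBlocks ((P.R : Mat3) * skew U.Ω) (Matrix.of fun i _ => act P.R U.V i) 0 0 := by
  simp only [SE3.toMatrix, Twist.toMatrix, Matrix.fromBlocks_multiply]
  congr 1
  · simp
  · ext i j
    simp [act, Matrix.mul_apply, Matrix.mulVec, dotProduct]
  · simp
  · simp

theorem hasDerivWithinAt_rotation {P : ℝ → SE3} {U : Twist} {J : Set ℝ} {t : ℝ}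
    (h : HasDerivWithinAt (fun s => (P s).toMatrix) ((P t).toMatrix * U.toMatrix) J t) :
    HasDerivWithinAt (fun s => ((P s).R : Mat3)) ((P t).R * skew U.Ω) J t := by
  rw [toMatrix_mul_twist, hasDerivWithinAt_matrix] at h
  exact hasDerivWithinAt_matrix.2 fun i j => h (Sum.inl i) (Sum.inl j)

theorem hasDerivWithinAt_translation {P : ℝ → SE3} {U : Twist} {J : Set ℝ} {t : ℝ}
    (h : HasDerivWithinAt (fun s => (P s).toMatrix) ((P t).toMatrix * U.toMatrix) J t) :
    HasDerivWithinAt (fun s => (P s).x) (act (P t).R U.V) J t := by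
  rw [toMatrix_mul_twist, hasDerivWithinAt_matrix] at h
  exact hasDerivWithinAt_E3.2 fun i => h (Sum.inl i) (Sum.inr ())

/-- Robot velocity in the world frame. -/
def worldVelocity (U : ℝ → Twist) (ξ : ℝ → TotalSpace n) (t : ℝ) : E3 := act (ξ t).P.R (U t).V

/-- Landmark bearing in the world frame. -/
def worldBearing (ξ : ℝ → TotalSpace n) (i : Fin n) (t : ℝ) : E3 := act (ξ t).P.R (output (ξ t) i)

theorem worldBearing_eq (ξ : ℝ → TotalSpace n) (i : Fin n) (t : ℝ) :
    worldBearing ξ i t = (range (ξ t) i)⁻¹ • ((ξ t).p i - (ξ t).P.x) := by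
  rw [worldBearing, coe_output, act_smul, ego, act_act_transpose]

variable {U : ℝ → Twist} {ξ : ℝ → TotalSpace n} {rlo rhi C : ℝ}

/-- Bounded angular velocity makes the attitude Lipschitz, and its product with a bounded uniformly
continuous velocity is uniformly continuous. -/
theorem uniformContinuousOn_worldVelocity (hξ : IsSystemTrajectory U ξ)
    (hV : UniformContinuousOn (fun t => (U t).V) (Ici 0))
    (hC : ∀ t, 0 ≤ t → ‖(U t).Ω‖ ≤ C ∧ ‖(U t).V‖ ≤ C) :
    UniformContinuousOn (worldVelocity U ξ) (Ici 0) := by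
  have hR : ∀ t, (((ξ t).P.R : Mat3)) ∈ Metric.closedBall (0 : Mat3) 1 := fun t => by
    simpa using norm_SO3_le (ξ t).P.R
  have hcont : Continuous fun p : Mat3 × E3 => p.1 * skew p.2 :=
    continuous_fst.matrix_mul (contDiff_skew.continuous.comp continuous_snd)
  obtain ⟨N, hN⟩ := ((isCompact_closedBall (0 : Mat3) 1).prod
    (isCompact_closedBall (0 : E3) C)).exists_bound_of_continuousOn hcont.continuousOn
  have ucR : UniformContinuousOn (fun t => ((ξ t).P.R : Mat3)) (Ici 0) :=
    uniformContinuousOn_of_norm_hasDerivWithinAt_le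
      (fun t ht => hasDerivWithinAt_rotation (hξ t ht).1)
      fun t ht => hN (((ξ t).P.R : Mat3), (U t).Ω) ⟨hR t, by simpa using (hC t ht).1⟩
  exact (uniformContinuousOn_prodMk ucR hV).continuousOn_comp_of_isCompact
    (h := fun p : Mat3 × E3 => act p.1 p.2)
    ((isCompact_closedBall (0 : Mat3) 1).prod (isCompact_closedBall (0 : E3) C))
    (fun t ht => ⟨hR t, by simpa using (hC t ht).2⟩) continuous_act.continuousOn

/-- Landmarks are static, so d = p - x has derivative -v. The formulas for r = ‖d‖ and z = d/r
follow, with no trace of the angular velocity. -/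
theorem isMotion (hξ : IsSystemTrajectory U ξ)
    (hV : UniformContinuousOn (fun t => (U t).V) (Ici 0))
    (hC : ∀ t, 0 ≤ t → ‖(U t).Ω‖ ≤ C ∧ ‖(U t).V‖ ≤ C)
    (hr : ∀ t, 0 ≤ t → ∀ i, rlo ≤ range (ξ t) i ∧ range (ξ t) i ≤ rhi) (i : Fin n) :
    IsMotion rlo rhi C (worldVelocity U ξ) (worldBearing ξ i) (fun t => range (ξ t) i) := by
  have dd : ∀ t ∈ Ici (0 : ℝ), HasDerivWithinAt (fun τ => (ξ τ).p i - (ξ τ).P.x)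
      (-worldVelocity U ξ t) (Ici 0) t := fun t ht =>
    (((hξ t ht).2 i).sub (hasDerivWithinAt_translation (hξ t ht).1)).congr_deriv (by
      rw [zero_sub]; rfl)
  have dr : ∀ t ∈ Ici (0 : ℝ), HasDerivWithinAt (fun τ => range (ξ τ) i)
      (-inner ℝ (worldBearing ξ i t) (worldVelocity U ξ t)) (Ici 0) t := fun t ht => by
    have hpos := range_pos (ξ t) i
    have h1 := (dd t ht).norm_sq.sqrt (pow_ne_zero 2 hpos.ne')
    simp only [Real.sqrt_sq (norm_nonneg _)] at h1
    refine h1.congr_deriv ?_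
    rw [worldBearing_eq, inner_smul_left, inner_neg_right, conj_trivial]
    change _ / (2 * range (ξ t) i) = _
    field_simp
  refine ⟨uniformContinuousOn_worldVelocity hξ hV hC, fun t ht => ?_, fun t ht => ?_,
    fun t ht => (hr t ht i).1, fun t ht => (hr t ht i).2, fun t ht => ?_, dr⟩
  · exact (norm_act _ _).trans_le (hC t ht).2
  · exact (norm_act _ _).trans (norm_output _ _)
  · have hpos := range_pos (ξ t) i
    have h1 := ((dr t ht).inv hpos.ne').smul (dd t ht)
    refine (h1.congr (fun τ _ => worldBearing_eq ξ i τ) (worldBearing_eq ξ i t)).congr_deriv ?_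
    simp only [Pi.inv_apply, neg_neg]
    generalize inner ℝ (worldBearing ξ i t) (worldVelocity U ξ t) = b
    rw [worldBearing_eq]
    generalize (ξ t).p i - (ξ t).P.x = d
    module

end

section

attribute [local instance] Matrix.normedAddCommGroup Matrix.normedSpace

variable {n : ℕ} {U : ℝ → Twist} {ξ : ℝ → TotalSpace n} {ξ₀ : TotalSpace n} {rlo rhi C k₀ : ℝ}
  {k α : Fin n → ℝ}

theorem eps_pos (hk₀ : 0 < k₀) (hlo : 0 < rlo) : 0 < eps k₀ rlo :=
  mul_pos (lt_min hk₀ one_half_pos) hlo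

theorem eps_lt (hlo : 0 < rlo) : eps k₀ rlo < rlo := by
  have : min k₀ (1 / 2) ≤ 1 / 2 := min_le_right _ _
  rw [eps]
  nlinarith

theorem act_mul_worldVelocity (Q : SO3) (U : ℝ → Twist) (ξ : ℝ → TotalSpace n) (t : ℝ) :
    act ((Q : Mat3) * ((ξ t).P.R : Mat3).transpose) (worldVelocity U ξ t) = act Q (U t).V := by
  rw [act_mul, worldVelocity, act_transpose_act]

theorem act_mul_worldBearing (Q : SO3) (ξ : ℝ → TotalSpace n) (i : Fin n) (t : ℝ) :
    act ((Q : Mat3) * ((ξ t).P.R : Mat3).transpose) (worldBearing ξ i t) =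
      act Q (output (ξ t) i) := by
  rw [act_mul, worldBearing, act_transpose_act]

theorem notMem_exceptionSet_iff (ξ₀ ξ : TotalSpace n) (X : Grp n) :
    err ξ₀ ξ X ∉ exceptionSet ξ₀ ↔
      ∀ i, 1 + inner ℝ (act (X.2 i).1 (output ξ i)) (output ξ₀ i : E3) ≠ 0 := by
  have h : ∀ i, ((err ξ₀ ξ X i).1 : E3) = act (X.2 i).1 (output ξ i) := fun i => rho_inv X _ i
  simp only [exceptionSet, mem_ofPred_eq, not_exists, h]
  exact forall_congr' fun i => (one_add_inner_ne_zero_iff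
    ((norm_act _ _).trans (norm_output ξ i)) (norm_output ξ₀ i)).symm

/-- The landmark components of an observer solve the landmark dynamics. -/
theorem IsObserverOn.isLandmarkSolution {Δ : PoseInnovation n} {J : Set ℝ} {X : ℝ → Grp n}
    (hX : IsObserverOn ξ₀ rlo k₀ k α Δ ξ U J X) (hξ : IsSystemTrajectory U ξ) (hJ : J ⊆ Ici 0)
    (i : Fin n) :
    IsLandmarkSolution (eps k₀ rlo) rlo (k i) (α i) (output ξ₀ i) (worldVelocity U ξ)
      (worldBearing ξ i) J (fun t => (((X t).2 i).1 : Mat3) * ((ξ t).P.R : Mat3).transpose)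
      (fun t => range (upsilon (X t) ξ₀) i) := by
  refine ⟨fun t _ => (((X t).2 i).1 * (ξ t).P.R⁻¹).2, fun t ht => (hX t ht).1 i, fun t ht => ?_,
    fun t ht => ?_, fun t ht => ?_⟩
  · rw [act_mul_worldBearing]
    exact (notMem_exceptionSet_iff _ _ _).1 (hX t ht).2.1 i
  · have hR := ((hasDerivWithinAt_rotation (hξ t (hJ ht)).1).mono hJ).matrix_transpose
    have hQ := ((hX t ht).2.2.2 i).1
    rw [rotation_rate] at hQ
    refine (hQ.matrix_mul hR).congr_deriv ?_
    rw [act_mul_worldBearing, act_mul_worldVelocity, Matrix.transpose_mul, skew_transpose]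
    simp only [Matrix.add_mul, Matrix.mul_neg, Matrix.neg_mul, Matrix.mul_assoc]
    abel
  · have ha := ((hX t ht).2.2.2 i).2
    rw [scale_rate] at ha
    have ha0 : (((X t).2 i).2 : ℝ) ≠ 0 := ((X t).2 i).2.2.ne'
    have hr0 := (range_pos ξ₀ i).ne'
    rw [act_mul_worldBearing, act_mul_worldVelocity]
    refine (((ha.inv ha0).mul_const (range ξ₀ i)).congr
      (fun τ _ => range_upsilon (X τ) ξ₀ i) (range_upsilon (X t) ξ₀ i)).congr_deriv ?_
    generalize rangeRate _ _ _ _ _ _ _ = ρ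
    rw [range_upsilon]
    field_simp

open Classical in
/-- The rotation with a given matrix. -/
def toSO3 (M : Mat3) : SO3 := if h : M ∈ SO3 then ⟨M, h⟩ else 1

theorem coe_toSO3 {M : Mat3} (h : M ∈ SO3) : (toSO3 M : Mat3) = M := by
  rw [toSO3, dif_pos h]

open Classical in
/-- The positive real number with a given value. -/
def toMR (a : ℝ) : MR := if h : 0 < a then ⟨a, h⟩ else ⟨1, one_pos⟩

theorem coe_toMR {a : ℝ} (h : 0 < a) : (toMR a : ℝ) = a := by
  rw [toMR, dif_pos h]

/-- Landmark solutions assemble to an observer with trivial pose innovation. -/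
theorem exists_isObserverOn (hξ : IsSystemTrajectory U ξ) (hε0 : 0 < eps k₀ rlo) (X₀ : Grp n)
    {M : Fin n → ℝ → Mat3} {s : Fin n → ℝ → ℝ}
    (hsol : ∀ i, IsLandmarkSolution (eps k₀ rlo) rlo (k i) (α i) (output ξ₀ i) (worldVelocity U ξ)
      (worldBearing ξ i) (Ici 0) (M i) (s i))
    (hM0 : ∀ i, M i 0 = ((X₀.2 i).1 : Mat3) * ((ξ 0).P.R : Mat3).transpose)
    (hs0 : ∀ i, s i 0 = range (upsilon X₀ ξ₀) i) :
    ∃ Z : ℝ → Grp n, Z 0 = X₀ ∧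
      IsObserverOn ξ₀ rlo k₀ k α (fun _ _ _ => 0) ξ U (Ici 0) Z := by
  -- A left translate of the true pose solves the pose equation without innovation; the landmark
  -- parts invert M = Q̂ R_Pᵀ and s = r₀/a, with r₀ the range at the origin configuration. The
  -- default values of `toSO3` and `toMR` can occur only at negative times.
  set Z : ℝ → Grp n := fun t => (X₀.1 * (ξ 0).P⁻¹ * (ξ t).P,
    fun i => (toSO3 (M i t) * (ξ t).P.R, toMR (range ξ₀ i / s i t))) with hZ
  have hs : ∀ i, ∀ t ∈ Ici (0 : ℝ), 0 < s i t := fun i t ht => hε0.trans ((hsol i).gt t ht)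
  have hQ : ∀ i, ∀ t ∈ Ici (0 : ℝ), (((Z t).2 i).1 : Mat3) = M i t * ((ξ t).P.R : Mat3) :=
    fun i t ht => by
      change (toSO3 (M i t) : Mat3) * ((ξ t).P.R : Mat3) = _
      rw [coe_toSO3 ((hsol i).so t ht)]
  have ha : ∀ i, ∀ t ∈ Ici (0 : ℝ), (((Z t).2 i).2 : ℝ) = range ξ₀ i / s i t :=
    fun i t ht => coe_toMR (div_pos (range_pos ξ₀ i) (hs i t ht))
  have hr : ∀ i, ∀ t ∈ Ici (0 : ℝ), range (upsilon (Z t) ξ₀) i = s i t := fun i t ht => by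
    have h1 := (range_pos ξ₀ i).ne'
    have h2 := (hs i t ht).ne'
    rw [range_upsilon, ha i t ht]
    field_simp
  have hδ : ∀ i, ∀ t ∈ Ici (0 : ℝ), act ((Z t).2 i).1 (output (ξ t) i) =
      act (M i t) (worldBearing ξ i t) := fun i t ht => by rw [hQ i t ht, act_mul]; rfl
  have hw : ∀ i, ∀ t ∈ Ici (0 : ℝ), act ((Z t).2 i).1 (U t).V =
      act (M i t) (worldVelocity U ξ t) := fun i t ht => by rw [hQ i t ht, act_mul]; rfl
  have h00 : (0 : ℝ) ∈ Ici (0 : ℝ) := mem_Ici.2 le_rfl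
  refine ⟨Z, ?_, fun t ht => ⟨fun i => ?_, ?_, ?_, fun i => ⟨?_, ?_⟩⟩⟩
  · refine Prod.ext (by simp [hZ]) (funext fun i => Prod.ext (Subtype.ext ?_) (Subtype.ext ?_))
    · rw [hQ i 0 h00, hM0, Matrix.mul_assoc, transpose_mul_SO3, Matrix.mul_one]
    · have h1 := (range_pos ξ₀ i).ne'
      have h2 : ((X₀.2 i).2 : ℝ) ≠ 0 := (X₀.2 i).2.2.ne'
      rw [ha i 0 h00, hs0, range_upsilon]
      field_simp
  · rw [hr i t ht]
    exact (hsol i).gt t ht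
  · refine (notMem_exceptionSet_iff _ _ _).2 fun i => ?_
    rw [hδ i t ht]
    exact (hsol i).ne t ht
  · have h1 := (hasDerivWithinAt_const t (Ici 0) (X₀.1 * (ξ 0).P⁻¹).toMatrix).matrix_mul (hξ t ht).1
    have h2 : (fun τ => (Z τ).1.toMatrix) =
        fun τ => (X₀.1 * (ξ 0).P⁻¹).toMatrix * (ξ τ).P.toMatrix :=
      funext fun τ => SE3.toMatrix_mul _ _
    have h3 : (Z t).1.toMatrix = (X₀.1 * (ξ 0).P⁻¹).toMatrix * (ξ t).P.toMatrix :=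
      SE3.toMatrix_mul _ _
    have h4 : (0 : Twist).toMatrix = 0 := by
      ext i j
      rcases i with i | i <;> rcases j with j | j
      · change skew 0 i j = 0
        fin_cases i <;> fin_cases j <;> simp [skew]
      all_goals rfl
    rw [h2, h3]
    refine h1.congr_deriv ?_
    change _ = _ * (U t).toMatrix - (0 : Twist).toMatrix * _
    rw [h4, Matrix.zero_mul, Matrix.zero_mul, zero_add, sub_zero, Matrix.mul_assoc]
  · rw [rotation_rate, hδ i t ht, hw i t ht, hr i t ht, hQ i t ht]
    refine ((((hsol i).dM t ht).matrix_mul (hasDerivWithinAt_rotation (hξ t ht).1)).congr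
      (fun τ hτ => hQ i τ hτ) (hQ i t ht)).congr_deriv ?_
    simp only [Matrix.mul_assoc]
  · rw [scale_rate, hδ i t ht, hw i t ht, hr i t ht, ha i t ht]
    have h2 := (hs i t ht).ne'
    refine (((hasDerivWithinAt_const t (Ici 0) (range ξ₀ i)).div ((hsol i).ds t ht) h2).congr
      (fun τ hτ => ha i τ hτ) (ha i t ht)).congr_deriv ?_
    field_simp
    ring

/-! ### Convergence of the state estimate -/

/-- The configuration with pose `P` and the same ego-centric landmark coordinates as `ξ'`. -/
def alignTo (P : SE3) (ξ' : TotalSpace n) : TotalSpace n where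
  P := P
  p i := act P.R (ego ξ' i) + P.x
  ne i := by
    intro h
    have h1 := add_eq_right.1 h
    have h2 := norm_act P.R (ego ξ' i)
    rw [h1, norm_zero, norm_ego] at h2
    exact (range_pos ξ' i).ne h2

theorem slamEquiv_alignTo (P : SE3) (ξ' : TotalSpace n) : SlamEquiv (alignTo P ξ') ξ' := by
  refine ⟨ξ'.P * P⁻¹, by simp [alignTo], fun i => ?_⟩
  change act P.R (act (ξ'.P.R : Mat3).transpose (ξ'.p i - ξ'.P.x)) + P.x = _
  have hR : (((ξ'.P * P⁻¹).R : SO3) : Mat3).transpose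
      = (P.R : Mat3) * (ξ'.P.R : Mat3).transpose := by
    change ((ξ'.P.R : Mat3) * (P.R : Mat3).transpose).transpose = _
    rw [Matrix.transpose_mul, Matrix.transpose_transpose]
  have hx : (ξ'.P * P⁻¹).x = act ξ'.P.R (-act (P.R : Mat3).transpose P.x) + ξ'.P.x := rfl
  rw [hR, hx, act_mul]
  simp only [act_sub, act_add, act_neg, act_transpose_act, act_act_transpose]
  abel

/-- The aligned copy has the true pose exactly. Rotated to the origin frame, the landmark
discrepancy is r (r̃ y₀ - δ), which tends to zero because r is bounded above. -/
theorem convergesUpToEquiv_of_tendsto_err {X : ℝ → Grp n}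
    (hr : ∀ t, 0 ≤ t → ∀ i, range (ξ t) i ≤ rhi)
    (h : Tendsto (fun t => err ξ₀ (ξ t) (X t)) atTop (𝓝 (equilibrium ξ₀))) :
    ConvergesUpToEquiv (fun t => upsilon (X t) ξ₀) ξ := by
  refine ⟨fun t => alignTo (ξ t).P (upsilon (X t) ξ₀), fun t _ => slamEquiv_alignTo _ _, ?_,
    fun i => ?_⟩
  · simp [alignTo]
  have hi := (tendsto_pi_nhds.1 h) i
  have hδ : Tendsto (fun t => act ((X t).2 i).1 (output (ξ t) i)) atTop (𝓝 (output ξ₀ i : E3)) := by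
    have := (continuous_subtype_val.tendsto _).comp (hi.fst_nhds)
    refine this.congr fun t => ?_
    exact rho_inv (X t) _ i
  have hs : Tendsto (fun t => range (upsilon (X t) ξ₀) i / range (ξ t) i) atTop (𝓝 1) :=
    (continuous_subtype_val.tendsto _).comp (hi.snd_nhds)
  have hlim : Tendsto (fun t => rhi * ‖(range (upsilon (X t) ξ₀) i / range (ξ t) i) •
      (output ξ₀ i : E3) - act ((X t).2 i).1 (output (ξ t) i)‖) atTop (𝓝 0) := by
    have := ((hs.smul_const (output ξ₀ i : E3)).sub hδ).norm.const_mul rhi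
    simpa using this
  rw [tendsto_zero_iff_norm_tendsto_zero]
  refine squeeze_zero' (Eventually.of_forall fun t => norm_nonneg _)
    ((eventually_ge_atTop 0).mono fun t ht => ?_) hlim
  have hpos := range_pos (ξ t) i
  have e1 : (alignTo (ξ t).P (upsilon (X t) ξ₀)).p i - (ξ t).p i =
      act (ξ t).P.R (ego (upsilon (X t) ξ₀) i - ego (ξ t) i) := by
    rw [act_sub]
    change act (ξ t).P.R (ego (upsilon (X t) ξ₀) i) + (ξ t).P.x - (ξ t).p i =
      _ - act (ξ t).P.R (act ((ξ t).P.R : Mat3).transpose ((ξ t).p i - (ξ t).P.x))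
    rw [act_act_transpose]
    abel
  have e2 : act ((X t).2 i).1 (ego (upsilon (X t) ξ₀) i - ego (ξ t) i) =
      range (ξ t) i • ((range (upsilon (X t) ξ₀) i / range (ξ t) i) • (output ξ₀ i : E3)
        - act ((X t).2 i).1 (output (ξ t) i)) := by
    rw [act_sub, ego_upsilon_eq, ego_eq (ξ t), act_smul, act_smul, act_act_transpose, smul_sub,
      smul_smul, mul_div_cancel₀ _ hpos.ne']
  rw [e1, norm_act, ← norm_act ((X t).2 i).1, e2, norm_smul, Real.norm_of_nonneg hpos.le]
  gcongr
  exact hr t ht i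

/-! ### The lifted system -/

theorem hasDerivWithinAt_ego (hξ : IsSystemTrajectory U ξ) (i : Fin n) {t : ℝ} (ht : t ∈ Ici (0 : ℝ)) :
    HasDerivWithinAt (fun τ => ego (ξ τ) i) (-cross (U t).Ω (ego (ξ t) i) - (U t).V) (Ici 0) t := by
  have hR := (hasDerivWithinAt_rotation (hξ t ht).1).matrix_transpose
  have hx := ((hξ t ht).2 i).sub (hasDerivWithinAt_translation (hξ t ht).1)
  refine (hR.act hx).congr_deriv ?_
  rw [Matrix.transpose_mul, skew_transpose, act_mul, zero_sub, act_neg, act_transpose_act,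
    ← sub_eq_add_neg]
  congr 1
  rw [← neg_one_smul ℝ (skew _), smul_act, neg_one_smul]
  rfl

/-- The defining property of the lift: its rotation part reproduces the component of V transverse to
q, its scale part the radial one, and together they give q' = -Ω × q - V as for the true system. -/
theorem hasDerivWithinAt_ego_upsilon {X : ℝ → Grp n} (hX : IsLiftedTrajectory ξ₀ U X) (i : Fin n)
    {t : ℝ} (ht : t ∈ Ici (0 : ℝ)) :
    HasDerivWithinAt (fun τ => ego (upsilon (X τ) ξ₀) i)
      (-cross (U t).Ω (ego (upsilon (X t) ξ₀) i) - (U t).V) (Ici 0) t := by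
  obtain ⟨-, h⟩ := hX t ht
  obtain ⟨hQ, ha⟩ := h i
  have ha0 : (((X t).2 i).2 : ℝ) ≠ 0 := ((X t).2 i).2.2.ne'
  set q := ego (upsilon (X t) ξ₀) i with hq
  have hq0 : ‖q‖ ^ 2 ≠ 0 := by rw [norm_ego]; exact pow_ne_zero 2 (range_pos _ _).ne'
  have hQ' : HasDerivWithinAt (fun τ => (((X τ).2 i).1 : Mat3))
      ((((X t).2 i).1 : Mat3) * skew ((U t).Ω + (‖q‖ ^ 2)⁻¹ • cross q (U t).V)) (Ici 0) t :=
    hQ.congr_deriv (by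
      change _ - (0 : Mat3) * _ = _
      rw [Matrix.zero_mul, sub_zero]; rfl)
  have ha' : HasDerivWithinAt (fun τ => (((X τ).2 i).2 : ℝ))
      (((X t).2 i).2 * (inner ℝ q (U t).V / ‖q‖ ^ 2)) (Ici 0) t :=
    ha.congr_deriv (by
      change _ - (0 : ℝ) * _ = _
      rw [zero_mul, sub_zero]; rfl)
  have h1 := hQ'.matrix_transpose.act (hasDerivWithinAt_const t (Ici 0) (ego ξ₀ i))
  have h2 := ((ha'.inv ha0).smul h1).congr (fun τ _ => ego_upsilon (X τ) ξ₀ i)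
    (ego_upsilon (X t) ξ₀ i)
  refine h2.congr_deriv ?_
  have e1 : act (((X t).2 i).1 : Mat3).transpose (ego ξ₀ i) = (((X t).2 i).2 : ℝ) • q := by
    rw [hq, ego_upsilon, smul_inv_smul₀ ha0]
  have e2 : act ((((X t).2 i).1 : Mat3) *
      skew ((U t).Ω + (‖q‖ ^ 2)⁻¹ • cross q (U t).V)).transpose (ego ξ₀ i) =
      -((((X t).2 i).2 : ℝ) • cross ((U t).Ω + (‖q‖ ^ 2)⁻¹ • cross q (U t).V) q) := by
    rw [Matrix.transpose_mul, skew_transpose, act_mul, e1, ← neg_one_smul ℝ (skew _), smul_act,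
      neg_one_smul, act_smul]
    rfl
  have e3 : act (((X t).2 i).1 : Mat3).transpose (0 : E3) = 0 := by simp [act]
  rw [e1, e2, e3, add_zero, add_cross, smul_cross, cross_cross_left, real_inner_self_eq_norm_sq,
    real_inner_comm q (U t).V]
  simp only [Pi.inv_apply]
  generalize (((X t).2 i).2 : ℝ) = a at *
  generalize ‖q‖ ^ 2 = N at *
  generalize inner ℝ q (U t).V = b at *
  generalize cross (U t).Ω q = c at *
  generalize (U t).V = V at *
  match_scalars <;> field_simp
  ring

/-- The difference e of the two coordinates satisfies e' = -Ω × e, which is orthogonal to e. So ‖e‖²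
is constant, and it starts at zero. -/
theorem ego_upsilon_eq_ego {X : ℝ → Grp n} (hξ : IsSystemTrajectory U ξ)
    (hX : IsLiftedTrajectory ξ₀ U X) (h0 : upsilon (X 0) ξ₀ = ξ 0) {t : ℝ} (ht : 0 ≤ t) (i : Fin n) :
    ego (upsilon (X t) ξ₀) i = ego (ξ t) i := by
  have hd : ∀ τ ∈ Ici (0 : ℝ),
      HasDerivWithinAt (fun τ => ‖ego (upsilon (X τ) ξ₀) i - ego (ξ τ) i‖ ^ 2) 0 (Ici 0) τ :=
    fun τ hτ => (((hasDerivWithinAt_ego_upsilon hX i hτ).sub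
      (hasDerivWithinAt_ego hξ i hτ)).norm_sq).congr_deriv (by
        change 2 * inner ℝ (ego (upsilon (X τ) ξ₀) i - ego (ξ τ) i) _ = 0
        rw [sub_sub_sub_cancel_right, neg_sub_neg, ← cross_sub, ← neg_sub (ego (ξ τ) i),
          inner_neg_left, inner_cross_self, neg_zero, mul_zero])
  have := (convex_Ici (0 : ℝ)).norm_image_sub_le_of_norm_hasDerivWithin_le (C := 0) hd (by simp)
    (mem_Ici.2 le_rfl) (mem_Ici.2 ht)
  rw [zero_mul, norm_le_zero_iff, h0, sub_self, norm_zero] at this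
  simpa [sub_eq_zero] using this

theorem rho_inv_output_eq {X : ℝ → Grp n} (hξ : IsSystemTrajectory U ξ)
    (hX : IsLiftedTrajectory ξ₀ U X) (h0 : upsilon (X 0) ξ₀ = ξ 0) {t : ℝ} (ht : 0 ≤ t)
    (Y : Grp n) : rho Y⁻¹ (output (ξ t)) = rho (X t * Y⁻¹) (output ξ₀) := by
  funext i
  have he := ego_upsilon_eq_ego hξ hX h0 ht i
  have hy : (output (ξ t) i : E3) = act (((X t).2 i).1 : Mat3).transpose (output ξ₀ i) := by
    rw [coe_output, ← norm_ego, ← he, norm_ego, ego_upsilon_eq,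
      inv_smul_smul₀ (range_pos _ _).ne']
  refine Subtype.ext ?_
  change act (((Y⁻¹).2 i).1 : Mat3).transpose (output (ξ t) i) =
    act ((((X t).2 i).1 : Mat3) * (((Y⁻¹).2 i).1 : Mat3)).transpose (output ξ₀ i)
  rw [hy, Matrix.transpose_mul, act_mul]

end

/-! ### Stability and basin of attraction for all landmarks together -/

section

variable {n : ℕ} {U : ℝ → Twist} {ξ : ℝ → TotalSpace n} {ξ₀ : TotalSpace n} {rlo rhi C k₀ : ℝ}
  {k α : Fin n → ℝ}

theorem exists_pos_forall_le {ι : Type*} [Finite ι] {m : ι → ℝ} (hm : ∀ i, 0 < m i) :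
    ∃ κ > 0, ∀ i, κ < m i := by
  have h : ∀ᶠ κ : ℝ in 𝓝[>] 0, ∀ i, κ < m i :=
    eventually_all.2 fun i => mem_nhdsWithin_of_mem_nhds (Iio_mem_nhds (hm i))
  obtain ⟨κ, h1, h2⟩ := (h.and self_mem_nhdsWithin).exists
  exact ⟨κ, h2, h1⟩

theorem dist_err_lt_iff (ξ₀ ξ : TotalSpace n) (X : Grp n) {η : ℝ} (hη : 0 < η) :
    dist (err ξ₀ ξ X) (equilibrium ξ₀) < η ↔
      ∀ i, ‖act (X.2 i).1 (output ξ i) - output ξ₀ i‖ < η ∧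
        |range (upsilon X ξ₀) i / range ξ i - 1| < η := by
  rw [dist_pi_lt_iff hη]
  refine forall_congr' fun i => ?_
  rw [Prod.dist_eq, max_lt_iff, Subtype.dist_eq, Subtype.dist_eq, dist_eq_norm, Real.dist_eq,
    ← rho_inv]
  rfl

theorem isStable (hlo : 0 < rlo) (hk : ∀ i, 0 < k i) (hα : ∀ i, 0 < α i) (hk₀ : 0 < k₀)
    (hξ : IsSystemTrajectory U ξ)
    (hm : ∀ i, IsMotion rlo rhi C (worldVelocity U ξ) (worldBearing ξ i) fun t => range (ξ t) i) :
    IsStable ξ₀ rlo k₀ k α ξ U := by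
  intro η hη
  choose κ hκ0 hκ using fun i => exists_stable (eps_pos hk₀ hlo) (eps_lt (k₀ := k₀) hlo) (hk i)
    (hα i) (norm_output ξ₀ i) (hm i) hη
  obtain ⟨κ₀, hκ₀, hκle⟩ := exists_pos_forall_le hκ0
  refine ⟨κ₀, hκ₀, fun Δ τ X hX hd t ht => ?_⟩
  have hJ : Ico 0 τ ⊆ Ici (0 : ℝ) := Ico_subset_Icc_self.trans Icc_subset_Ici_self
  have h0 : (0 : ℝ) ∈ Ico 0 τ := ⟨le_rfl, ht.1.trans_lt ht.2⟩
  rw [dist_err_lt_iff _ _ _ hκ₀] at hd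
  rw [dist_err_lt_iff _ _ _ hη]
  intro i
  have := hκ i (Ico 0 τ) _ _ hJ (convex_Ico 0 τ) h0 (hX.isLandmarkSolution hξ hJ i)
    (by rw [act_mul_worldBearing]; exact (hd i).1.trans (hκle i)) ((hd i).2.trans (hκle i)) t ht
  rwa [act_mul_worldBearing] at this

/-- Errors off the exception set with range ratios above the relative threshold belong to the
basin of attraction. -/
theorem mem_basin (hlo : 0 < rlo) (hk : ∀ i, 0 < k i) (hα : ∀ i, 0 < α i) (hk₀ : 0 < k₀)
    (hξ : IsSystemTrajectory U ξ)
    (hm : ∀ i, IsMotion rlo rhi C (worldVelocity U ξ) (worldBearing ξ i) fun t => range (ξ t) i)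
    (hpe : ∀ i, ∃ T μ : ℝ, 0 < T ∧ 0 < μ ∧ ∀ t, 0 < t →
      μ ≤ 1 / T * ∫ τ in t..(t + T),
        ‖cross (output (ξ τ) i) (cross (output (ξ τ) i) (U τ).V)‖)
    {e : Err n} (he : e ∉ exceptionSet ξ₀) (hr : ∀ i, min k₀ (1 / 2) < ((e i).2 : ℝ)) :
    e ∈ basin ξ₀ rlo k₀ k α ξ U := by
  rintro X₀ rfl
  have hε0 := eps_pos hk₀ hlo
  have hε : eps k₀ rlo < rlo := eps_lt hlo
  have h00 : (0 : ℝ) ∈ Ici (0 : ℝ) := mem_Ici.2 le_rfl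
  constructor
  -- r̂ = r̃ r > min(k₀, 1/2) r ≥ min(k₀, 1/2) rlo = ε.
  · have hinit : ∀ i, eps k₀ rlo < range (upsilon X₀ ξ₀) i := fun i => by
      have h1 : min k₀ (1 / 2) < range (upsilon X₀ ξ₀) i / range (ξ 0) i := hr i
      rw [lt_div_iff₀ (range_pos _ _)] at h1
      refine lt_of_le_of_lt ?_ h1
      exact mul_le_mul_of_nonneg_left ((hm i).lo 0 h00) (lt_min hk₀ one_half_pos).le
    have hne := (notMem_exceptionSet_iff ξ₀ (ξ 0) X₀).1 he
    choose M s hM0 hs0 hsol using fun i => exists_isLandmarkSolution hε0 hε (hk i) (hα i)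
      (norm_output ξ₀ i) (hm i) (M₀ := ((X₀.2 i).1 : Mat3) * ((ξ 0).P.R : Mat3).transpose)
      ((X₀.2 i).1 * (ξ 0).P.R⁻¹).2 (hinit i)
      (by rw [act_mul_worldBearing]; exact hne i)
    obtain ⟨Z, hZ0, hZ⟩ := exists_isObserverOn hξ hε0 X₀ hsol hM0 hs0
    refine ⟨Z, hZ0, hZ, fun Δ τ X hX0 hX t ht => funext fun i => ?_⟩
    have hsub : Icc 0 t ⊆ Ico 0 τ := fun x hx => ⟨hx.1, hx.2.trans_lt ht.2⟩
    have hJ : Ico 0 τ ⊆ Ici (0 : ℝ) := Ico_subset_Icc_self.trans Icc_subset_Ici_self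
    -- The landmark equation is the same for every Δ, so uniqueness on [0, t] compares the given
    -- observer with Z. Right multiplication by R_P then recovers Q̂ from M.
    obtain ⟨hM, hs⟩ := ((hX.isLandmarkSolution hξ hJ i).mono hsub).eqOn hε0 hε (hm i)
      ((hZ.isLandmarkSolution hξ subset_rfl i).mono Icc_subset_Ici_self)
      (by rw [hX0, hZ0]) (by rw [hX0, hZ0]) (right_mem_Icc.2 ht.1)
    refine Prod.ext (Subtype.ext ?_) (Subtype.ext ?_)
    · have := congrArg (· * ((ξ t).P.R : Mat3)) hM
      simpa only [Matrix.mul_assoc, transpose_mul_SO3, Matrix.mul_one] using this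
    · rw [range_upsilon, range_upsilon] at hs
      exact inv_injective (mul_right_cancel₀ (range_pos ξ₀ i).ne' hs)
  · intro Δ X hX0 hX
    refine tendsto_pi_nhds.2 fun i => ?_
    have hnorm : ∀ τ, ‖worldVelocity U ξ τ - inner ℝ (worldBearing ξ i τ) (worldVelocity U ξ τ) •
        worldBearing ξ i τ‖ = ‖cross (output (ξ τ) i) (cross (output (ξ τ) i) (U τ).V)‖ :=
      fun τ => by
        rw [norm_cross_cross (norm_output _ _), worldVelocity, worldBearing, inner_act_act,
          ← act_smul, ← act_sub, norm_act]
    obtain ⟨h1, h2⟩ := (hX.isLandmarkSolution hξ subset_rfl i).tendsto (hm i) hε0 hε (hk i) (hα i)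
      (norm_output ξ₀ i) (by simpa only [hnorm] using hpe i)
    refine Tendsto.prodMk_nhds (tendsto_subtype_rng.2 ?_) (tendsto_subtype_rng.2 h2)
    refine h1.congr fun t => ?_
    rw [act_mul_worldBearing, ← rho_inv]

theorem equilibrium_notMem_exceptionSet (ξ₀ : TotalSpace n) :
    equilibrium ξ₀ ∉ exceptionSet ξ₀ := by
  rintro ⟨i, hi⟩
  refine (one_add_inner_ne_zero_iff (norm_output ξ₀ i) (norm_output ξ₀ i)).1 ?_ hi
  rw [real_inner_self_eq_norm_sq, norm_output]
  norm_num

theorem isClosed_exceptionSet (ξ₀ : TotalSpace n) : IsClosed (exceptionSet ξ₀) := by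
  have : exceptionSet ξ₀ = ⋃ i, {e : Err n | ((e i).1 : E3) = -(output ξ₀ i : E3)} := by
    ext e; simp [exceptionSet]
  rw [this]
  exact isClosed_iUnion_of_finite fun i => isClosed_eq (by fun_prop) continuous_const

/-- The source of k₀: each range ratio attains a positive minimum on K, and k₀ is chosen strictly
below all of them. -/
theorem exists_lt_snd_of_isCompact {K : Set (Err n)} (hK : IsCompact K) :
    ∃ k₀ > 0, ∀ e ∈ K, ∀ i, k₀ < ((e i).2 : ℝ) := by
  have h : ∀ i : Fin n, ∃ m : ℝ, 0 < m ∧ ∀ e ∈ K, m ≤ ((e i).2 : ℝ) := fun i => by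
    rcases K.eq_empty_or_nonempty with rfl | hne
    · exact ⟨1, one_pos, by simp⟩
    · obtain ⟨e, he, hmin⟩ := hK.exists_isMinOn hne
        (f := fun e : Err n => ((e i).2 : ℝ)) (by fun_prop)
      exact ⟨_, (e i).2.2, fun e' he' => hmin he'⟩
  choose m hm0 hm using h
  obtain ⟨κ, hκ0, hκ⟩ := exists_pos_forall_le hm0
  exact ⟨κ, hκ0, fun e he i => (hκ i).trans_le (hm i e he)⟩

end

end VSLAM

end

/-! ### The main theorem -/

theorem mainTheorem1 (n : ℕ) (ξ₀ : VSLAM.TotalSpace n) (rlo rhi : ℝ) (hlo : 0 < rlo)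
    (hhi : rlo < rhi) (k α : Fin n → ℝ) (hk : ∀ i, 0 < k i) (hα : ∀ i, 0 < α i) :
    VSLAM.errMeasure n (VSLAM.exceptionSet ξ₀) = 0 ∧
    ∀ K : Set (VSLAM.Err n), IsCompact K → K ⊆ (VSLAM.exceptionSet ξ₀)ᶜ →
      ∃ k₀ : ℝ, 0 < k₀ ∧
        ∀ (U : ℝ → VSLAM.Twist) (ξ : ℝ → VSLAM.TotalSpace n),
          VSLAM.IsSystemTrajectory U ξ →
          ContinuousOn (fun t => (U t).Ω) (Ici 0) →
          UniformContinuousOn (fun t => (U t).V) (Ici 0) →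
          (∃ C : ℝ, ∀ t, 0 ≤ t → ‖(U t).Ω‖ ≤ C ∧ ‖(U t).V‖ ≤ C) →
          (∀ t, 0 ≤ t → ∀ i, rlo ≤ VSLAM.range (ξ t) i ∧ VSLAM.range (ξ t) i ≤ rhi) →
          (∀ i, ∃ T μ : ℝ, 0 < T ∧ 0 < μ ∧ ∀ t, 0 < t →
            μ ≤ 1 / T * ∫ s in t..(t + T),
              ‖VSLAM.cross (VSLAM.output (ξ s) i)
                (VSLAM.cross (VSLAM.output (ξ s) i) (U s).V)‖) →
          -- the equilibrium is asymptotically stable with basin of attraction containing `K`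
          VSLAM.IsStable ξ₀ rlo k₀ k α ξ U ∧
          VSLAM.basin ξ₀ rlo k₀ k α ξ U ∈ 𝓝 (VSLAM.equilibrium ξ₀) ∧
          K ⊆ VSLAM.basin ξ₀ rlo k₀ k α ξ U ∧
          -- as the error converges, so does the state estimate, up to equivalence
          (∀ (Δ : VSLAM.PoseInnovation n) (Xhat : ℝ → VSLAM.Grp n),
            VSLAM.IsObserverOn ξ₀ rlo k₀ k α Δ ξ U (Ici 0) Xhat →
            Tendsto (fun t => VSLAM.err ξ₀ (ξ t) (Xhat t)) atTop
              (𝓝 (VSLAM.equilibrium ξ₀)) →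
            VSLAM.ConvergesUpToEquiv (fun t => VSLAM.upsilon (Xhat t) ξ₀) ξ) ∧
          -- the two expressions of the output error agree along the lifted system
          (∀ X : ℝ → VSLAM.Grp n, VSLAM.IsLiftedTrajectory ξ₀ U X →
            VSLAM.upsilon (X 0) ξ₀ = ξ 0 →
            ∀ t, 0 ≤ t → ∀ Xhat : VSLAM.Grp n,
              VSLAM.rho Xhat⁻¹ (VSLAM.output (ξ t)) =
                VSLAM.rho (X t * Xhat⁻¹) (VSLAM.output ξ₀)) := by
  refine ⟨VSLAM.errMeasure_exceptionSet ξ₀, fun K hK hKχ => ?_⟩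
  obtain ⟨k₀, hk₀, hk₀K⟩ := VSLAM.exists_lt_snd_of_isCompact hK
  refine ⟨k₀, hk₀, fun U ξ hξ _ hV ⟨C, hC⟩ hr hpe => ?_⟩
  have hm := fun i => VSLAM.isMotion hξ hV hC hr i
  refine ⟨VSLAM.isStable hlo hk hα hk₀ hξ hm, ?_, fun e he => ?_, fun Δ Xhat _ hlim => ?_,
    fun X hX h0 t ht Xhat => VSLAM.rho_inv_output_eq hξ hX h0 ht Xhat⟩
  -- However large k₀ is, the relative threshold min(k₀, 1/2) stays below 1, the range ratio at the
  -- equilibrium; so a full neighbourhood of the equilibrium satisfies the hypotheses of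
  -- `mem_basin`.
  · have hopen : IsOpen {e : VSLAM.Err n | ∀ i, min k₀ (1 / 2) < ((e i).2 : ℝ)} := by
      simp only [ofPred_forall]
      exact isOpen_iInter_of_finite fun i => isOpen_lt continuous_const (by fun_prop)
    filter_upwards [(VSLAM.isClosed_exceptionSet ξ₀).isOpen_compl.mem_nhds
      (VSLAM.equilibrium_notMem_exceptionSet ξ₀), hopen.mem_nhds (x := VSLAM.equilibrium ξ₀)
      (fun i => (min_le_right k₀ (1 / 2)).trans_lt one_half_lt_one)] with e he1 he2
    exact VSLAM.mem_basin hlo hk hα hk₀ hξ hm hpe he1 he2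
  · exact VSLAM.mem_basin hlo hk hα hk₀ hξ hm hpe (hKχ he)
      fun i => (min_le_left _ _).trans_lt (hk₀K e he i)
  · exact VSLAM.convergesUpToEquiv_of_tendsto_err (fun t ht i => (hr t ht i).2) hlim
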